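/- Let $k$ be a field, let $A$ and $B$ be (not necessarily finite dimensional) $k$-algebras, let $M$ be a $B$-$A$-bimodule and $N$ an $A$-$B$-bimodule, with $k$ acting centrally. Put $\mathbb A=A\times B$ and let $\mathbb M=M\oplus N$ be the $\mathbb A$-bimodule with actions $(a,b)(m,n)=(bm,an)$ and $(m,n)(a,b)=(ma,nb)$. The null-square algebra is $$\Lambda=\begin{pmatrix}A&N\\ M&B\end{pmatrix}$$ with matrix multiplication in which the products $M\cdot N$ and $N\cdot M$ are zero; it contains $\mathbb A$ as its diagonal subalgebra, and the projection $\Lambda\to\mathbb A$ which kills $M$ and $N$ is a homomorphism of algebras. Suppose that $\mathbb M$ is projective as an $\mathbb A$-bimodule. For a $k$-algebra $R$, write $\mathrm{HH}^n(R)=\mathrm{Ext}^n_{R\otimes_k R^{\mathrm{op}}}(R,R)$, write $\mathrm{Hom}_{\mathbb A-\mathbb A}$ for homomorphisms of bimodules, and write $\mathbb M^{\otimes_{\mathbb A} n}$ for the $n$-fold tensor power over $\mathbb A$. For every integer $m>0$ there is an exact sequence of $k$-vector spaces $$0\to \mathrm{HH}^{2m}(\Lambda)\to \mathrm{HH}^{2m}(\mathbb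 A)\oplus \mathrm{Hom}_{\mathbb A-\mathbb A}\left(\mathbb M^{\otimes_{\mathbb A}2m},\mathbb A\right)\xrightarrow{\nabla_{2m}}\mathrm{Hom}_{\mathbb A-\mathbb A}\left(\mathbb M^{\otimes_{\mathbb A}2m+1},\mathbb M\right)\to \mathrm{HH}^{2m+1}(\Lambda)\to \mathrm{HH}^{2m+1}(\mathbb A)\to 0,$$ and for $m=0$ there is an exact sequence of $k$-vector spaces $$0\to \mathrm{HH}^{0}(\Lambda)\to \mathrm{HH}^{0}(\mathbb A)\xrightarrow{\nabla_0}\mathrm{End}_{\mathbb A-\mathbb A}\mathbb M\to \mathrm{HH}^{1}(\Lambda)\to \mathrm{HH}^{1}(\mathbb A)\to 0.$$ In both sequences the maps (respectively components of maps) $\mathrm{HH}^{n}(\Lambda)\to \mathrm{HH}^{n}(\mathbb A)$ are the canonical ones, given by restricting $\Lambda$-bimodules to $\mathbb A$-bimodules and composing with the inclusion $\mathbb A\to\Lambda$ and the projection $\Lambda\to\mathbb A$. The maps $\nabla$ are the commutators with the identity of $\mathbb M$: for $m>0$, $$\nabla_{2m}(c,\varphi)(x_0\otimes\cdots\otimes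 x_{2m})=x_0\,\varphi(x_1\otimes\cdots\otimes x_{2m})-\varphi(x_0\otimes\cdots\otimes x_{2m-1})\,x_{2m},$$ and $\nabla_0(z)(x)=xz-zx$, where $\mathrm{HH}^0(\mathbb A)=\mathrm{End}_{\mathbb A-\mathbb A}(\mathbb A)$ is identified with the center of $\mathbb A$ through $f\mapsto f(1)$. -/

import Mathlib

open CategoryTheory CategoryTheory.Abelian
open MulOpposite (op)
open scoped TensorProduct ModuleCat

universe u

noncomputable section

namespace HH

/-! ### Bimodules over a `k`-algebra -/

section Bimodules

variable (k : Type u) [Field k] (R : Type u) [Ring R] [Algebra k R]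

/-- The enveloping algebra `R ⊗ₖ Rᵒᵖ`. -/
abbrev Env : Type u := R ⊗[k] Rᵐᵒᵖ

/-- The category of `R`-bimodules on which `k` acts centrally, that is, of left modules over the
enveloping algebra. -/
abbrev BimodCat : Type (u + 1) := ModuleCat.{u} (Env k R)

/-- An abelian group with commuting left and right actions of `R`, as a module over the enveloping
algebra: `(a ⊗ b) • x = a x b`. -/
def ofBimod (X : Type u) [AddCommGroup X] [Module k X] [Module R X] [Module Rᵐᵒᵖ X]
    [SMulCommClass R Rᵐᵒᵖ X] [IsScalarTower k R X] [IsScalarTower k Rᵐᵒᵖ X] : BimodCat k R :=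
  letI : Module (Env k R) X := TensorProduct.Algebra.module
  ModuleCat.of (Env k R) X

/-- The algebra `R`, as a bimodule over itself. -/
def regular : BimodCat k R := ofBimod k R R

variable {k R}

/-- The element `x` of an unbundled bimodule, as an element of the associated object. -/
def toBimod {X : Type u} [AddCommGroup X] [Module k X] [Module R X] [Module Rᵐᵒᵖ X]
    [SMulCommClass R Rᵐᵒᵖ X] [IsScalarTower k R X] [IsScalarTower k Rᵐᵒᵖ X] (x : X) :
    ofBimod k R X := x

/-- The inverse of `toBimod`. -/
def unBimod {X : Type u} [AddCommGroup X] [Module k X] [Module R X] [Module Rᵐᵒᵖ X]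
    [SMulCommClass R Rᵐᵒᵖ X] [IsScalarTower k R X] [IsScalarTower k Rᵐᵒᵖ X]
    (x : ofBimod k R X) : X := x

/-- The element `r` of `R`, as an element of the regular bimodule. -/
def toReg (r : R) : regular k R := r

/-- The inverse of `toReg`. -/
def unReg (r : regular k R) : R := r

theorem tmul_smul_toBimod {X : Type u} [AddCommGroup X] [Module k X] [Module R X]
    [Module Rᵐᵒᵖ X] [SMulCommClass R Rᵐᵒᵖ X] [IsScalarTower k R X] [IsScalarTower k Rᵐᵒᵖ X]
    (a : R) (b : Rᵐᵒᵖ) (x : X) :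
    (a ⊗ₜ[k] b : Env k R) • (toBimod x : ofBimod k R X) = toBimod (a • b • x) :=
  TensorProduct.Algebra.smul_def a b x

theorem tmul_smul_toReg (a b x : R) :
    (a ⊗ₜ[k] op b : Env k R) • (toReg x : regular k R) = toReg (a * (x * b)) :=
  TensorProduct.Algebra.smul_def a (op b) x

/-! ### Tensor products over `R` -/

/-- The space `X ⊗ₖ Y` underlying the outer tensor product of two bimodules. -/
def OuterTensor (X Y : BimodCat k R) : Type u := X ⊗[k] Y

instance (X Y : BimodCat k R) : AddCommGroup (OuterTensor X Y) :=
  inferInstanceAs (AddCommGroup (X ⊗[k] Y))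

/-- `a ⊗ b` acts on `X ⊗ₖ Y` through the left action of `a` on `X` and the right action of `b`
on `Y`. -/
def outerAction (X Y : BimodCat k R) : Env k R →ₐ[k] Module.End k (X ⊗[k] Y) :=
  (Module.endTensorEndAlgHom (R := k) (A := k) (M := X) (N := Y)).comp
    (Algebra.TensorProduct.map
      ((Algebra.lsmul k k X).comp (Algebra.TensorProduct.includeLeft : R →ₐ[k] Env k R))
      ((Algebra.lsmul k k Y).comp (Algebra.TensorProduct.includeRight : Rᵐᵒᵖ →ₐ[k] Env k R)))

instance (X Y : BimodCat k R) : Module (Env k R) (OuterTensor X Y) :=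
  Module.compHom (X ⊗[k] Y) (outerAction X Y).toRingHom

/-- The pure tensor `x ⊗ y` in `X ⊗ₖ Y`. -/
def outerTmul {X Y : BimodCat k R} (x : X) (y : Y) : OuterTensor X Y := x ⊗ₜ[k] y

theorem smul_outerTmul {X Y : BimodCat k R} (a : R) (b : Rᵐᵒᵖ) (x : X) (y : Y) :
    (a ⊗ₜ[k] b : Env k R) • outerTmul x y =
      outerTmul ((a ⊗ₜ[k] (1 : Rᵐᵒᵖ) : Env k R) • x) (((1 : R) ⊗ₜ[k] b : Env k R) • y) :=
  rfl

/-- The sub-bimodule generated by the elements `x r ⊗ y - x ⊗ r y`. -/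
def balancing (X Y : BimodCat k R) : Submodule (Env k R) (OuterTensor X Y) :=
  Submodule.span (Env k R)
    {t | ∃ (x : X) (r : R) (y : Y),
      t = outerTmul (((1 : R) ⊗ₜ[k] op r : Env k R) • x) y
        - outerTmul x ((r ⊗ₜ[k] (1 : Rᵐᵒᵖ) : Env k R) • y)}

/-- The tensor product `X ⊗_R Y` of two bimodules. -/
def tensor (X Y : BimodCat k R) : BimodCat k R :=
  ModuleCat.of (Env k R) (OuterTensor X Y ⧸ balancing X Y)

/-- The pure tensor `x ⊗ y` in `X ⊗_R Y`. -/
def tmul {X Y : BimodCat k R} (x : X) (y : Y) : tensor X Y :=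
  (balancing X Y).mkQ (outerTmul x y)

/-- The tensor power `X ⊗_R ⋯ ⊗_R X` with `n` factors; it is `R` for `n = 0`. -/
def tensorPower (X : BimodCat k R) : ℕ → BimodCat k R
  | 0 => regular k R
  | n + 1 => tensor X (tensorPower X n)

/-- The pure tensor `x₀ ⊗ ⋯ ⊗ xₙ₋₁`. -/
def pureTensor (X : BimodCat k R) : (n : ℕ) → (Fin n → X) → tensorPower X n
  | 0, _ => toReg 1
  | n + 1, x => tmul (x 0) (pureTensor X n (Fin.tail x))

end Bimodules

/-! ### Hochschild cohomology -/

section Hochschild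

variable (k : Type u) [Field k] (R : Type u) [Ring R] [Algebra k R]

/-- `HHⁿ(R) = Extⁿ(R, R)` over the enveloping algebra of `R`. -/
abbrev HHCohomology (n : ℕ) : Type u := Ext (regular k R) (regular k R) n

variable {k R} {S : Type u} [Ring S] [Algebra k S]

/-- The homomorphism of enveloping algebras induced by a homomorphism of algebras. -/
def envMap (i : R →ₐ[k] S) : Env k R →ₐ[k] Env k S :=
  Algebra.TensorProduct.map i (AlgHom.op i)

/-- The restriction of bimodules along a homomorphism of algebras. -/
abbrev restrictBimod (i : R →ₐ[k] S) : BimodCat k S ⥤ BimodCat k R :=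
  ModuleCat.restrictScalars (envMap i).toRingHom

instance (i : R →ₐ[k] S) : Limits.PreservesFiniteLimits (restrictBimod i) :=
  ⟨fun _ _ _ => ⟨fun {_} => inferInstance⟩⟩

theorem inclusion_smul (i : R →ₐ[k] S) (e : Env k R) (x : R) :
    i (unReg (e • (toReg x : regular k R))) =
      unReg (envMap i e • (toReg (i x) : regular k S)) := by
  induction e using TensorProduct.induction_on with
  | zero =>
    rw [map_zero]
    exact ((congrArg (fun y => i (unReg y)) (zero_smul (Env k R) (toReg x : regular k R))).trans
      (map_zero i)).trans (zero_smul (Env k S) (toReg (i x) : regular k S)).symm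
  | add e f he hf =>
    rw [map_add, add_smul, add_smul]
    exact (map_add i _ _).trans (congrArg₂ (· + ·) he hf)
  | tmul a b =>
    change i (a * (x * b.unop)) = i a * (i x * i b.unop)
    simp only [map_mul]

theorem retraction_smul (i : R →ₐ[k] S) (p : S →ₐ[k] R) (h : ∀ r, p (i r) = r) (e : Env k R)
    (x : S) :
    p (unReg (envMap i e • (toReg x : regular k S))) =
      unReg (e • (toReg (p x) : regular k R)) := by
  induction e using TensorProduct.induction_on with
  | zero =>
    rw [map_zero]
    exact ((congrArg (fun y => p (unReg y)) (zero_smul (Env k S) (toReg x : regular k S))).trans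
      (map_zero p)).trans (zero_smul (Env k R) (toReg (p x) : regular k R)).symm
  | add e f he hf =>
    rw [map_add, add_smul, add_smul]
    exact (map_add p _ _).trans (congrArg₂ (· + ·) he hf)
  | tmul a b =>
    change p (i a * (x * i b.unop)) = a * (p x * b.unop)
    simp only [map_mul, h]

/-- A homomorphism of algebras `i : R → S` is a homomorphism of `R`-bimodules. -/
def inclusionHom (i : R →ₐ[k] S) :
    regular k R ⟶ (restrictBimod i).obj (regular k S) :=
  ModuleCat.ofHom (X := regular k R) (Y := (restrictBimod i).obj (regular k S))
    { toFun := fun r => (toReg (i (unReg r)) : regular k S)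
      map_add' := fun x y => map_add i (unReg x) (unReg y)
      map_smul' := fun e x => inclusion_smul i e (unReg x) }

/-- A homomorphism of algebras `p : S → R` with `p ∘ i = id` is a homomorphism of `R`-bimodules,
where `R` acts on `S` through `i`. -/
def retractionHom (i : R →ₐ[k] S) (p : S →ₐ[k] R) (h : ∀ r, p (i r) = r) :
    (restrictBimod i).obj (regular k S) ⟶ regular k R :=
  ModuleCat.ofHom (X := (restrictBimod i).obj (regular k S)) (Y := regular k R)
    { toFun := fun s => toReg (p (unReg (k := k) (R := S) s))
      map_add' := fun x y => map_add p (unReg (k := k) (R := S) x) (unReg (k := k) (R := S) y)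
      map_smul' := fun e x => retraction_smul i p h e (unReg (k := k) (R := S) x) }

/-- Let `R` be a retract of the algebra `S`, with inclusion `i` and retraction `p`. The induced map
`HHⁿ(S) → HHⁿ(R)` restricts an extension of `S`-bimodules to an extension of `R`-bimodules and
composes it with `i` and `p`; on Hochschild cochains it is `f ↦ p ∘ f ∘ i^{⊗ n}`. -/
def retractMap (i : R →ₐ[k] S) (p : S →ₐ[k] R) (h : ∀ r, p (i r) = r) (n : ℕ)
    (x : HHCohomology k S n) : HHCohomology k R n :=
  ((Ext.mk₀ (inclusionHom i)).comp (x.mapExactFunctor (restrictBimod i)) (zero_add n)).comp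
    (Ext.mk₀ (retractionHom i p h)) (add_zero n)

end Hochschild

/-! ### Null-square algebras -/

section NullSquare

/-- The direct sum `M ⊕ N` of the two corner bimodules: `M` is a `B`-`A`-bimodule and `N` an
`A`-`B`-bimodule. -/
def Corners (M N : Type u) : Type u := M × N

variable (k : Type u) [Field k] (A B M N : Type u) [Ring A] [Ring B] [Algebra k A] [Algebra k B]
  [AddCommGroup M] [Module k M] [Module B M] [Module Aᵐᵒᵖ M] [SMulCommClass B Aᵐᵒᵖ M]
  [IsScalarTower k B M] [IsScalarTower k Aᵐᵒᵖ M]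
  [AddCommGroup N] [Module k N] [Module A N] [Module Bᵐᵒᵖ N] [SMulCommClass A Bᵐᵒᵖ N]
  [IsScalarTower k A N] [IsScalarTower k Bᵐᵒᵖ N]

instance : AddCommGroup (Corners M N) := inferInstanceAs (AddCommGroup (M × N))

instance : Module k (Corners M N) := inferInstanceAs (Module k (M × N))

/-- `(a, b) (m, n) = (b m, a n)`. -/
instance : Module (A × B) (Corners M N) where
  smul c x := ((c.2 • x.1, c.1 • x.2) : M × N)
  one_smul x := Prod.ext (one_smul B x.1) (one_smul A x.2)
  mul_smul c d x := Prod.ext (mul_smul c.2 d.2 x.1) (mul_smul c.1 d.1 x.2)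
  smul_zero c := Prod.ext (smul_zero c.2) (smul_zero c.1)
  smul_add c x y := Prod.ext (smul_add c.2 x.1 y.1) (smul_add c.1 x.2 y.2)
  add_smul c d x := Prod.ext (add_smul c.2 d.2 x.1) (add_smul c.1 d.1 x.2)
  zero_smul x := Prod.ext (zero_smul B x.1) (zero_smul A x.2)

/-- `(m, n) (a, b) = (m a, n b)`. -/
instance : Module (A × B)ᵐᵒᵖ (Corners M N) where
  smul c x := ((op c.unop.1 • x.1, op c.unop.2 • x.2) : M × N)
  one_smul x := Prod.ext (one_smul Aᵐᵒᵖ x.1) (one_smul Bᵐᵒᵖ x.2)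
  mul_smul c d x := Prod.ext (mul_smul (op c.unop.1) (op d.unop.1) x.1)
    (mul_smul (op c.unop.2) (op d.unop.2) x.2)
  smul_zero c := Prod.ext (smul_zero (op c.unop.1)) (smul_zero (op c.unop.2))
  smul_add c x y := Prod.ext (smul_add (op c.unop.1) x.1 y.1) (smul_add (op c.unop.2) x.2 y.2)
  add_smul c d x := Prod.ext (add_smul (op c.unop.1) (op d.unop.1) x.1)
    (add_smul (op c.unop.2) (op d.unop.2) x.2)
  zero_smul x := Prod.ext (zero_smul Aᵐᵒᵖ x.1) (zero_smul Bᵐᵒᵖ x.2)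

instance : SMulCommClass (A × B) (A × B)ᵐᵒᵖ (Corners M N) where
  smul_comm c d x := Prod.ext (smul_comm c.2 (op d.unop.1) x.1) (smul_comm c.1 (op d.unop.2) x.2)

instance : IsScalarTower k (A × B) (Corners M N) where
  smul_assoc t c x := Prod.ext (smul_assoc t c.2 x.1) (smul_assoc t c.1 x.2)

instance : IsScalarTower k (A × B)ᵐᵒᵖ (Corners M N) where
  smul_assoc t c x := Prod.ext (smul_assoc t (op c.unop.1) x.1) (smul_assoc t (op c.unop.2) x.2)

/-- The null-square algebra of matrices `(A N; M B)`, that is, the trivial extension of `A × B` by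
the bimodule `M ⊕ N`; see `matrix_mul_matrix` for its product. -/
abbrev NullSquare : Type u := TrivSqZeroExt (A × B) (Corners M N)

variable {A B M N}

/-- The matrix with rows `(a, n)` and `(m, b)`. -/
def matrix (a : A) (n : N) (m : M) (b : B) : NullSquare A B M N := ((a, b), ((m, n) : M × N))

set_option linter.unusedSectionVars false in
theorem matrix_mul_matrix (a a' : A) (n n' : N) (m m' : M) (b b' : B) :
    (matrix a n m b * matrix a' n' m' b' : NullSquare A B M N) =
      matrix (a * a') (a • n' + op b' • n) (b • m' + op a' • m) (b * b') :=
  rfl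

variable (A B M N)

/-- The restriction map `HHⁿ(Λ) → HHⁿ(A × B)` given by the diagonal `A × B ⊆ Λ` and the projection
`Λ → A × B` that kills the corners. -/
def diagonalMap (n : ℕ) :
    HHCohomology k (NullSquare A B M N) n → HHCohomology k (A × B) n :=
  retractMap (TrivSqZeroExt.inlAlgHom k (A × B) (Corners M N))
    (TrivSqZeroExt.fstHom k (A × B) (Corners M N)) (fun _ => rfl) n

end NullSquare

end HH

end

/-!
Write `R = A × B`, `X = M ⊕ N` and `S = R ⊕ X` for the null-square algebra, a trivial extension in
which `X` has square zero. Only three features of this situation matter: `X` is projective as a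
bimodule, and multiplication by the central idempotent `e = (1, 0)` from the left and from the right
are complementary projections of `X`. The proof compares `HH(S)` with `HH(R)` and with the
homomorphisms out of the tensor powers of `X`.

*Resolution.* The induced bimodules `Bₙ = S ⊗_R X^{⊗n} ⊗_R S` form the relative bar resolution of
`S` (`bar`). Over `R` they split into the four summands `X^{⊗n}`, `X^{⊗(n+1)}` (twice) and
`X^{⊗(n+2)}`, and the syzygies `Qₙ` are `X^{⊗n} ⊕ X^{⊗(n+1)}` with an explicit action of `X`
(`syzygy`, `barSequence_shortExact`); `Q₀` is `S` itself. Since `X` is projective, `X^{⊗n}` and thus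
`Bₙ` are projective for `n > 0` (`tensorPower_projective`, `bar_projective`). The term `B₀` is not
projective, but restriction along `R → S` preserves injective bimodules
(`RightProjective.injective`, `rightProjective_envMap`), so that `Extⁿ(B₀, S)` embeds in
`Extⁿ(R, S)` over `R` (`ext_bar_eq_zero`). The central element `e ⊗ 1 - 1 ⊗ e` of the enveloping
algebra acts as zero on `R` and as an involution on `X`; therefore `Extⁿ(R, X) = 0` and `Extⁿ(R, S)`
embeds in `HHⁿ(R)` (`ext_regular_eq_zero`, `eq_zero_of_comp_fstHom`).

*Surjectivity.* The map `HHⁿ(S) → HHⁿ(R)` is surjective for `n > 0` (`retract_surjective`). A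
class `ξ` of `HHⁿ(R)`, restricted along `S → R`, lifts to `Extⁿ(R, S)` if its product with the class
of `0 → X → S → R → 0` vanishes. That extension is a pullback, along `r ↦ (· r, r ·)`, of an
extension of `S`-bimodules whose quotient comes from the `R`-bimodule `End X` of pairs of one-sided
endomorphisms of `X`, and `Extⁿ(R, End X) = 0` over `R` because `X` is projective
(`ext_endBimod_eq_zero`).

*Long exact sequence.* It follows that the kernel of `HHⁿ(S) → HHⁿ(R)`, for `n > 0`, is the quotient
of `Hom(Qₙ, S)` by the homomorphisms that factor through `Bₙ₋₁` (`exists_syzygyClass_comp`,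
`syzygyClass_comp_mk₀_eq_zero_iff`).

*Parity.* Left and right multiplication by `e` coincide on `R` and on the even tensor powers of `X`,
and are complementary on the odd ones (`pow_parity`). So there are no homomorphisms from odd powers
to `R` or from even powers to `X`. For odd `n` this identifies `Hom(Qₙ, S)` with `Hom(X^{⊗n}, X)`
(`exists_cornerHom`), and the homomorphisms through `Bₙ₋₁` with the commutators of maps
`X^{⊗(n-1)} → R` with the identity of `X` (`commutator_exact`). For even `n` it identifies
`Hom(Qₙ, S)` with the kernel of the commutator map on `Hom(X^{⊗n}, R)` (`diagonalHom_exact`), and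
nothing but zero factors through `Bₙ₋₁` (`syzygyIncl_comp_eq_zero`). In even degrees, a linear
splitting of the resulting short exact sequence gives the first map of the theorem
(`exists_exact_splice`).
-/

noncomputable section

namespace HH

/-! ### The two actions on a bimodule -/

section Actions

variable {k : Type u} [Field k] {R : Type u} [Ring R] [Algebra k R]

/-- The left action of `R` on a module over the enveloping algebra. -/
instance leftModule (Y : BimodCat k R) : Module R Y :=
  Module.compHom Y (Algebra.TensorProduct.includeLeft : R →ₐ[k] Env k R).toRingHom

/-- The right action of `R` on a module over the enveloping algebra. -/
instance rightModule (Y : BimodCat k R) : Module Rᵐᵒᵖ Y :=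
  Module.compHom Y (Algebra.TensorProduct.includeRight : Rᵐᵒᵖ →ₐ[k] Env k R).toRingHom

variable {Y Z : BimodCat k R}

theorem env_induction {p : Env k R → Prop} (h0 : p 0) (hadd : ∀ a b, p a → p b → p (a + b))
    (ht : ∀ (a : R) (b : R), p (a ⊗ₜ op b)) (e : Env k R) : p e :=
  TensorProduct.induction_on e h0 (fun a b => ht a b.unop) hadd

theorem left_smul_def (r : R) (y : Y) : r • y = (r ⊗ₜ[k] (1 : Rᵐᵒᵖ) : Env k R) • y := rfl

theorem right_smul_def (r : Rᵐᵒᵖ) (y : Y) : r • y = ((1 : R) ⊗ₜ[k] r : Env k R) • y := rfl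

theorem tmul_smul (a : R) (b : Rᵐᵒᵖ) (y : Y) : (a ⊗ₜ[k] b : Env k R) • y = a • b • y := by
  rw [left_smul_def, right_smul_def, smul_smul]
  simp

instance (Y : BimodCat k R) : SMulCommClass R Rᵐᵒᵖ Y where
  smul_comm a b y := by
    rw [← tmul_smul, left_smul_def, right_smul_def, smul_smul]
    simp

instance (Y : BimodCat k R) : IsScalarTower k R Y where
  smul_assoc c r y := by
    rw [left_smul_def, left_smul_def, ← TensorProduct.smul_tmul', smul_assoc]

instance (Y : BimodCat k R) : IsScalarTower k Rᵐᵒᵖ Y where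
  smul_assoc c r y := by
    rw [right_smul_def, right_smul_def, TensorProduct.tmul_smul, smul_assoc]

/-- An additive map that commutes with both actions is a homomorphism of bimodules. -/
def bimodHom (f : Y →+ Z) (hl : ∀ (r : R) y, f (r • y) = r • f y)
    (hr : ∀ (r : R) y, f (op r • y) = op r • f y) : Y ⟶ Z :=
  ModuleCat.ofHom
    { f with
      map_smul' := fun e y => by
        change f (e • y) = e • f y
        induction e using env_induction with
        | h0 =>
          exact (congrArg f (zero_smul (Env k R) y)).trans
            ((map_zero f).trans (zero_smul (Env k R) (f y)).symm)
        | hadd e e' h h' => rw [add_smul, add_smul, map_add, h, h']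
        | ht a b => rw [tmul_smul, tmul_smul, hl, hr] }

theorem hom_left_smul (f : Y ⟶ Z) (r : R) (y : Y) : f (r • y) = r • f y :=
  f.hom.map_smul _ y

theorem hom_right_smul (f : Y ⟶ Z) (r : Rᵐᵒᵖ) (y : Y) : f (r • y) = r • f y :=
  f.hom.map_smul _ y

section OfBimod

variable {V : Type u} [AddCommGroup V] [Module k V] [Module R V] [Module Rᵐᵒᵖ V]
  [SMulCommClass R Rᵐᵒᵖ V] [IsScalarTower k R V] [IsScalarTower k Rᵐᵒᵖ V]

@[simp] theorem left_smul_toBimod (r : R) (v : V) :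
    r • (toBimod v : ofBimod k R V) = toBimod (r • v) := by
  rw [left_smul_def, tmul_smul_toBimod, one_smul]

@[simp] theorem right_smul_toBimod (r : Rᵐᵒᵖ) (v : V) :
    r • (toBimod v : ofBimod k R V) = toBimod (r • v) := by
  rw [right_smul_def, tmul_smul_toBimod, one_smul]

end OfBimod

@[simp] theorem left_smul_toReg (r s : R) : r • (toReg s : regular k R) = toReg (r * s) :=
  left_smul_toBimod r s

@[simp] theorem right_smul_toReg (r s : R) : op r • (toReg s : regular k R) = toReg (s * r) :=
  right_smul_toBimod (op r) s

variable {S : Type u} [Ring S] [Algebra k S]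

theorem left_smul_restrict (i : R →ₐ[k] S) (W : BimodCat k S) (r : R) (w : W) :
    r • (show (restrictBimod i).obj W from w) = (i r • w : W) := by
  refine congrArg (fun e : Env k S => e • w) ?_
  change envMap i (r ⊗ₜ 1) = i r ⊗ₜ 1
  simp [envMap]

theorem right_smul_restrict (i : R →ₐ[k] S) (W : BimodCat k S) (r : R) (w : W) :
    op r • (show (restrictBimod i).obj W from w) = (op (i r) • w : W) := by
  refine congrArg (fun e : Env k S => e • w) ?_
  change envMap i (1 ⊗ₜ op r) = 1 ⊗ₜ op (i r)
  simp [envMap]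

end Actions

/-! ### Maps out of tensor products over `R` -/

section Tensor

variable {k : Type u} [Field k] {R : Type u} [Ring R] [Algebra k R]
variable {Y Y' Z : BimodCat k R} {G : Type*} [AddCommGroup G]

theorem tensor_induction {p : tensor Y Y' → Prop} (h0 : p 0) (hadd : ∀ a b, p a → p b → p (a + b))
    (ht : ∀ y y', p (tmul y y')) (t : tensor Y Y') : p t := by
  obtain ⟨t, rfl⟩ := (balancing Y Y').mkQ_surjective t
  change Y ⊗[k] Y' at t
  induction t using TensorProduct.induction_on with
  | zero => exact h0
  | add a b ha hb => exact (map_add (balancing Y Y').mkQ (a : OuterTensor Y Y') b) ▸ hadd _ _ ha hb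
  | tmul a b => exact ht a b

/-- The map `(y, y') ↦ y ⊗ y'`. -/
def tmulHom (Y Y' : BimodCat k R) : Y →+ Y' →+ tensor Y Y' :=
  AddMonoidHom.mk' (fun y => AddMonoidHom.mk' (fun y' => tmul y y')
    (fun a b => (congrArg (balancing Y Y').mkQ (TensorProduct.tmul_add y a b)).trans
      (map_add (balancing Y Y').mkQ (outerTmul y a) (outerTmul y b))))
    (fun a b => by
      ext y'
      exact (congrArg (balancing Y Y').mkQ (TensorProduct.add_tmul a b y')).trans
        (map_add (balancing Y Y').mkQ (outerTmul a y') (outerTmul b y')))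

theorem tmulHom_apply (y : Y) (y' : Y') : tmulHom Y Y' y y' = tmul y y' := rfl

theorem left_smul_tmul (r : R) (y : Y) (y' : Y') : r • tmul y y' = tmul (r • y) y' := by
  rw [left_smul_def]
  refine (map_smul (balancing Y Y').mkQ _ _).symm.trans ?_
  rw [smul_outerTmul, ← right_smul_def, one_smul]
  rfl

theorem right_smul_tmul (r : Rᵐᵒᵖ) (y : Y) (y' : Y') : r • tmul y y' = tmul y (r • y') := by
  rw [right_smul_def]
  refine (map_smul (balancing Y Y').mkQ _ _).symm.trans ?_
  rw [smul_outerTmul, ← left_smul_def, one_smul]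
  rfl

theorem tmul_balanced (y : Y) (r : R) (y' : Y') : tmul (op r • y) y' = tmul y (r • y') :=
  (Submodule.Quotient.eq _).2 (Submodule.subset_span ⟨y, r, y', rfl⟩)

theorem tensor_addHom_ext {f g : tensor Y Y' →+ G}
    (h : ∀ y y', f (tmul y y') = g (tmul y y')) (t : tensor Y Y') : f t = g t := by
  induction t using tensor_induction with
  | h0 => rw [map_zero, map_zero]
  | hadd a b ha hb => rw [map_add, map_add, ha, hb]
  | ht y y' => exact h y y'

/-- The map on `Y ⊗_R Y'` given by a balanced biadditive map. -/
def tensorLift (b : Y →+ Y' →+ G) (hb : ∀ y (r : R) y', b (op r • y) y' = b y (r • y')) :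
    tensor Y Y' →+ G :=
  letI b' : OuterTensor Y Y' →+ G := TensorProduct.liftAddHom b (fun c y y' => by
    have h := hb y (algebraMap k R c) y'
    rwa [algebraMap_smul, ← MulOpposite.algebraMap_apply, algebraMap_smul] at h)
  QuotientAddGroup.lift (balancing Y Y').toAddSubgroup b' (by
    intro t ht
    have key : ∀ t ∈ balancing Y Y', ∀ e : Env k R, b' (e • t : OuterTensor Y Y') = 0 := by
      intro t ht
      induction ht using Submodule.span_induction with
      | zero => intro e; rw [smul_zero]; exact map_zero b'
      | add a b _ _ ha hb =>
        intro e; rw [smul_add]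
        exact (map_add b' _ _).trans (by rw [ha, hb, add_zero])
      | smul a x _ hx => intro e; rw [smul_smul]; exact hx _
      | mem t ht =>
        obtain ⟨y, r, y', rfl⟩ := ht
        intro e
        induction e using env_induction with
        | h0 => exact (congrArg b' (zero_smul (Env k R) (_ : OuterTensor Y Y'))).trans (map_zero b')
        | hadd e e' h h' =>
          rw [add_smul]
          exact (map_add b' _ _).trans (by rw [h, h', add_zero])
        | ht c d =>
          rw [smul_sub, smul_outerTmul, smul_outerTmul]
          refine (map_sub b' _ _).trans (sub_eq_zero.2 ?_)
          change b (c • op r • y) (op d • y') = b (c • y) (op d • r • y')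
          rw [smul_comm c, hb, smul_comm r]
    have := key t ht 1
    rwa [one_smul] at this)

@[simp] theorem tensorLift_tmul (b : Y →+ Y' →+ G)
    (hb : ∀ y (r : R) y', b (op r • y) y' = b y (r • y')) (y : Y) (y' : Y') :
    tensorLift b hb (tmul y y') = b y y' := by
  refine (QuotientAddGroup.lift_mk' _ _ _).trans ?_
  exact TensorProduct.liftAddHom_tmul _ _ _ _

theorem tensorLift_left (b : Y →+ Y' →+ Z) (hb) (hl : ∀ (r : R) y y', b (r • y) y' = r • b y y')
    (r : R) (t : tensor Y Y') : tensorLift b hb (r • t) = r • tensorLift b hb t := by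
  induction t using tensor_induction with
  | h0 => simp
  | hadd x y hx hy => rw [smul_add, map_add, map_add, hx, hy, smul_add]
  | ht y y' => rw [left_smul_tmul, tensorLift_tmul, tensorLift_tmul, hl]

theorem tensorLift_right (b : Y →+ Y' →+ Z) (hb)
    (hr : ∀ (r : R) y y', b y (op r • y') = op r • b y y')
    (r : R) (t : tensor Y Y') : tensorLift b hb (op r • t) = op r • tensorLift b hb t := by
  induction t using tensor_induction with
  | h0 => simp
  | hadd x y hx hy => rw [smul_add, map_add, map_add, hx, hy, smul_add]
  | ht y y' => rw [right_smul_tmul, tensorLift_tmul, tensorLift_tmul, hr]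

end Tensor

/-! ### Tensor powers -/

section Power

variable {k : Type u} [Field k] {R : Type u} [Ring R] [Algebra k R] (X : BimodCat k R)
  {G : Type*} [AddCommGroup G]

/-- The element `r` of the zeroth tensor power. -/
def scalar : R →+ tensorPower X 0 where
  toFun r := (toReg r : regular k R)
  map_zero' := rfl
  map_add' _ _ := rfl

/-- The map `(x, w) ↦ x ⊗ w`. -/
def cons (n : ℕ) : X →+ tensorPower X n →+ tensorPower X (n + 1) := tmulHom X (tensorPower X n)

variable {X}

theorem exists_scalar (w : tensorPower X 0) : ∃ r, scalar X r = w := ⟨unReg w, rfl⟩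

theorem left_smul_scalar (r s : R) : r • scalar X s = scalar X (r * s) := left_smul_toReg r s

theorem right_smul_scalar (r s : R) : op r • scalar X s = scalar X (s * r) := right_smul_toReg r s

variable {n : ℕ}

theorem cons_induction {p : tensorPower X (n + 1) → Prop} (h0 : p 0)
    (hadd : ∀ a b, p a → p b → p (a + b)) (hc : ∀ x w, p (cons X n x w))
    (t : tensorPower X (n + 1)) : p t :=
  tensor_induction h0 hadd hc t

theorem cons_addHom_ext {f g : tensorPower X (n + 1) →+ G}
    (h : ∀ x w, f (cons X n x w) = g (cons X n x w)) : f = g :=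
  AddMonoidHom.ext (tensor_addHom_ext h)

theorem left_smul_cons (r : R) (x : X) (w : tensorPower X n) :
    r • cons X n x w = cons X n (r • x) w := left_smul_tmul r x w

theorem right_smul_cons (r : Rᵐᵒᵖ) (x : X) (w : tensorPower X n) :
    r • cons X n x w = cons X n x (r • w) := right_smul_tmul r x w

theorem cons_balanced (x : X) (r : R) (w : tensorPower X n) :
    cons X n (op r • x) w = cons X n x (r • w) := tmul_balanced x r w

/-- The map on `X^{⊗(n+1)} = X ⊗_R X^{⊗n}` given by a balanced biadditive map. -/
def consLift (b : X →+ tensorPower X n →+ G)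
    (hb : ∀ x (r : R) w, b (op r • x) w = b x (r • w)) : tensorPower X (n + 1) →+ G :=
  tensorLift b hb

@[simp] theorem consLift_cons (b : X →+ tensorPower X n →+ G)
    (hb : ∀ x (r : R) w, b (op r • x) w = b x (r • w)) (x : X) (w : tensorPower X n) :
    consLift b hb (cons X n x w) = b x w := tensorLift_tmul b hb x w

theorem consLift_left {Z : BimodCat k R} (b : X →+ tensorPower X n →+ Z)
    (hb : ∀ x (r : R) w, b (op r • x) w = b x (r • w))
    (hl : ∀ (r : R) x w, b (r • x) w = r • b x w) (r : R) (t : tensorPower X (n + 1)) :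
    consLift b hb (r • t) = r • consLift b hb t :=
  tensorLift_left b hb hl r t

/-! ### Appending a factor to a tensor power -/

variable (X)

/-- The biadditive maps `(x, w) ↦ x ⋆ w` from `X` and `X^{⊗n}` to `X^{⊗(n+1)}` that are left linear
in `w`; the property is what makes `appendStep` well defined. -/
def LeftLinearPairing (n : ℕ) : Type u :=
  { f : X →+ tensorPower X n →+ tensorPower X (n + 1) // ∀ x (r : R) w, f x (r • w) = r • f x w }

variable {X}

/-- The map `(y, w) ↦ y ⊗ (x ⋆ w)`. -/
def consPairing (f : LeftLinearPairing X n) (x : X) :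
    X →+ tensorPower X n →+ tensorPower X (n + 1 + 1) :=
  AddMonoidHom.mk' (fun y => (cons X (n + 1) y).comp (f.1 x)) (fun a b => by
    ext w
    exact DFunLike.congr_fun (map_add (cons X (n + 1)) a b) _)

theorem consPairing_apply (f : LeftLinearPairing X n) (x y : X) (w : tensorPower X n) :
    consPairing f x y w = cons X (n + 1) y (f.1 x w) := rfl

theorem consPairing_balanced (f : LeftLinearPairing X n) (x y : X) (r : R) (w : tensorPower X n) :
    consPairing f x (op r • y) w = consPairing f x y (r • w) := by
  rw [consPairing_apply, consPairing_apply, f.2, cons_balanced]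

/-- The pairing with `x ⋆ (y ⊗ w) = y ⊗ (x ⋆ w)`. -/
def appendStep (f : LeftLinearPairing X n) : LeftLinearPairing X (n + 1) :=
  ⟨AddMonoidHom.mk' (fun x => consLift (consPairing f x) (consPairing_balanced f x))
    (fun a b => by
      refine cons_addHom_ext (fun y w => ?_)
      rw [AddMonoidHom.add_apply, consLift_cons, consLift_cons, consLift_cons, consPairing_apply,
        consPairing_apply, consPairing_apply, map_add, AddMonoidHom.add_apply, map_add]),
    fun x r t => consLift_left (Z := tensorPower X (n + 1 + 1)) (consPairing f x)
      (consPairing_balanced f x) (fun r y w => (left_smul_cons _ _ _).symm) r t⟩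

variable (X)

/-- The map `(x, w) ↦ w ⊗ x`, bundled with the linearity that its recursive construction needs. -/
def appendAux : (n : ℕ) → LeftLinearPairing X n
  | 0 => ⟨AddMonoidHom.mk' (fun x => AddMonoidHom.mk'
        (fun w : tensorPower X 0 => cons X 0 ((unReg w : R) • x) (scalar X 1))
        (fun a b => (congrArg (fun y => cons X 0 y (scalar X 1))
          (add_smul (unReg a : R) (unReg b) x)).trans
            (DFunLike.congr_fun (map_add (cons X 0) _ _) _)))
        (fun a b => by
          ext w
          exact (congrArg (fun y => cons X 0 y (scalar X 1)) (smul_add (unReg w : R) a b)).trans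
              (DFunLike.congr_fun (map_add (cons X 0) _ _) _)),
      fun x r w => by
        obtain ⟨s, rfl⟩ := exists_scalar w
        rw [left_smul_scalar]
        exact (congrArg (fun y => cons X 0 y (scalar X 1)) (mul_smul r s x)).trans
          (left_smul_cons r (s • x) (scalar X 1)).symm⟩
  | n + 1 => appendStep (appendAux n)

/-- The map `(x, w) ↦ w ⊗ x`. -/
def append (n : ℕ) : X →+ tensorPower X n →+ tensorPower X (n + 1) := (appendAux X n).1

variable {X}

theorem append_scalar (x : X) (r : R) :
    append X 0 x (scalar X r) = cons X 0 (r • x) (scalar X 1) := rfl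

theorem append_cons (x y : X) (w : tensorPower X n) :
    append X (n + 1) x (cons X n y w) = cons X (n + 1) y (append X n x w) := by
  exact consLift_cons (consPairing (appendAux X n) x) (consPairing_balanced _ x) y w

theorem append_left (x : X) (r : R) (w : tensorPower X n) :
    append X n x (r • w) = r • append X n x w := (appendAux X n).2 x r w

theorem append_right (x : X) (r : R) (w : tensorPower X n) :
    append X n (op r • x) w = op r • append X n x w := by
  induction n with
  | zero =>
    obtain ⟨s, rfl⟩ := exists_scalar w
    rw [append_scalar, append_scalar, smul_comm, cons_balanced, right_smul_cons, left_smul_scalar,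
      right_smul_scalar, one_mul, mul_one]
  | succ n ih =>
    refine DFunLike.congr_fun (cons_addHom_ext (f := append X (n + 1) (op r • x))
      (g := (DistribSMul.toAddMonoidHom _ (op r)).comp (append X (n + 1) x)) (fun y w => ?_)) w
    change _ = op r • append X (n + 1) x (cons X n y w)
    rw [append_cons, append_cons, ih, right_smul_cons]

theorem append_balanced (x : X) (r : R) (w : tensorPower X n) :
    append X n (r • x) w = append X n x (op r • w) := by
  induction n with
  | zero =>
    obtain ⟨s, rfl⟩ := exists_scalar w
    rw [right_smul_scalar, append_scalar, append_scalar, mul_smul]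
  | succ n ih =>
    refine DFunLike.congr_fun (cons_addHom_ext (f := append X (n + 1) (r • x))
      (g := (append X (n + 1) x).comp (DistribSMul.toAddMonoidHom _ (op r))) (fun y w => ?_)) w
    change _ = append X (n + 1) x (op r • cons X n y w)
    rw [right_smul_cons, append_cons, append_cons, ih]

theorem append_induction {p : tensorPower X (n + 1) → Prop} (h0 : p 0)
    (hadd : ∀ a b, p a → p b → p (a + b)) (ha : ∀ x w, p (append X n x w))
    (t : tensorPower X (n + 1)) : p t := by
  induction n with
  | zero =>
    refine cons_induction h0 hadd (fun x w => ?_) t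
    obtain ⟨r, rfl⟩ := exists_scalar w
    have := ha (op r • x) (scalar X 1)
    rwa [append_scalar, one_smul, cons_balanced, left_smul_scalar, mul_one] at this
  | succ n ih =>
    refine cons_induction h0 hadd (fun y w => ?_) t
    induction w using ih with
    | h0 => rw [map_zero]; exact h0
    | hadd a b ha hb => rw [map_add]; exact hadd _ _ ha hb
    | ha x w => rw [← append_cons]; exact ha _ _

theorem append_addHom_ext {f g : tensorPower X (n + 1) →+ G}
    (h : ∀ x w, f (append X n x w) = g (append X n x w)) : f = g := by
  ext t
  induction t using append_induction with
  | h0 => rw [map_zero, map_zero]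
  | hadd a b ha hb => rw [map_add, map_add, ha, hb]
  | ha y y' => exact h y y'

/-- The power `X^{⊗(n+1)}` is also the tensor product `X^{⊗n} ⊗_R X`, through `append`. -/
theorem exists_append_lift (Z : BimodCat k R) (n : ℕ) (b : tensorPower X n →+ X →+ Z)
    (hb : ∀ w (r : R) x, b (op r • w) x = b w (r • x))
    (hr : ∀ w (r : R) x, b w (op r • x) = op r • b w x) :
    ∃ g : tensorPower X (n + 1) →+ Z, ∀ x w, g (append X n x w) = b w x := by
  induction n with
  | zero =>
    have hb' : ∀ (x : X) (s : R), b (scalar X s) x = b (scalar X 1) (s • x) :=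
      fun x s => by rw [← hb, right_smul_scalar, one_mul]
    refine ⟨consLift (AddMonoidHom.mk' (fun x => AddMonoidHom.mk'
      (fun s : tensorPower X 0 => op (unReg s : R) • b (scalar X 1) x) (fun s t => ?_))
      (fun x y => ?_)) (fun x r s => ?_), fun x w => ?_⟩
    · exact (congrArg (· • b (scalar X 1) x) (MulOpposite.op_add (unReg s : R) (unReg t))).trans
        (add_smul _ _ _)
    · ext s
      exact (congrArg (op (unReg s : R) • ·) (map_add (b (scalar X 1)) x y)).trans (smul_add _ _ _)
    · obtain ⟨s, rfl⟩ := exists_scalar s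
      rw [left_smul_scalar]
      change op s • b (scalar X 1) (op r • x) = op (r * s) • b (scalar X 1) x
      rw [hr, smul_smul]
      rfl
    · obtain ⟨s, rfl⟩ := exists_scalar w
      rw [append_scalar, consLift_cons, hb']
      exact one_smul Rᵐᵒᵖ _
  | succ n ih =>
    have h1 : ∀ y : X, ∃ g : tensorPower X (n + 1) →+ Z, ∀ x w, g (append X n x w) =
        b (cons X n y w) x := fun y =>
      ih (b.comp (cons X n y))
        (fun w r x => by
          change b (cons X n y (op r • w)) x = b (cons X n y w) (r • x)
          rw [← hb, right_smul_cons])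
        (fun w r x => hr _ r x)
    choose g hg using h1
    have hadd : ∀ y y', g (y + y') = g y + g y' := fun y y' => by
      refine append_addHom_ext (fun x w => ?_)
      rw [AddMonoidHom.add_apply, hg, hg, hg, map_add, AddMonoidHom.add_apply, map_add,
        AddMonoidHom.add_apply]
    have hbal : ∀ y (r : R) t, g (op r • y) t = g y (r • t) := fun y r t => by
      refine DFunLike.congr_fun (append_addHom_ext (f := g (op r • y)) (g := (g y).comp
        (DistribSMul.toAddMonoidHom _ r)) (fun x w => ?_)) t
      change _ = g y (r • _)
      rw [← append_left, hg, hg, cons_balanced]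
    refine ⟨consLift (AddMonoidHom.mk' g hadd) hbal, fun x t => ?_⟩
    refine DFunLike.congr_fun (cons_addHom_ext (f := (consLift
      (AddMonoidHom.mk' g hadd) hbal).comp (append X (n + 1) x)) (g := b.flip x)
        (fun y w => ?_)) t
    rw [AddMonoidHom.comp_apply, append_cons]
    exact (consLift_cons (AddMonoidHom.mk' g hadd) hbal _ _).trans (hg y x w)

end Power

/-! ### Bimodules over a trivial square-zero extension -/

section SquareZero

variable (k : Type u) [Field k] (R : Type u) [Ring R] [Algebra k R]
  (X : Type u) [AddCommGroup X] [Module k X] [Module R X] [Module Rᵐᵒᵖ X]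
  [SMulCommClass R Rᵐᵒᵖ X] [IsScalarTower k R X] [IsScalarTower k Rᵐᵒᵖ X]

/-- The trivial extension `R ⊕ X`. -/
abbrev SqZ (R X : Type u) : Type u := TrivSqZeroExt R X

/-- The inclusion of `R` in the trivial extension. -/
abbrev incl : R →ₐ[k] SqZ R X := TrivSqZeroExt.inlAlgHom k R X

/-- The projection of the trivial extension onto `R`. -/
abbrev proj : SqZ R X →ₐ[k] R := TrivSqZeroExt.fstHom k R X

variable {k R X}

/-- A homomorphism of bimodules over `R ⊕ X`, from an additive map that commutes with the actions
of `R` and of `X`. -/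
def sqHom {Z W : BimodCat k (SqZ R X)} (f : Z →+ W)
    (h1 : ∀ (a : R) z, f ((TrivSqZeroExt.inl a : SqZ R X) • z) =
      (TrivSqZeroExt.inl a : SqZ R X) • f z)
    (h2 : ∀ (x : X) z, f ((TrivSqZeroExt.inr x : SqZ R X) • z) =
      (TrivSqZeroExt.inr x : SqZ R X) • f z)
    (h3 : ∀ (a : R) z, f (op (TrivSqZeroExt.inl a : SqZ R X) • z) =
      op (TrivSqZeroExt.inl a : SqZ R X) • f z)
    (h4 : ∀ (x : X) z, f (op (TrivSqZeroExt.inr x : SqZ R X) • z) =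
      op (TrivSqZeroExt.inr x : SqZ R X) • f z) : Z ⟶ W :=
  bimodHom f
    (fun s z => by
      rw [← TrivSqZeroExt.inl_fst_add_inr_snd_eq s, add_smul, add_smul, map_add, h1, h2])
    (fun s z => by
      rw [← TrivSqZeroExt.inl_fst_add_inr_snd_eq s, MulOpposite.op_add, add_smul, add_smul,
        map_add, h3, h4])

variable (R X) in
/-- The operators `l x` and `r x` by which the elements `x` of `X` act, from the left and from the
right, on an `R`-bimodule `V` that is a bimodule over `R ⊕ X`. -/
structure SqAction (V : Type u) [AddCommGroup V] [Module R V] [Module Rᵐᵒᵖ V] where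
  l : X →+ V →+ V
  r : X →+ V →+ V
  l_smul : ∀ (a : R) x v, l (a • x) v = a • l x v
  l_op : ∀ (a : R) x v, l (op a • x) v = l x (a • v)
  l_right : ∀ (a : R) x v, l x (op a • v) = op a • l x v
  r_op : ∀ (a : R) x v, r (op a • x) v = op a • r x v
  r_smul : ∀ (a : R) x v, r (a • x) v = r x (op a • v)
  r_left : ∀ (a : R) x v, r x (a • v) = a • r x v
  l_l : ∀ x y v, l x (l y v) = 0
  r_r : ∀ x y v, r x (r y v) = 0
  l_r : ∀ x y v, l x (r y v) = r y (l x v)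

namespace SqAction

variable {V : Type u} [AddCommGroup V] [Module k V] [Module R V] [Module Rᵐᵒᵖ V]
  [SMulCommClass R Rᵐᵒᵖ V] [IsScalarTower k R V] [IsScalarTower k Rᵐᵒᵖ V]

/-- The space `V`, with the actions of `R ⊕ X`. -/
@[nolint unusedArguments]
def Carrier (_ : SqAction R X V) : Type u := V

variable (σ : SqAction R X V)

instance : AddCommGroup σ.Carrier := inferInstanceAs (AddCommGroup V)

instance : Module k σ.Carrier := inferInstanceAs (Module k V)

/-- `(a + x) v = a v + l x v`. -/
instance : Module (SqZ R X) σ.Carrier where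
  smul s v := (s.fst • (show V from v) + σ.l s.snd v : V)
  one_smul := show ∀ v : V, (1 : R) • v + σ.l 0 v = v from fun v => by simp
  mul_smul s t := show ∀ v : V, (s.fst * t.fst) • v + σ.l (s.fst • t.snd + op t.fst • s.snd) v
      = s.fst • (t.fst • v + σ.l t.snd v) + σ.l s.snd (t.fst • v + σ.l t.snd v) from fun v => by
    simp only [map_add, AddMonoidHom.add_apply, σ.l_smul, σ.l_op, σ.l_l, smul_add, mul_smul]
    abel
  smul_zero s := show s.fst • (0 : V) + σ.l s.snd 0 = 0 by simp
  smul_add s := show ∀ v w : V, s.fst • (v + w) + σ.l s.snd (v + w) =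
      s.fst • v + σ.l s.snd v + (s.fst • w + σ.l s.snd w) from fun v w => by
    simp only [map_add, smul_add]; abel
  add_smul s t := show ∀ v : V, (s.fst + t.fst) • v + σ.l (s.snd + t.snd) v =
      s.fst • v + σ.l s.snd v + (t.fst • v + σ.l t.snd v) from fun v => by
    simp only [map_add, add_smul, AddMonoidHom.add_apply]; abel
  zero_smul := show ∀ v : V, (0 : R) • v + σ.l 0 v = 0 from fun v => by simp

/-- `v (a + x) = v a + r x v`. -/
instance : Module (SqZ R X)ᵐᵒᵖ σ.Carrier where
  smul s v := (op s.unop.fst • (show V from v) + σ.r s.unop.snd v : V)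
  one_smul := show ∀ v : V, (1 : Rᵐᵒᵖ) • v + σ.r 0 v = v from fun v => by simp
  mul_smul s t := show ∀ v : V, op (t.unop.fst * s.unop.fst) • v
      + σ.r (t.unop.fst • s.unop.snd + op s.unop.fst • t.unop.snd) v
      = op s.unop.fst • (op t.unop.fst • v + σ.r t.unop.snd v)
        + σ.r s.unop.snd (op t.unop.fst • v + σ.r t.unop.snd v) from fun v => by
    simp only [map_add, AddMonoidHom.add_apply, σ.r_smul, σ.r_op, σ.r_r, smul_add,
      MulOpposite.op_mul, mul_smul]
    abel
  smul_zero s := show op s.unop.fst • (0 : V) + σ.r s.unop.snd 0 = 0 by simp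
  smul_add s := show ∀ v w : V, op s.unop.fst • (v + w) + σ.r s.unop.snd (v + w) =
      op s.unop.fst • v + σ.r s.unop.snd v +
        (op s.unop.fst • w + σ.r s.unop.snd w) from fun v w => by
    simp only [map_add, smul_add]; abel
  add_smul s t := show ∀ v : V, op (s.unop.fst + t.unop.fst) • v +
      σ.r (s.unop.snd + t.unop.snd) v =
      op s.unop.fst • v + σ.r s.unop.snd v +
        (op t.unop.fst • v + σ.r t.unop.snd v) from fun v => by
    simp only [map_add, MulOpposite.op_add, add_smul, AddMonoidHom.add_apply]; abel
  zero_smul := show ∀ v : V, (0 : Rᵐᵒᵖ) • v + σ.r 0 v = 0 from fun v => by simp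

instance : SMulCommClass (SqZ R X) (SqZ R X)ᵐᵒᵖ σ.Carrier where
  smul_comm s t := show ∀ v : V, s.fst • (op t.unop.fst • v + σ.r t.unop.snd v)
      + σ.l s.snd (op t.unop.fst • v + σ.r t.unop.snd v)
      = op t.unop.fst • (s.fst • v + σ.l s.snd v)
      + σ.r t.unop.snd (s.fst • v + σ.l s.snd v) from fun v => by
    simp only [map_add, smul_add, σ.r_left, σ.l_right, σ.l_r]
    rw [smul_comm]
    abel

instance : IsScalarTower k (SqZ R X) σ.Carrier where
  smul_assoc c s := show ∀ v : V, (c • s.fst) • v + σ.l (c • s.snd) v =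
      c • (s.fst • v + σ.l s.snd v) from fun v => by
    rw [← algebraMap_smul R c s.snd, σ.l_smul, algebraMap_smul, smul_assoc, smul_add]

instance : IsScalarTower k (SqZ R X)ᵐᵒᵖ σ.Carrier where
  smul_assoc c s := show ∀ v : V, (c • op s.unop.fst) • v + σ.r (c • s.unop.snd) v =
      c • (op s.unop.fst • v + σ.r s.unop.snd v) from fun v => by
    rw [← algebraMap_smul Rᵐᵒᵖ c s.unop.snd, MulOpposite.algebraMap_apply, σ.r_op,
      ← MulOpposite.algebraMap_apply, algebraMap_smul, smul_assoc, smul_add]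

variable (k) in
/-- The bimodule over `R ⊕ X` given by `V` and the operators `l x` and `r x`. -/
def obj : BimodCat k (SqZ R X) := ofBimod k (SqZ R X) σ.Carrier

variable (k) in
/-- The identification of `V` with the associated bimodule. -/
def elt : V ≃+ σ.obj k := AddEquiv.refl V

theorem inl_smul_elt (a : R) (v : V) :
    (TrivSqZeroExt.inl a : SqZ R X) • σ.elt k v = σ.elt k (a • v) := by
  refine (left_smul_toBimod (k := k) (V := σ.Carrier) (TrivSqZeroExt.inl a) v).trans ?_
  exact (show a • v + σ.l 0 v = a • v by simp)

theorem inr_smul_elt (x : X) (v : V) :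
    (TrivSqZeroExt.inr x : SqZ R X) • σ.elt k v = σ.elt k (σ.l x v) := by
  refine (left_smul_toBimod (k := k) (V := σ.Carrier) (TrivSqZeroExt.inr x) v).trans ?_
  exact (show (0 : R) • v + σ.l x v = σ.l x v by simp)

theorem op_inl_smul_elt (a : R) (v : V) :
    op (TrivSqZeroExt.inl a : SqZ R X) • σ.elt k v = σ.elt k (op a • v) := by
  refine (right_smul_toBimod (k := k) (V := σ.Carrier) (op (TrivSqZeroExt.inl a)) v).trans ?_
  exact (show op a • v + σ.r 0 v = op a • v by simp)

theorem op_inr_smul_elt (x : X) (v : V) :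
    op (TrivSqZeroExt.inr x : SqZ R X) • σ.elt k v = σ.elt k (σ.r x v) := by
  refine (right_smul_toBimod (k := k) (V := σ.Carrier) (op (TrivSqZeroExt.inr x)) v).trans ?_
  exact (show op (0 : R) • v + σ.r x v = σ.r x v by simp)

/-- A homomorphism out of the bimodule given by `V` and the operators `l x` and `r x`. -/
def desc {W : BimodCat k (SqZ R X)} (f : V →+ W)
    (h1 : ∀ (a : R) v, f (a • v) = (TrivSqZeroExt.inl a : SqZ R X) • f v)
    (h2 : ∀ (x : X) v, f (σ.l x v) = (TrivSqZeroExt.inr x : SqZ R X) • f v)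
    (h3 : ∀ (a : R) v, f (op a • v) = op (TrivSqZeroExt.inl a : SqZ R X) • f v)
    (h4 : ∀ (x : X) v, f (σ.r x v) = op (TrivSqZeroExt.inr x : SqZ R X) • f v) : σ.obj k ⟶ W :=
  sqHom (f.comp (σ.elt k).symm.toAddMonoidHom)
    (fun a z => by
      obtain ⟨v, rfl⟩ := (σ.elt k).surjective z
      rw [inl_smul_elt]; simpa using h1 a v)
    (fun a z => by
      obtain ⟨v, rfl⟩ := (σ.elt k).surjective z
      rw [inr_smul_elt]; simpa using h2 a v)
    (fun a z => by
      obtain ⟨v, rfl⟩ := (σ.elt k).surjective z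
      rw [op_inl_smul_elt]; simpa using h3 a v)
    (fun a z => by
      obtain ⟨v, rfl⟩ := (σ.elt k).surjective z
      rw [op_inr_smul_elt]; simpa using h4 a v)

end SqAction

/-- An exact sequence of modules is a short exact sequence if its maps are injective and surjective,
in terms of elements. -/
theorem shortExact_of_exact {E : Type u} [Ring E] (C : ShortComplex (ModuleCat.{u} E))
    (hf : Function.Injective C.f) (hg : Function.Surjective C.g)
    (hfg : ∀ y, C.g y = 0 → ∃ x, C.f x = y) : C.ShortExact where
  exact := (ShortComplex.moduleCat_exact_iff C).2 hfg
  mono_f := (ModuleCat.mono_iff_injective _).2 hf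
  epi_g := (ModuleCat.epi_iff_surjective _).2 hg

/-! ### Multiplication by elements of `X` on the tensor powers of `X` -/

variable (k R X) in
/-- The `n`-th tensor power of `X` over `R`. -/
abbrev Pow (n : ℕ) : BimodCat k R := tensorPower (ofBimod k R X) n

variable (k R X) in
/-- `toBimod` as an additive map. -/
def toBimodHom : X →+ ofBimod k R X := AddMonoidHom.id X

variable (k R X) in
/-- The map `(x, w) ↦ x ⊗ w`. -/
def lmul (n : ℕ) : X →+ Pow k R X n →+ Pow k R X (n + 1) :=
  (cons (ofBimod k R X) n).comp (toBimodHom k R X)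

variable (k R X) in
/-- The map `(x, w) ↦ w ⊗ x`. -/
def rmul (n : ℕ) : X →+ Pow k R X n →+ Pow k R X (n + 1) :=
  (append (ofBimod k R X) n).comp (toBimodHom k R X)

section

variable {n : ℕ} (a : R) (x y : X) (w : Pow k R X n)

theorem lmul_def : lmul k R X n x w = cons (ofBimod k R X) n (toBimod x) w := rfl

theorem rmul_def : rmul k R X n x w = append (ofBimod k R X) n (toBimod x) w := rfl

theorem lmul_smul : lmul k R X n (a • x) w = a • lmul k R X n x w := by
  rw [lmul_def, lmul_def, left_smul_cons, left_smul_toBimod]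

theorem lmul_op : lmul k R X n (op a • x) w = lmul k R X n x (a • w) := by
  rw [lmul_def, lmul_def, ← cons_balanced, right_smul_toBimod]

theorem lmul_right : lmul k R X n x (op a • w) = op a • lmul k R X n x w := by
  rw [lmul_def, lmul_def, right_smul_cons]

theorem rmul_op : rmul k R X n (op a • x) w = op a • rmul k R X n x w := by
  rw [rmul_def, rmul_def, ← append_right, right_smul_toBimod]

theorem rmul_smul : rmul k R X n (a • x) w = rmul k R X n x (op a • w) := by
  rw [rmul_def, rmul_def, ← append_balanced, left_smul_toBimod]

theorem rmul_left : rmul k R X n x (a • w) = a • rmul k R X n x w := by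
  rw [rmul_def, rmul_def, append_left]

theorem lmul_rmul : lmul k R X (n + 1) x (rmul k R X n y w) =
    rmul k R X (n + 1) y (lmul k R X n x w) := by
  rw [lmul_def, lmul_def, rmul_def, rmul_def, append_cons]

theorem lmul_addHom_ext {G : Type*} [AddCommGroup G] {f g : Pow k R X (n + 1) →+ G}
    (h : ∀ x w, f (lmul k R X n x w) = g (lmul k R X n x w)) : f = g :=
  cons_addHom_ext h

theorem rmul_addHom_ext {G : Type*} [AddCommGroup G] {f g : Pow k R X (n + 1) →+ G}
    (h : ∀ x w, f (rmul k R X n x w) = g (rmul k R X n x w)) : f = g :=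
  append_addHom_ext h

end

/-- The map on `X ⊗_R X^{⊗n}` given by a balanced biadditive map on `X` and `X^{⊗n}`. -/
theorem exists_lmul_lift {G : Type*} [AddCommGroup G] (n : ℕ) (b : X →+ Pow k R X n →+ G)
    (hb : ∀ x (a : R) w, b (op a • x) w = b x (a • w)) :
    ∃ g : Pow k R X (n + 1) →+ G, ∀ x w, g (lmul k R X n x w) = b x w := by
  refine ⟨consLift (X := ofBimod k R X) b (fun x a w => ?_), fun x w => consLift_cons _ _ _ _⟩
  refine Eq.trans ?_ (hb x a w)
  exact congrArg (fun y => b y w) (right_smul_toBimod (k := k) (V := X) (op a) x)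

/-- The power `X^{⊗(n+1)}` is also the tensor product `X^{⊗n} ⊗_R X`, with the pure tensors given by
`rmul`. -/
theorem exists_rmul_lift (Z : BimodCat k R) (n : ℕ) (b : Pow k R X n →+ X →+ Z)
    (hb : ∀ w (a : R) x, b (op a • w) x = b w (a • x))
    (hr : ∀ w (a : R) x, b w (op a • x) = op a • b w x) :
    ∃ g : Pow k R X (n + 1) →+ Z, ∀ x w, g (rmul k R X n x w) = b w x := by
  obtain ⟨g, hg⟩ := exists_append_lift (X := ofBimod k R X) Z n b
    (fun w a x => (hb w a x).trans
      (congrArg (b w) (left_smul_toBimod (k := k) (V := X) a x).symm))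
    (fun w a x =>
      (congrArg (b w) (right_smul_toBimod (k := k) (V := X) (op a) x)).trans (hr w a x))
  exact ⟨g, hg⟩

end SquareZero

/-! ### The relative bar resolution of a trivial extension -/

section Resolution

variable (k : Type u) [Field k] (R : Type u) [Ring R] [Algebra k R]
  (X : Type u) [AddCommGroup X] [Module k X] [Module R X] [Module Rᵐᵒᵖ X]
  [SMulCommClass R Rᵐᵒᵖ X] [IsScalarTower k R X] [IsScalarTower k Rᵐᵒᵖ X]

/-- The sign `(-1)ⁿ`. -/
def sign : ℕ → ℤ
  | 0 => 1
  | n + 1 => -sign n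

/-- The actions of `X` on `X^{⊗n} ⊕ X^{⊗(n+1)}` are
`x (w, v) = (0, x ⊗ w)` and `(w, v) x = (0, (-1)ⁿ w ⊗ x)`. -/
def syzygyAction (n : ℕ) : SqAction R X (Pow k R X n × Pow k R X (n + 1)) where
  l := AddMonoidHom.mk' (fun x => ((AddMonoidHom.inr _ _).comp (lmul k R X n x)).comp
    (AddMonoidHom.fst _ _)) (fun x y => by ext v <;> simp)
  r := AddMonoidHom.mk' (fun x => ((AddMonoidHom.inr _ _).comp (sign n • rmul k R X n x)).comp
    (AddMonoidHom.fst _ _)) (fun x y => by ext v <;> simp)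
  l_smul a x v := by ext <;> simp [lmul_smul]
  l_op a x v := by ext <;> simp [lmul_op]
  l_right a x v := by ext <;> simp [lmul_right]
  r_op a x v := by ext <;> simp [rmul_op, smul_comm (sign n)]
  r_smul a x v := by ext <;> simp [rmul_smul]
  r_left a x v := by ext <;> simp [rmul_left, smul_comm (sign n)]
  l_l x y v := by ext <;> simp
  r_r x y v := by ext <;> simp
  l_r x y v := by ext <;> simp

/-- The actions of `X` on `X^{⊗n} ⊕ X^{⊗(n+1)} ⊕ X^{⊗(n+1)} ⊕ X^{⊗(n+2)}` are
`x (w, u, v, t) = (0, x ⊗ w, 0, x ⊗ v)` and `(w, u, v, t) x = (0, 0, w ⊗ x, u ⊗ x)`. -/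
def barAction (n : ℕ) : SqAction R X (Pow k R X n × Pow k R X (n + 1) × Pow k R X (n + 1) ×
    Pow k R X (n + 1 + 1)) where
  l := AddMonoidHom.mk' (fun x => AddMonoidHom.mk'
    (fun v => (0, lmul k R X n x v.1, 0, lmul k R X (n + 1) x v.2.2.1))
    (fun v v' => by simp)) (fun x y => by ext v <;> simp)
  r := AddMonoidHom.mk' (fun x => AddMonoidHom.mk'
    (fun v => (0, 0, rmul k R X n x v.1, rmul k R X (n + 1) x v.2.1))
    (fun v v' => by simp)) (fun x y => by ext v <;> simp)
  l_smul a x v := by ext <;> simp [lmul_smul]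
  l_op a x v := by ext <;> simp [lmul_op]
  l_right a x v := by ext <;> simp [lmul_right]
  r_op a x v := by ext <;> simp [rmul_op]
  r_smul a x v := by ext <;> simp [rmul_smul]
  r_left a x v := by ext <;> simp [rmul_left]
  l_l x y v := by ext <;> simp
  r_r x y v := by ext <;> simp
  l_r x y v := by ext <;> simp [lmul_rmul]

/-- The `n`-th relative syzygy of `R ⊕ X`. -/
abbrev syzygy (n : ℕ) : BimodCat k (SqZ R X) := (syzygyAction k R X n).obj k

/-- The `n`-th term of the relative bar resolution of `S = R ⊕ X`: the induced bimodule
`S ⊗_R X^{⊗n} ⊗_R S`, split into its four components over `R`. -/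
abbrev bar (n : ℕ) : BimodCat k (SqZ R X) := (barAction k R X n).obj k

variable {k R X}

/-- Elements of the syzygies. -/
def syz {n : ℕ} (w : Pow k R X n) (v : Pow k R X (n + 1)) : syzygy k R X n :=
  (syzygyAction k R X n).elt k (w, v)

/-- Elements of the terms of the bar resolution. -/
def barElt {n : ℕ} (w : Pow k R X n) (u v : Pow k R X (n + 1)) (t : Pow k R X (n + 1 + 1)) :
    bar k R X n :=
  (barAction k R X n).elt k (w, u, v, t)

variable {n : ℕ}

theorem exists_syz (q : syzygy k R X n) : ∃ w v, syz w v = q :=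
  ⟨((syzygyAction k R X n).elt k).symm q |>.1, ((syzygyAction k R X n).elt k).symm q |>.2, rfl⟩

theorem exists_barElt (q : bar k R X n) : ∃ w u v t, barElt w u v t = q :=
  let p := ((barAction k R X n).elt k).symm q
  ⟨p.1, p.2.1, p.2.2.1, p.2.2.2, rfl⟩

section

variable {W : BimodCat k (SqZ R X)} (f g : syzygy k R X n ⟶ W) (p q : bar k R X n ⟶ W)
  (w w' : Pow k R X n) (u u' v v' : Pow k R X (n + 1)) (t t' : Pow k R X (n + 1 + 1))

theorem syz_add : syz (w + w') (v + v') = syz w v + syz w' v' := rfl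

theorem barElt_add : barElt (w + w') (u + u') (v + v') (t + t') =
    barElt w u v t + barElt w' u' v' t' := rfl

theorem inr_smul_syz (x : X) : (TrivSqZeroExt.inr x : SqZ R X) • syz w v =
    syz 0 (lmul k R X n x w) := SqAction.inr_smul_elt _ x _

theorem op_inr_smul_syz (x : X) : op (TrivSqZeroExt.inr x : SqZ R X) • syz w v =
    syz 0 (sign n • rmul k R X n x w) := SqAction.op_inr_smul_elt _ x _

theorem inl_smul_syz (a : R) : (TrivSqZeroExt.inl a : SqZ R X) • syz w v =
    syz (a • w) (a • v) := SqAction.inl_smul_elt _ a _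

theorem op_inl_smul_syz (a : R) : op (TrivSqZeroExt.inl a : SqZ R X) • syz w v =
    syz (op a • w) (op a • v) := SqAction.op_inl_smul_elt _ a _

theorem inr_smul_barElt (x : X) : (TrivSqZeroExt.inr x : SqZ R X) • barElt w u v t =
    barElt 0 (lmul k R X n x w) 0 (lmul k R X (n + 1) x v) := SqAction.inr_smul_elt _ x _

theorem op_inr_smul_barElt (x : X) : op (TrivSqZeroExt.inr x : SqZ R X) • barElt w u v t =
    barElt 0 0 (rmul k R X n x w) (rmul k R X (n + 1) x u) := SqAction.op_inr_smul_elt _ x _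

theorem inl_smul_barElt (a : R) : (TrivSqZeroExt.inl a : SqZ R X) • barElt w u v t =
    barElt (a • w) (a • u) (a • v) (a • t) := SqAction.inl_smul_elt _ a _

theorem op_inl_smul_barElt (a : R) : op (TrivSqZeroExt.inl a : SqZ R X) • barElt w u v t =
    barElt (op a • w) (op a • u) (op a • v) (op a • t) := SqAction.op_inl_smul_elt _ a _

end

variable (k R X) in
/-- The inclusion `(v, t) ↦ (0, -(-1)ⁿ v, v, t)` of a syzygy. -/
def syzygyIncl (n : ℕ) : syzygy k R X (n + 1) ⟶ bar k R X n :=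
  (syzygyAction k R X (n + 1)).desc
    (AddMonoidHom.mk' (fun v => barElt 0 (-sign n • v.1) v.1 v.2)
      (fun v v' => by rw [← barElt_add]; simp))
    (fun a v => by
      rw [AddMonoidHom.mk'_apply, inl_smul_barElt]
      simp [smul_comm (sign n)])
    (fun x v => by
      rw [AddMonoidHom.mk'_apply, inr_smul_barElt]
      simp [syzygyAction])
    (fun a v => by
      rw [AddMonoidHom.mk'_apply, op_inl_smul_barElt]
      simp [smul_comm (sign n)])
    (fun x v => by
      rw [AddMonoidHom.mk'_apply, op_inr_smul_barElt]
      simp [syzygyAction, sign])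

theorem syzygyIncl_syz (v : Pow k R X (n + 1)) (t : Pow k R X (n + 1 + 1)) :
    syzygyIncl k R X n (syz v t) = barElt 0 (-sign n • v) v t := rfl

variable (k R X) in
/-- The projection `(w, u, v, t) ↦ (w, u + (-1)ⁿ v)` onto a syzygy. -/
def barProj (n : ℕ) : bar k R X n ⟶ syzygy k R X n :=
  (barAction k R X n).desc
    (AddMonoidHom.mk' (fun v => syz v.1 (v.2.1 + sign n • v.2.2.1))
      (fun v v' => by rw [← syz_add]; simp; abel_nf))
    (fun a v => by
      rw [AddMonoidHom.mk'_apply, inl_smul_syz]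
      simp [smul_comm (sign n)])
    (fun x v => by
      rw [AddMonoidHom.mk'_apply, inr_smul_syz]
      simp [barAction])
    (fun a v => by
      rw [AddMonoidHom.mk'_apply, op_inl_smul_syz]
      simp [smul_comm (sign n)])
    (fun x v => by
      rw [AddMonoidHom.mk'_apply, op_inr_smul_syz]
      simp [barAction])

theorem barProj_barElt (w : Pow k R X n) (u v : Pow k R X (n + 1)) (t : Pow k R X (n + 1 + 1)) :
    barProj k R X n (barElt w u v t) = syz w (u + sign n • v) := rfl

theorem syz_injective {w w' : Pow k R X n} {v v' : Pow k R X (n + 1)}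
    (h : syz w v = syz w' v') : w = w' ∧ v = v' :=
  Prod.mk.inj h

theorem barElt_injective {w w' : Pow k R X n} {u u' v v' : Pow k R X (n + 1)}
    {t t' : Pow k R X (n + 1 + 1)} (h : barElt w u v t = barElt w' u' v' t') :
    w = w' ∧ u = u' ∧ v = v' ∧ t = t' := by
  have h' : (w, u, v, t) = (w', u', v', t') := h
  simpa using h'

variable (k R X) in
/-- The sequence `0 → Qₙ₊₁ → Bₙ → Qₙ → 0`. -/
def barSequence (n : ℕ) : ShortComplex (BimodCat k (SqZ R X)) where
  X₁ := syzygy k R X (n + 1)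
  X₂ := bar k R X n
  X₃ := syzygy k R X n
  f := syzygyIncl k R X n
  g := barProj k R X n
  zero := by
    ext q
    obtain ⟨v, t, rfl⟩ := exists_syz q
    change barProj k R X n (syzygyIncl k R X n (syz v t)) = 0
    rw [syzygyIncl_syz, barProj_barElt, neg_smul, neg_add_cancel]
    rfl

variable (k R X) in
theorem barSequence_shortExact (n : ℕ) : (barSequence k R X n).ShortExact := by
  refine shortExact_of_exact _ ?_ ?_ ?_
  · refine (injective_iff_map_eq_zero (syzygyIncl k R X n).hom).2 (fun q hq => ?_)
    obtain ⟨v, t, rfl⟩ := exists_syz q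
    obtain ⟨-, -, h1, h2⟩ := barElt_injective (show barElt 0 (-sign n • v) v t = barElt 0 0 0 0
      from hq)
    rw [h1, h2]
    rfl
  · intro q
    obtain ⟨w, v, rfl⟩ := exists_syz q
    refine ⟨barElt w v 0 0, (barProj_barElt _ _ _ _).trans ?_⟩
    rw [smul_zero, add_zero]
  · intro q hq
    obtain ⟨w, u, v, t, rfl⟩ := exists_barElt q
    obtain ⟨h1, h2⟩ := syz_injective (show syz w (u + sign n • v) = syz 0 0 from hq)
    refine ⟨syz v t, (syzygyIncl_syz v t).trans ?_⟩
    rw [h1, eq_neg_of_add_eq_zero_left h2, neg_smul]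

/-- The bimodule `Bₙ` is generated by the copy of `X^{⊗n}` in it. -/
theorem bar_hom_ext {W : BimodCat k (SqZ R X)} {f g : bar k R X n ⟶ W}
    (h : ∀ w, f (barElt w 0 0 0) = g (barElt w 0 0 0)) : f = g := by
  have e1 : ∀ u, f (barElt 0 u 0 0) = g (barElt 0 u 0 0) := by
    refine DFunLike.congr_fun (lmul_addHom_ext
      (f := AddMonoidHom.mk' (fun u => f (barElt 0 u 0 0)) (fun a b => ?_))
      (g := AddMonoidHom.mk' (fun u => g (barElt 0 u 0 0)) (fun a b => ?_)) (fun x w => ?_))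
    · rw [← map_add, ← barElt_add]; simp
    · rw [← map_add, ← barElt_add]; simp
    · have h0 := inr_smul_barElt w 0 0 0 x
      rw [map_zero] at h0
      rw [AddMonoidHom.mk'_apply, AddMonoidHom.mk'_apply, ← h0, hom_left_smul, hom_left_smul, h]
  have e2 : ∀ u, f (barElt 0 0 u 0) = g (barElt 0 0 u 0) := by
    refine DFunLike.congr_fun (rmul_addHom_ext
      (f := AddMonoidHom.mk' (fun u => f (barElt 0 0 u 0)) (fun a b => ?_))
      (g := AddMonoidHom.mk' (fun u => g (barElt 0 0 u 0)) (fun a b => ?_)) (fun x w => ?_))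
    · rw [← map_add, ← barElt_add]; simp
    · rw [← map_add, ← barElt_add]; simp
    · have h0 := op_inr_smul_barElt w 0 0 0 x
      rw [map_zero] at h0
      rw [AddMonoidHom.mk'_apply, AddMonoidHom.mk'_apply, ← h0, hom_right_smul, hom_right_smul, h]
  have e3 : ∀ u, f (barElt 0 0 0 u) = g (barElt 0 0 0 u) := by
    refine DFunLike.congr_fun (lmul_addHom_ext
      (f := AddMonoidHom.mk' (fun u => f (barElt 0 0 0 u)) (fun a b => ?_))
      (g := AddMonoidHom.mk' (fun u => g (barElt 0 0 0 u)) (fun a b => ?_)) (fun x w => ?_))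
    · rw [← map_add, ← barElt_add]; simp
    · rw [← map_add, ← barElt_add]; simp
    · have h0 := inr_smul_barElt 0 0 w 0 x
      rw [map_zero] at h0
      rw [AddMonoidHom.mk'_apply, AddMonoidHom.mk'_apply, ← h0, hom_left_smul, hom_left_smul, e2]
  ext q
  obtain ⟨w, u, v, t, rfl⟩ := exists_barElt q
  have hq : barElt w u v t = barElt w 0 0 0 + barElt 0 u 0 0 + barElt 0 0 v 0 + barElt 0 0 0 t := by
    rw [← barElt_add, ← barElt_add, ← barElt_add]; simp
  change f _ = g _
  rw [hq]
  simp only [map_add, h, e1, e2, e3]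

/-- Restriction of bimodules from `R ⊕ X` to `R`. -/
abbrev res (W : BimodCat k (SqZ R X)) : BimodCat k R := (restrictBimod (incl k R X)).obj W

theorem left_smul_res (W : BimodCat k (SqZ R X)) (a : R) (w : W) :
    a • (show res W from w) = ((TrivSqZeroExt.inl a : SqZ R X) • w : W) :=
  left_smul_restrict (incl k R X) W a w

theorem right_smul_res (W : BimodCat k (SqZ R X)) (a : R) (w : W) :
    op a • (show res W from w) = (op (TrivSqZeroExt.inl a : SqZ R X) • w : W) :=
  right_smul_restrict (incl k R X) W a w

/-- The bimodule `Bₙ` is induced by `X^{⊗n}`. -/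
theorem exists_bar_lift {W : BimodCat k (SqZ R X)} (f : Pow k R X n ⟶ res W) :
    ∃ g : bar k R X n ⟶ W, ∀ w, g (barElt w 0 0 0) = (show W from f w) := by
  let f0 : Pow k R X n →+ W := f.hom.toAddMonoidHom
  have fl : ∀ (a : R) w, f0 (a • w) = (TrivSqZeroExt.inl a : SqZ R X) • f0 w := fun a w =>
    (hom_left_smul f a w).trans (left_smul_res W a _)
  have fr : ∀ (a : R) w, f0 (op a • w) = op (TrivSqZeroExt.inl a : SqZ R X) • f0 w := fun a w =>
    (hom_right_smul f (op a) w).trans (right_smul_res W a _)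
  -- `L` and `M` describe the left and right multiplication by `X` on `W`
  let L : X →+ W →+ W := AddMonoidHom.mk'
    (fun x => DistribSMul.toAddMonoidHom W (TrivSqZeroExt.inr x : SqZ R X))
    (fun x y => by ext w; simp [add_smul])
  let M : X →+ W →+ W := AddMonoidHom.mk'
    (fun x => DistribSMul.toAddMonoidHom W (op (TrivSqZeroExt.inr x : SqZ R X)))
    (fun x y => by ext w; simp [add_smul])
  have Ldef : ∀ x w, L x w = (TrivSqZeroExt.inr x : SqZ R X) • w := fun _ _ => rfl
  have Mdef : ∀ x w, M x w = op (TrivSqZeroExt.inr x : SqZ R X) • w := fun _ _ => rfl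
  have La : ∀ (a : R) x w, L (op a • x) w = L x ((TrivSqZeroExt.inl a : SqZ R X) • w) :=
    fun a x w => by rw [Ldef, Ldef, smul_smul, TrivSqZeroExt.inr_mul_inl]
  have La' : ∀ (a : R) x w, L (a • x) w = (TrivSqZeroExt.inl a : SqZ R X) • L x w :=
    fun a x w => by rw [Ldef, Ldef, smul_smul, TrivSqZeroExt.inl_mul_inr]
  have Ma : ∀ (a : R) x w, M (a • x) w = M x (op (TrivSqZeroExt.inl a : SqZ R X) • w) :=
    fun a x w => by
      rw [Mdef, Mdef, smul_smul, ← MulOpposite.op_mul, TrivSqZeroExt.inl_mul_inr]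
  have Ma' : ∀ (a : R) x w, M (op a • x) w = op (TrivSqZeroExt.inl a : SqZ R X) • M x w :=
    fun a x w => by
      rw [Mdef, Mdef, smul_smul, ← MulOpposite.op_mul, TrivSqZeroExt.inr_mul_inl]
  obtain ⟨g1, hg1⟩ := exists_lmul_lift (k := k) (R := R) n
    (AddMonoidHom.mk' (fun x => (L x).comp f0) (fun x y => by ext; simp))
    (fun x a w => by
      change L (op a • x) (f0 w) = L x (f0 (a • w))
      rw [La, fl])
  obtain ⟨g2, hg2⟩ := exists_rmul_lift (k := k) (R := R) (res W) n
    (AddMonoidHom.mk' (fun w => (show X →+ W from M.flip (f0 w))) (fun x y => by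
      ext z
      exact (congrArg (M z) (map_add f0 x y)).trans (map_add (M z) _ _)))
    (fun w a x => by
      change M x (f0 (op a • w)) = M (a • x) (f0 w)
      rw [Ma, fr])
    (fun w a x => by
      refine Eq.trans ?_ (right_smul_res W a (M x (f0 w))).symm
      exact Ma' _ _ _)
  have hg1' : ∀ x w, g1 (lmul k R X n x w) = L x (f0 w) := hg1
  let G2 : Pow k R X (n + 1) →+ W := g2
  have hg2' : ∀ x w, G2 (rmul k R X n x w) = M x (f0 w) := hg2
  have g2l : ∀ (a : R) w, G2 (a • w) = (TrivSqZeroExt.inl a : SqZ R X) • G2 w := fun a =>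
    DFunLike.congr_fun (rmul_addHom_ext (f := G2.comp (DistribSMul.toAddMonoidHom _ a))
      (g := (DistribSMul.toAddMonoidHom W (TrivSqZeroExt.inl a : SqZ R X)).comp G2)
      (fun x w => by
        change G2 (a • _) = (TrivSqZeroExt.inl a : SqZ R X) • G2 _
        rw [← rmul_left, hg2', hg2', fl, Mdef, Mdef, ← smul_comm]))
  have g2r : ∀ (a : R) w, G2 (op a • w) = op (TrivSqZeroExt.inl a : SqZ R X) • G2 w := fun a =>
    DFunLike.congr_fun (rmul_addHom_ext (f := G2.comp (DistribSMul.toAddMonoidHom _ (op a)))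
      (g := (DistribSMul.toAddMonoidHom W (op (TrivSqZeroExt.inl a : SqZ R X))).comp G2)
      (fun x w => by
        change G2 (op a • _) = op (TrivSqZeroExt.inl a : SqZ R X) • G2 _
        rw [← rmul_op, hg2', hg2', Ma']))
  obtain ⟨g3, hg3⟩ := exists_lmul_lift (k := k) (R := R) (n + 1)
    (AddMonoidHom.mk' (fun x => (L x).comp G2) (fun x y => by ext; simp))
    (fun x a w => by
      change L (op a • x) (G2 w) = L x (G2 (a • w))
      rw [La, g2l])
  have hg3' : ∀ x w, g3 (lmul k R X (n + 1) x w) = L x (G2 w) := hg3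
  have g1l : ∀ (a : R) w, g1 (a • w) = (TrivSqZeroExt.inl a : SqZ R X) • g1 w := fun a =>
    DFunLike.congr_fun (lmul_addHom_ext (f := g1.comp (DistribSMul.toAddMonoidHom _ a))
      (g := (DistribSMul.toAddMonoidHom W (TrivSqZeroExt.inl a : SqZ R X)).comp g1)
      (fun x w => by
        change g1 (a • _) = (TrivSqZeroExt.inl a : SqZ R X) • g1 _
        rw [← lmul_smul, hg1', hg1', La']))
  have g1r : ∀ (a : R) w, g1 (op a • w) = op (TrivSqZeroExt.inl a : SqZ R X) • g1 w := fun a =>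
    DFunLike.congr_fun (lmul_addHom_ext (f := g1.comp (DistribSMul.toAddMonoidHom _ (op a)))
      (g := (DistribSMul.toAddMonoidHom W (op (TrivSqZeroExt.inl a : SqZ R X))).comp g1)
      (fun x w => by
        change g1 (op a • _) = op (TrivSqZeroExt.inl a : SqZ R X) • g1 _
        rw [← lmul_right, hg1', hg1', fr, Ldef, Ldef, smul_comm]))
  have g3l : ∀ (a : R) w, g3 (a • w) = (TrivSqZeroExt.inl a : SqZ R X) • g3 w := fun a =>
    DFunLike.congr_fun (lmul_addHom_ext (f := g3.comp (DistribSMul.toAddMonoidHom _ a))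
      (g := (DistribSMul.toAddMonoidHom W (TrivSqZeroExt.inl a : SqZ R X)).comp g3)
      (fun x w => by
        change g3 (a • _) = (TrivSqZeroExt.inl a : SqZ R X) • g3 _
        rw [← lmul_smul, hg3', hg3', La']))
  have g3r : ∀ (a : R) w, g3 (op a • w) = op (TrivSqZeroExt.inl a : SqZ R X) • g3 w := fun a =>
    DFunLike.congr_fun (lmul_addHom_ext (f := g3.comp (DistribSMul.toAddMonoidHom _ (op a)))
      (g := (DistribSMul.toAddMonoidHom W (op (TrivSqZeroExt.inl a : SqZ R X))).comp g3)
      (fun x w => by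
        change g3 (op a • _) = op (TrivSqZeroExt.inl a : SqZ R X) • g3 _
        rw [← lmul_right, hg3', hg3', g2r, Ldef, Ldef, smul_comm]))
  -- the two ways of computing `x w y`
  have g13 : ∀ y w, g3 (rmul k R X (n + 1) y w) = M y (g1 w) := fun y =>
    DFunLike.congr_fun (lmul_addHom_ext (f := g3.comp (rmul k R X (n + 1) y))
      (g := (M y).comp g1) (fun x w => by
        rw [AddMonoidHom.comp_apply, AddMonoidHom.comp_apply, ← lmul_rmul, hg3', hg2', hg1',
          Ldef, Ldef, Mdef, Mdef, smul_comm]))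
  have LL : ∀ x y w, L x (L y w) = 0 := fun x y w => by simp [Ldef, smul_smul]
  have MM : ∀ x y w, M x (M y w) = 0 := fun x y w => by
    simp [Mdef, smul_smul, ← MulOpposite.op_mul]
  have Lg1 : ∀ x w, L x (g1 w) = 0 := fun x => DFunLike.congr_fun (lmul_addHom_ext
    (f := (L x).comp g1) (g := 0) (fun y w => by
      rw [AddMonoidHom.comp_apply, hg1', LL]; rfl))
  have Lg3 : ∀ x w, L x (g3 w) = 0 := fun x => DFunLike.congr_fun (lmul_addHom_ext
    (f := (L x).comp g3) (g := 0) (fun y w => by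
      rw [AddMonoidHom.comp_apply, hg3', LL]; rfl))
  have Mg2 : ∀ x w, M x (G2 w) = 0 := fun x => DFunLike.congr_fun (rmul_addHom_ext
    (f := (M x).comp G2) (g := 0) (fun y w => by
      rw [AddMonoidHom.comp_apply, hg2', MM]; rfl))
  have Mg3 : ∀ x w, M x (g3 w) = 0 := fun x => DFunLike.congr_fun (lmul_addHom_ext
    (f := (M x).comp g3) (g := 0) (fun y w => by
      rw [AddMonoidHom.comp_apply, hg3']
      have := Mg2 x w
      rw [Mdef] at this ⊢
      rw [Ldef, ← smul_comm, this, smul_zero]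
      rfl))
  refine ⟨(barAction k R X n).desc (AddMonoidHom.mk'
    (fun v => f0 v.1 + g1 v.2.1 + G2 v.2.2.1 + g3 v.2.2.2) (fun v v' => ?_))
    (fun a v => ?_) (fun x v => ?_) (fun a v => ?_) (fun x v => ?_), fun w => ?_⟩
  · simp only [Prod.fst_add, Prod.snd_add, map_add]
    abel
  · simp only [AddMonoidHom.mk'_apply, Prod.smul_fst, Prod.smul_snd, fl, g1l, g2l, g3l, smul_add]
  · simp only [AddMonoidHom.mk'_apply, ← Ldef, map_add, Lg1, Lg3, ← hg1', ← hg3']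
    simp [barAction]
  · simp only [AddMonoidHom.mk'_apply, Prod.smul_fst, Prod.smul_snd, fr, g1r, g2r, g3r, smul_add]
  · simp only [AddMonoidHom.mk'_apply, ← Mdef, map_add, Mg2, Mg3, ← hg2', ← g13]
    simp [barAction]
  · change f0 w + g1 0 + G2 0 + g3 0 = f0 w
    simp

end Resolution

/-! ### Projective bimodules -/

section Projective

/-- A projective module over `E` is projective over `C` if `E` is projective over `C`. -/
theorem projective_compHom {C E Y : Type u} [Ring C] [Ring E] [AddCommGroup Y] [Module E Y]
    (j : C →+* E) (hE : letI := Module.compHom E j; Module.Projective C E)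
    (hY : Module.Projective E Y) : letI := Module.compHom Y j; Module.Projective C Y := by
  classical
  let := Module.compHom E j
  let := Module.compHom Y j
  have : IsScalarTower C E Y := ⟨fun c e y => mul_smul (j c) e y⟩
  have : IsScalarTower C E E := ⟨fun c e y => mul_assoc (j c) e y⟩
  obtain ⟨s, hs⟩ := hY
  have : Module.Projective C (Y →₀ E) :=
    Module.Projective.of_equiv (finsuppLequivDFinsupp C (ι := Y) (M := E)).symm
  exact Module.Projective.of_split (s.restrictScalars C)
    ((Finsupp.linearCombination E id).restrictScalars C) (LinearMap.ext hs)

variable {k : Type u} [Field k] {R : Type u} [Ring R] [Algebra k R] {X Y P U V : BimodCat k R}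

/-- A homomorphism of bimodules, as a left linear map. -/
def leftLin (f : X ⟶ Y) : X →ₗ[R] Y where
  toFun := f
  map_add' := f.hom.map_add
  map_smul' := hom_left_smul f

/-- A homomorphism of bimodules, as a right linear map. -/
def rightLin (f : X ⟶ Y) : X →ₗ[Rᵐᵒᵖ] Y where
  toFun := f
  map_add' := f.hom.map_add
  map_smul' := hom_right_smul f

/-- A projective bimodule is projective as a left module, because `R ⊗ₖ Rᵒᵖ` is free over `R`:
it comes from a vector space over `k`. -/
theorem projective_left (hY : Module.Projective (Env k R) Y) : Module.Projective R Y := by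
  refine projective_compHom (Algebra.TensorProduct.includeLeft : R →ₐ[k] Env k R).toRingHom ?_ hY
  let m := Module.compHom (Env k R) (Algebra.TensorProduct.includeLeft : R →ₐ[k] Env k R).toRingHom
  have e : @LinearEquiv R R _ _ (RingHom.id R) (RingHom.id R) _ _ (R ⊗[k] Rᵐᵒᵖ) (Env k R) _ _
      TensorProduct.leftModule m :=
    @LinearEquiv.mk _ _ _ _ _ _ _ _ _ _ _ _ TensorProduct.leftModule m
      (@LinearMap.mk _ _ _ _ _ _ _ _ _ TensorProduct.leftModule m ⟨id, fun _ _ => rfl⟩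
      (fun r t => by
        change r • t = (r ⊗ₜ[k] (1 : Rᵐᵒᵖ) : Env k R) * t
        induction t using TensorProduct.induction_on with
        | zero => rw [smul_zero]; exact (mul_zero (r ⊗ₜ[k] (1 : Rᵐᵒᵖ) : Env k R)).symm
        | add a b ha hb => rw [smul_add, mul_add, ha, hb]
        | tmul a b => rw [TensorProduct.smul_tmul', Algebra.TensorProduct.tmul_mul_tmul,
            smul_eq_mul, one_mul])) id (fun _ => rfl) (fun _ => rfl)
  exact @Module.Projective.of_equiv' _ _ _ _ m _ _ TensorProduct.leftModule _ e

/-- A projective bimodule is projective as a right module. -/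
theorem projective_right (hY : Module.Projective (Env k R) Y) : Module.Projective Rᵐᵒᵖ Y := by
  refine projective_compHom (Algebra.TensorProduct.includeRight : Rᵐᵒᵖ →ₐ[k] Env k R).toRingHom
    ?_ hY
  let m := Module.compHom (Env k R)
    (Algebra.TensorProduct.includeRight : Rᵐᵒᵖ →ₐ[k] Env k R).toRingHom
  have e : @LinearEquiv Rᵐᵒᵖ Rᵐᵒᵖ _ _ (RingHom.id _) (RingHom.id _) _ _ (Rᵐᵒᵖ ⊗[k] R) (Env k R)
      _ _ TensorProduct.leftModule m :=
    @LinearEquiv.mk _ _ _ _ _ _ _ _ _ _ _ _ TensorProduct.leftModule m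
      (@LinearMap.mk _ _ _ _ _ _ _ _ _ TensorProduct.leftModule m
        ⟨TensorProduct.comm k Rᵐᵒᵖ R, map_add _⟩
      (fun r t => by
        change TensorProduct.comm k Rᵐᵒᵖ R (r • t) =
          ((1 : R) ⊗ₜ[k] r : Env k R) * TensorProduct.comm k Rᵐᵒᵖ R t
        induction t using TensorProduct.induction_on with
        | zero =>
          rw [smul_zero, map_zero]; exact (mul_zero ((1 : R) ⊗ₜ[k] r : Env k R)).symm
        | add a b ha hb => rw [smul_add, map_add, map_add, mul_add, ha, hb]
        | tmul a b => rw [TensorProduct.smul_tmul', TensorProduct.comm_tmul,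
            TensorProduct.comm_tmul, Algebra.TensorProduct.tmul_mul_tmul, smul_eq_mul, one_mul]))
      (TensorProduct.comm k Rᵐᵒᵖ R).symm (TensorProduct.comm k Rᵐᵒᵖ R).left_inv
      (TensorProduct.comm k Rᵐᵒᵖ R).right_inv
  exact @Module.Projective.of_equiv' _ _ _ _ m _ _ _ _ e

/-! ### Pairings with a projective bimodule -/

/-- The map `a ⊗ b ↦ (p ↦ a h(b p))`, for an additive map `h` between bimodules. -/
def sandwich (h : P →+ U) (hk : ∀ (c : k) p, h (c • p) = c • h p) : Env k R →+ P →+ U :=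
  TensorProduct.liftAddHom
    (AddMonoidHom.mk' (fun a : R => AddMonoidHom.mk' (fun b : Rᵐᵒᵖ =>
      (DistribSMul.toAddMonoidHom U a).comp (h.comp (DistribSMul.toAddMonoidHom P b.unop)))
      (fun b b' => by ext p; simp [add_smul])) (fun a a' => by ext b p; simp [add_smul]))
    (fun c a b => by
      ext p
      change (c • a) • h (b.unop • p) = a • h ((c • b.unop) • p)
      rw [smul_assoc, smul_assoc, hk, smul_comm])

theorem sandwich_tmul (h : P →+ U) (hk : ∀ (c : k) p, h (c • p) = c • h p) (a b : R) (p : P) :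
    sandwich h hk (a ⊗ₜ op b) p = a • h (b • p) :=
  rfl

/-- The map `a ⊗ b ↦ (p ↦ h(p a) b)`, for an additive map `h` between bimodules. -/
def sandwich' (h : P →+ U) (hk : ∀ (c : k) p, h (c • p) = c • h p) : Env k R →+ P →+ U :=
  TensorProduct.liftAddHom
    (AddMonoidHom.mk' (fun a : R => AddMonoidHom.mk' (fun b : Rᵐᵒᵖ =>
      (DistribSMul.toAddMonoidHom U b).comp (h.comp (DistribSMul.toAddMonoidHom P (op a))))
      (fun b b' => by ext p; simp [add_smul])) (fun a a' => by ext b p; simp [add_smul]))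
    (fun c a b => by
      ext p
      change b • h ((c • op a) • p) = (c • b) • h (op a • p)
      rw [smul_assoc, smul_assoc, hk, smul_comm])

theorem sandwich'_tmul (h : P →+ U) (hk : ∀ (c : k) p, h (c • p) = c • h p) (a b : R) (p : P) :
    sandwich' h hk (a ⊗ₜ op b) p = op b • h (op a • p) :=
  rfl

theorem env_addHom_ext {G : Type*} [AddCommGroup G] {f g : Env k R →+ G}
    (h : ∀ a b : R, f (a ⊗ₜ op b) = g (a ⊗ₜ op b)) (e : Env k R) : f e = g e := by
  induction e using env_induction with
  | h0 => exact (map_zero f).trans (map_zero g).symm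
  | hadd a b ha hb => rw [map_add, map_add, ha, hb]
  | ht a b => exact h a b

section

variable (h : P →+ U) (hk : ∀ (c : k) p, h (c • p) = c • h p) (a : R) (d : Env k R) (p : P)

theorem sandwich_left_mul : sandwich h hk ((a ⊗ₜ 1 : Env k R) * d) p = a • sandwich h hk d p := by
  refine env_addHom_ext (f := ((sandwich h hk).comp (AddMonoidHom.mulLeft
    (a ⊗ₜ 1 : Env k R))).flip p) (g := (DistribSMul.toAddMonoidHom U a).comp
      ((sandwich h hk).flip p)) (fun b c => ?_) d
  change sandwich h hk ((a ⊗ₜ 1 : Env k R) * b ⊗ₜ op c) p = a • sandwich h hk (b ⊗ₜ op c) p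
  rw [Algebra.TensorProduct.tmul_mul_tmul, one_mul, sandwich_tmul, sandwich_tmul, mul_smul]

theorem sandwich_right_mul :
    sandwich h hk (((1 : R) ⊗ₜ op a : Env k R) * d) p = sandwich h hk d (a • p) := by
  refine env_addHom_ext (f := ((sandwich h hk).comp (AddMonoidHom.mulLeft
    ((1 : R) ⊗ₜ op a : Env k R))).flip p) (g := (sandwich h hk).flip (a • p)) (fun b c => ?_) d
  change sandwich h hk (((1 : R) ⊗ₜ op a : Env k R) * b ⊗ₜ op c) p = sandwich h hk (b ⊗ₜ op c) _
  rw [Algebra.TensorProduct.tmul_mul_tmul, one_mul, ← MulOpposite.op_mul, sandwich_tmul,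
    sandwich_tmul, mul_smul]

theorem sandwich_right (hr : ∀ (a : R) p, h (op a • p) = op a • h p) :
    sandwich h hk d (op a • p) = op a • sandwich h hk d p := by
  refine env_addHom_ext (f := (sandwich h hk).flip (op a • p))
    (g := (DistribSMul.toAddMonoidHom U (op a)).comp ((sandwich h hk).flip p)) (fun b c => ?_) d
  change sandwich h hk (b ⊗ₜ op c) (op a • p) = op a • sandwich h hk (b ⊗ₜ op c) p
  rw [sandwich_tmul, sandwich_tmul, smul_comm c, hr, smul_comm b]

theorem sandwich'_right_mul :
    sandwich' h hk (((1 : R) ⊗ₜ op a : Env k R) * d) p = op a • sandwich' h hk d p := by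
  refine env_addHom_ext (f := ((sandwich' h hk).comp (AddMonoidHom.mulLeft
    ((1 : R) ⊗ₜ op a : Env k R))).flip p) (g := (DistribSMul.toAddMonoidHom U (op a)).comp
      ((sandwich' h hk).flip p)) (fun b c => ?_) d
  change sandwich' h hk (((1 : R) ⊗ₜ op a : Env k R) * b ⊗ₜ op c) p =
    op a • sandwich' h hk (b ⊗ₜ op c) p
  rw [Algebra.TensorProduct.tmul_mul_tmul, one_mul, ← MulOpposite.op_mul, sandwich'_tmul,
    sandwich'_tmul, smul_smul, MulOpposite.op_mul]

theorem sandwich'_left_mul :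
    sandwich' h hk ((a ⊗ₜ 1 : Env k R) * d) p = sandwich' h hk d (op a • p) := by
  refine env_addHom_ext (f := ((sandwich' h hk).comp (AddMonoidHom.mulLeft
    (a ⊗ₜ 1 : Env k R))).flip p) (g := (sandwich' h hk).flip (op a • p)) (fun b c => ?_) d
  change sandwich' h hk ((a ⊗ₜ 1 : Env k R) * b ⊗ₜ op c) p = sandwich' h hk (b ⊗ₜ op c) _
  rw [Algebra.TensorProduct.tmul_mul_tmul, one_mul, sandwich'_tmul,
    sandwich'_tmul, smul_smul, MulOpposite.op_mul]

theorem sandwich'_left (hl : ∀ (a : R) p, h (a • p) = a • h p) :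
    sandwich' h hk d (a • p) = a • sandwich' h hk d p := by
  refine env_addHom_ext (f := (sandwich' h hk).flip (a • p))
    (g := (DistribSMul.toAddMonoidHom U a).comp ((sandwich' h hk).flip p)) (fun b c => ?_) d
  change sandwich' h hk (b ⊗ₜ op c) (a • p) = a • sandwich' h hk (b ⊗ₜ op c) p
  rw [sandwich'_tmul, sandwich'_tmul, smul_comm a (op c), ← hl, smul_comm a]

end

/-- Let `s` be a section of the canonical map from the free bimodule on `X` to `X`. Additive maps
on `X` are defined by prescribing `d ↦ F z d` as the value at `d z`, for `z` in `X`. -/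
def sectionLift {G : Type*} [AddCommGroup G] (s : X →ₗ[Env k R] (X →₀ Env k R))
    (F : X → Env k R →+ G) : X →+ G :=
  (Finsupp.liftAddHom F).comp s.toAddMonoidHom

section

variable {G : Type*} [AddCommGroup G] {G' : Type*} [AddCommGroup G']
  (s : X →ₗ[Env k R] (X →₀ Env k R)) (F : X → Env k R →+ G)

theorem finsupp_liftAddHom_eq {f g : (X →₀ Env k R) →+ G}
    (h : ∀ z d, f (Finsupp.single z d) = g (Finsupp.single z d)) (t : X →₀ Env k R) : f t = g t :=
  DFunLike.congr_fun (Finsupp.addHom_ext h) t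

/-- A value of `sectionLift` is what is prescribed, up to a map `Φ` for which the prescriptions are
compatible. -/
theorem sectionLift_comp (hs : ∀ x, Finsupp.linearCombination (Env k R) id (s x) = x)
    (Φ : G →+ G') (b : X →+ G') (h : ∀ z d, Φ (F z d) = b (d • z)) (x : X) :
    Φ (sectionLift s F x) = b x := by
  have := finsupp_liftAddHom_eq (f := Φ.comp (Finsupp.liftAddHom F))
    (g := b.comp (Finsupp.linearCombination (Env k R) id).toAddMonoidHom) (fun z d => by
      change Φ (Finsupp.liftAddHom F (Finsupp.single z d)) =
        b (Finsupp.linearCombination (Env k R) id (Finsupp.single z d))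
      rw [Finsupp.liftAddHom_apply_single, Finsupp.linearCombination_single, h]
      rfl) (s x)
  refine this.trans ?_
  change b (Finsupp.linearCombination (Env k R) id (s x)) = b x
  rw [hs]

theorem sectionLift_congr (Φ Ψ : G →+ G') (h : ∀ z d, Φ (F z d) = Ψ (F z d)) (x : X) :
    Φ (sectionLift s F x) = Ψ (sectionLift s F x) :=
  finsupp_liftAddHom_eq (f := Φ.comp (Finsupp.liftAddHom F))
    (g := Ψ.comp (Finsupp.liftAddHom F)) (fun z d => by
      change Φ (Finsupp.liftAddHom F (Finsupp.single z d)) =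
        Ψ (Finsupp.liftAddHom F (Finsupp.single z d))
      rw [Finsupp.liftAddHom_apply_single, h]) (s x)

theorem sectionLift_smul (e : Env k R) (Φ : G →+ G) (h : ∀ z d, F z (e * d) = Φ (F z d)) (x : X) :
    sectionLift s F (e • x) = Φ (sectionLift s F x) := by
  have := finsupp_liftAddHom_eq (f := (Finsupp.liftAddHom F).comp (DistribSMul.toAddMonoidHom _ e))
    (g := Φ.comp (Finsupp.liftAddHom F)) (fun z d => by
      change Finsupp.liftAddHom F (e • Finsupp.single z d) =
        Φ (Finsupp.liftAddHom F (Finsupp.single z d))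
      rw [Finsupp.smul_single, Finsupp.liftAddHom_apply_single, Finsupp.liftAddHom_apply_single,
        smul_eq_mul, h]) (s x)
  refine Eq.trans ?_ this
  change Finsupp.liftAddHom F (s (e • x)) = Finsupp.liftAddHom F (e • s x)
  rw [map_smul]

end

theorem right_linear_k {h : P →+ U} (hr : ∀ (a : R) p, h (op a • p) = op a • h p) (c : k) (p : P) :
    h (c • p) = c • h p := by
  have := hr (algebraMap k R c) p
  rwa [← MulOpposite.algebraMap_apply, algebraMap_smul, algebraMap_smul] at this

theorem left_linear_k {h : P →+ U} (hl : ∀ (a : R) p, h (a • p) = a • h p) (c : k) (p : P) :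
    h (c • p) = c • h p := by
  have := hl (algebraMap k R c) p
  rwa [algebraMap_smul, algebraMap_smul] at this

/-- Let `X` be a projective bimodule. A balanced pairing `b` of `X` and `Y` with values in `V`, that
is left linear on `X`, lifts to a pairing of `X` and `P` with values in `U` if each `b z`
lifts to a right linear map. -/
theorem exists_pairing (hX : Module.Projective (Env k R) X) (b : X →+ Y →+ V)
    (hb : ∀ x (a : R) y, b (op a • x) y = b x (a • y)) (hl : ∀ (a : R) x y, b (a • x) y = a • b x y)
    (τ : U →+ V) (hτ : ∀ (a : R) u, τ (a • u) = a • τ u)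
    (j : Y →+ P) (hj : ∀ (a : R) y, j (a • y) = a • j y)
    (h : X → P →+ U) (hr : ∀ x (a : R) p, h x (op a • p) = op a • h x p)
    (hb' : ∀ x y, τ (h x (j y)) = b x y) :
    ∃ H : X →+ P →+ U, (∀ x y, τ (H x (j y)) = b x y) ∧
      (∀ x (a : R) p, H (op a • x) p = H x (a • p)) ∧
      (∀ (a : R) x p, H (a • x) p = a • H x p) ∧
      (∀ (a : R) x p, H x (op a • p) = op a • H x p) := by
  obtain ⟨s, hs⟩ := hX
  let F : X → Env k R →+ P →+ U := fun x => sandwich (h x) (right_linear_k (hr x))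
  refine ⟨sectionLift s F, fun x y => ?_, fun x a p => ?_, fun a x p => ?_, fun a x p => ?_⟩
  · refine sectionLift_comp s F hs (Φ := τ.comp ((AddMonoidHom.eval (j y)))) (b := b.flip y)
      (fun z d => ?_) x
    change τ (F z d (j y)) = b (d • z) y
    refine env_addHom_ext (f := τ.comp ((F z).flip (j y)))
      (g := (b.flip y).comp ((smulAddHom (Env k R) X).flip z)) (fun c c' => ?_) d
    change τ (sandwich (h z) (right_linear_k (hr z)) (c ⊗ₜ op c') (j y)) =
      b ((c ⊗ₜ[k] op c' : Env k R) • z) y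
    rw [sandwich_tmul, hτ, ← hj, hb', tmul_smul, hl, hb]
  · exact DFunLike.congr_fun (sectionLift_smul s F ((1 : R) ⊗ₜ op a)
      (AddMonoidHom.compHom.flip (DistribSMul.toAddMonoidHom P a))
      (fun z d => AddMonoidHom.ext fun p => sandwich_right_mul (h z) _ a d p) x) p
  · exact DFunLike.congr_fun (sectionLift_smul s F (a ⊗ₜ 1)
      (AddMonoidHom.compHom (DistribSMul.toAddMonoidHom U a))
      (fun z d => AddMonoidHom.ext fun p => sandwich_left_mul (h z) _ a d p) x) p
  · exact DFunLike.congr_fun (sectionLift_congr s F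
      (AddMonoidHom.compHom.flip (DistribSMul.toAddMonoidHom P (op a)))
      (AddMonoidHom.compHom (DistribSMul.toAddMonoidHom U (op a)))
      (fun z d => AddMonoidHom.ext fun p => sandwich_right (h z) _ a d p (hr z)) x) p

/-- The mirror image of `exists_pairing`. -/
theorem exists_pairing' (hX : Module.Projective (Env k R) X) (b : X →+ Y →+ V)
    (hb : ∀ x (a : R) y, b (a • x) y = b x (op a • y))
    (hr : ∀ (a : R) x y, b (op a • x) y = op a • b x y)
    (τ : U →+ V) (hτ : ∀ (a : R) u, τ (op a • u) = op a • τ u)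
    (j : Y →+ P) (hj : ∀ (a : R) y, j (op a • y) = op a • j y)
    (h : X → P →+ U) (hl : ∀ x (a : R) p, h x (a • p) = a • h x p)
    (hb' : ∀ x y, τ (h x (j y)) = b x y) :
    ∃ H : X →+ P →+ U, (∀ x y, τ (H x (j y)) = b x y) ∧
      (∀ x (a : R) p, H (a • x) p = H x (op a • p)) ∧
      (∀ (a : R) x p, H (op a • x) p = op a • H x p) ∧
      (∀ (a : R) x p, H x (a • p) = a • H x p) := by
  obtain ⟨s, hs⟩ := hX
  let F : X → Env k R →+ P →+ U := fun x => sandwich' (h x) (left_linear_k (hl x))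
  refine ⟨sectionLift s F, fun x y => ?_, fun x a p => ?_, fun a x p => ?_, fun a x p => ?_⟩
  · refine sectionLift_comp s F hs (Φ := τ.comp ((AddMonoidHom.eval (j y)))) (b := b.flip y)
      (fun z d => ?_) x
    change τ (F z d (j y)) = b (d • z) y
    refine env_addHom_ext (f := τ.comp ((F z).flip (j y)))
      (g := (b.flip y).comp ((smulAddHom (Env k R) X).flip z)) (fun c c' => ?_) d
    change τ (sandwich' (h z) (left_linear_k (hl z)) (c ⊗ₜ op c') (j y)) =
      b ((c ⊗ₜ[k] op c' : Env k R) • z) y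
    rw [sandwich'_tmul, hτ, ← hj, hb', tmul_smul, hb, hr]
  · exact DFunLike.congr_fun (sectionLift_smul s F (a ⊗ₜ 1)
      (AddMonoidHom.compHom.flip (DistribSMul.toAddMonoidHom P (op a)))
      (fun z d => AddMonoidHom.ext fun p => sandwich'_left_mul (h z) _ a d p) x) p
  · exact DFunLike.congr_fun (sectionLift_smul s F ((1 : R) ⊗ₜ op a)
      (AddMonoidHom.compHom (DistribSMul.toAddMonoidHom U (op a)))
      (fun z d => AddMonoidHom.ext fun p => sandwich'_right_mul (h z) _ a d p) x) p
  · exact DFunLike.congr_fun (sectionLift_congr s F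
      (AddMonoidHom.compHom.flip (DistribSMul.toAddMonoidHom P a))
      (AddMonoidHom.compHom (DistribSMul.toAddMonoidHom U a))
      (fun z d => AddMonoidHom.ext fun p => sandwich'_left (h z) _ a d p (hl z)) x) p

/-- The tensor product `X ⊗_R Y` is projective if `X` is projective and `Y` is projective as a right
module. -/
theorem tensor_projective (hX : Module.Projective (Env k R) X) (hY : Module.Projective Rᵐᵒᵖ Y) :
    Module.Projective (Env k R) (tensor X Y) := by
  have : Projective (tensor X Y) := by
    refine ⟨fun {U V} f e he => ?_⟩
    have hlift : ∀ x : X, ∃ h : Y →ₗ[Rᵐᵒᵖ] U, ∀ y, e (h y) = f (tmul x y) := fun x => by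
      obtain ⟨h, hh⟩ := Module.projective_lifting_property (rightLin e)
        ({ toFun := fun y => f (tmul x y)
           map_add' := fun a b => by rw [← tmulHom_apply, map_add, map_add]; rfl
           map_smul' := fun a y => by
             rw [← right_smul_tmul]
             exact hom_right_smul f a _ } : Y →ₗ[Rᵐᵒᵖ] V)
        ((ModuleCat.epi_iff_surjective e).1 he)
      exact ⟨h, fun y => DFunLike.congr_fun hh y⟩
    choose h hh using hlift
    obtain ⟨H, H1, H2, H3, H4⟩ := exists_pairing (Y := Y) (P := Y) hX
      (AddMonoidHom.mk' (fun x => f.hom.toAddMonoidHom.comp (tmulHom X Y x)) (fun a b => by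
        ext y
        change f (tmulHom X Y (a + b) y) = f (tmulHom X Y a y) + f (tmulHom X Y b y)
        rw [map_add]
        exact map_add f.hom _ _))
      (fun x a y => congrArg f (tmul_balanced x a y))
      (fun a x y => (congrArg f (left_smul_tmul a x y).symm).trans (hom_left_smul f a _))
      e.hom.toAddMonoidHom (hom_left_smul e) (AddMonoidHom.id Y) (fun _ _ => rfl)
      (fun x => (h x).toAddMonoidHom) (fun x a y => (h x).map_smul (op a) y) hh
    refine ⟨bimodHom (tensorLift H H2) (tensorLift_left H H2 H3) (tensorLift_right H H2 H4), ?_⟩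
    ext t
    refine tensor_addHom_ext (f := e.hom.toAddMonoidHom.comp (tensorLift H H2))
      (g := f.hom.toAddMonoidHom) (fun x y => ?_) t
    rw [AddMonoidHom.comp_apply, tensorLift_tmul]
    exact H1 x y
  exact ModuleCat.projective_of_module_projective _

theorem regular_projective_left : Module.Projective R (regular k R) := by
  let e : R ≃ₗ[R] regular k R :=
    { toFun := fun r => (toReg r : regular k R)
      invFun := unReg
      map_add' := fun _ _ => rfl
      map_smul' := fun r s => (left_smul_toReg r s).symm
      left_inv := fun _ => rfl
      right_inv := fun _ => rfl }
  exact Module.Projective.of_equiv' e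

theorem regular_projective_right : Module.Projective Rᵐᵒᵖ (regular k R) := by
  let e : Rᵐᵒᵖ ≃ₗ[Rᵐᵒᵖ] regular k R :=
    { toFun := fun r => (toReg r.unop : regular k R)
      invFun := fun r => op (unReg r)
      map_add' := fun _ _ => rfl
      map_smul' := fun r s => (right_smul_toReg r.unop s.unop).symm
      left_inv := fun _ => rfl
      right_inv := fun _ => rfl }
  exact Module.Projective.of_equiv' e

theorem tensorPower_projective (hX : Module.Projective (Env k R) X) (n : ℕ) :
    Module.Projective (Env k R) (tensorPower X (n + 1)) := by
  induction n with
  | zero => exact tensor_projective hX regular_projective_right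
  | succ n ih => exact tensor_projective hX (projective_right ih)

end Projective

/-! ### Short exact sequences of modules -/

section Presentations

variable {E : Type u} [Ring E]

theorem injective_f {C : ShortComplex (ModuleCat.{u} E)} (hC : C.ShortExact) :
    Function.Injective C.f :=
  (ModuleCat.mono_iff_injective _).1 hC.mono_f

theorem surjective_g {C : ShortComplex (ModuleCat.{u} E)} (hC : C.ShortExact) :
    Function.Surjective C.g :=
  (ModuleCat.epi_iff_surjective _).1 hC.epi_g

theorem exact_f_g {C : ShortComplex (ModuleCat.{u} E)} (hC : C.ShortExact) :
    Function.Exact C.f C.g :=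
  (ShortComplex.ShortExact.moduleCat_exact_iff_function_exact C).1 hC.exact

theorem exists_projective_presentation (Y : ModuleCat.{u} E) :
    ∃ (Ω P : ModuleCat.{u} E) (i : Ω ⟶ P) (p : P ⟶ Y) (w : i ≫ p = 0),
      (ShortComplex.mk i p w).ShortExact ∧ Projective P :=
  ⟨_, Projective.over Y, Limits.kernel.ι (Projective.π Y), Projective.π Y,
    Limits.kernel.condition _, { exact := ShortComplex.exact_kernel _ }, inferInstance⟩

theorem exists_injective_presentation (Y : ModuleCat.{u} E) :
    ∃ (J W : ModuleCat.{u} E) (i : Y ⟶ J) (p : J ⟶ W) (w : i ≫ p = 0),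
      (ShortComplex.mk i p w).ShortExact ∧ Injective J :=
  ⟨Injective.under Y, _, Injective.ι Y, Limits.cokernel.π (Injective.ι Y),
    Limits.cokernel.condition _, { exact := ShortComplex.exact_cokernel _ }, inferInstance⟩

theorem exists_extClass_comp {C : ShortComplex (ModuleCat.{u} E)} (hC : C.ShortExact)
    (hP : Projective C.X₂) {W : ModuleCat.{u} E} {n : ℕ} (x : Ext C.X₃ W (n + 1)) :
    ∃ x' : Ext C.X₁ W n, hC.extClass.comp x' (add_comm 1 n) = x :=
  Ext.contravariant_sequence_exact₃ hC W x (Ext.eq_zero_of_projective _) (add_comm 1 n)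

theorem exists_comp_extClass {C : ShortComplex (ModuleCat.{u} E)} (hC : C.ShortExact)
    (hJ : Injective C.X₂) {Y : ModuleCat.{u} E} {n : ℕ} (x : Ext Y C.X₁ (n + 1)) :
    ∃ x' : Ext Y C.X₃ n, x'.comp hC.extClass rfl = x :=
  Ext.covariant_sequence_exact₁ Y hC x (Ext.eq_zero_of_injective _) rfl

end Presentations

/-! ### Vanishing of extensions by one-sided endomorphisms -/

section Endomorphisms

variable {k : Type u} [Field k] {R : Type u} [Ring R] [Algebra k R]

/-- The pairs of a left linear and a right linear endomorphism of a bimodule. -/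
def EndPair (X : BimodCat k R) : Type u := (X →ₗ[R] X) × (X →ₗ[Rᵐᵒᵖ] X)

namespace EndPair

variable {X : BimodCat k R}

instance : AddCommGroup (EndPair X) := inferInstanceAs (AddCommGroup ((X →ₗ[R] X) × (X →ₗ[Rᵐᵒᵖ] X)))

instance : Module k (EndPair X) := inferInstanceAs (Module k ((X →ₗ[R] X) × (X →ₗ[Rᵐᵒᵖ] X)))

/-- Right multiplication by `a`, as a left linear map. -/
def mulRight (a : R) : X →ₗ[R] X where
  toFun x := op a • x
  map_add' := smul_add _
  map_smul' b x := (smul_comm b (op a) x).symm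

/-- Left multiplication by `a`, as a right linear map. -/
def mulLeft (a : R) : X →ₗ[Rᵐᵒᵖ] X where
  toFun x := a • x
  map_add' := smul_add _
  map_smul' b x := smul_comm a b x

/-- `a (f, g) = (f(- a), a g)`. -/
instance : Module R (EndPair X) where
  smul a p := (p.1.comp (mulRight a), (mulLeft a).comp p.2)
  one_smul p := Prod.ext (LinearMap.ext fun x => congrArg p.1 (one_smul Rᵐᵒᵖ x))
    (LinearMap.ext fun x => one_smul R (p.2 x))
  mul_smul a b p := Prod.ext (LinearMap.ext fun x => congrArg p.1 (mul_smul (op b) (op a) x))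
    (LinearMap.ext fun x => mul_smul a b (p.2 x))
  smul_zero a := Prod.ext rfl (LinearMap.ext fun _ => smul_zero a)
  smul_add a p q := Prod.ext rfl (LinearMap.ext fun x => smul_add a (p.2 x) (q.2 x))
  add_smul a b p := Prod.ext
    (LinearMap.ext fun x => (congrArg p.1 (add_smul (op a) (op b) x)).trans (map_add p.1 _ _))
    (LinearMap.ext fun x => add_smul a b (p.2 x))
  zero_smul p := Prod.ext
    (LinearMap.ext fun x => (congrArg p.1 (zero_smul Rᵐᵒᵖ x)).trans (map_zero p.1))
    (LinearMap.ext fun x => zero_smul R (p.2 x))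

/-- `(f, g) a = (f a, g(a -))`. -/
instance : Module Rᵐᵒᵖ (EndPair X) where
  smul a p := ((mulRight a.unop).comp p.1, p.2.comp (mulLeft a.unop))
  one_smul p := Prod.ext (LinearMap.ext fun x => one_smul Rᵐᵒᵖ (p.1 x))
    (LinearMap.ext fun x => congrArg p.2 (one_smul R x))
  mul_smul a b p := Prod.ext (LinearMap.ext fun x => mul_smul a b (p.1 x))
    (LinearMap.ext fun x => congrArg p.2 (mul_smul b.unop a.unop x))
  smul_zero a := Prod.ext (LinearMap.ext fun _ => smul_zero a) rfl
  smul_add a p q := Prod.ext (LinearMap.ext fun x => smul_add a (p.1 x) (q.1 x)) rfl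
  add_smul a b p := Prod.ext
    (LinearMap.ext fun x => add_smul a b (p.1 x))
    (LinearMap.ext fun x => (congrArg p.2 (add_smul a.unop b.unop x)).trans (map_add p.2 _ _))
  zero_smul p := Prod.ext
    (LinearMap.ext fun x => zero_smul Rᵐᵒᵖ (p.1 x))
    (LinearMap.ext fun x => (congrArg p.2 (zero_smul R x)).trans (map_zero p.2))

instance : SMulCommClass R Rᵐᵒᵖ (EndPair X) where
  smul_comm _ _ _ := rfl

instance : IsScalarTower k R (EndPair X) where
  smul_assoc c a p := Prod.ext
    (LinearMap.ext fun x => by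
      change p.1 ((c • op a) • x) = c • p.1 (op a • x)
      rw [smul_assoc, ← algebraMap_smul R c, map_smul, algebraMap_smul])
    (LinearMap.ext fun x => smul_assoc c a (p.2 x))

instance : IsScalarTower k Rᵐᵒᵖ (EndPair X) where
  smul_assoc c a p := Prod.ext
    (LinearMap.ext fun x => smul_assoc c a (p.1 x))
    (LinearMap.ext fun x => by
      change p.2 ((c • a.unop) • x) = c • p.2 (a.unop • x)
      rw [smul_assoc, ← algebraMap_smul Rᵐᵒᵖ c, map_smul, algebraMap_smul])

end EndPair

/-- The pairs of a left linear and a right linear endomorphism of `X`, as a bimodule. -/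
abbrev endBimod (X : BimodCat k R) : BimodCat k R := ofBimod k R (EndPair X)

variable {X Y : BimodCat k R}

/-- Let `Ω → P` be the inclusion of a sub-bimodule that is a direct summand as a left module and as
a right module. If `X` is projective, then all homomorphisms from `Ω` to `endBimod X` extend
to `P`. -/
theorem exists_extension_endBimod (hX : Module.Projective (Env k R) X) {Ω P : BimodCat k R}
    (j : Ω ⟶ P) (l : P →ₗ[R] Ω) (hl : ∀ w, l (j w) = w) (r : P →ₗ[Rᵐᵒᵖ] Ω)
    (hr : ∀ w, r (j w) = w) (φ : Ω ⟶ endBimod X) : ∃ Φ : P ⟶ endBimod X, j ≫ Φ = φ := by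
  let ψ : Ω →+ EndPair X := φ.hom.toAddMonoidHom
  have ψl : ∀ (a : R) w, ψ (a • w) = a • ψ w := fun a w =>
    (hom_left_smul φ a w).trans (left_smul_toBimod (V := EndPair X) a (ψ w))
  have ψr : ∀ (a : R) w, ψ (op a • w) = op a • ψ w := fun a w =>
    (hom_right_smul φ (op a) w).trans (right_smul_toBimod (V := EndPair X) (op a) (ψ w))
  let ψ1 : Ω → X →ₗ[R] X := fun w => (ψ w).1
  let ψ2 : Ω → X →ₗ[Rᵐᵒᵖ] X := fun w => (ψ w).2
  have a1 : ∀ w w' x, ψ1 (w + w') x = ψ1 w x + ψ1 w' x := fun w w' x =>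
    congrArg (fun p : EndPair X => p.1 x) (map_add ψ w w')
  have a2 : ∀ w w' x, ψ2 (w + w') x = ψ2 w x + ψ2 w' x := fun w w' x =>
    congrArg (fun p : EndPair X => p.2 x) (map_add ψ w w')
  have l1 : ∀ (a : R) w x, ψ1 (a • w) x = ψ1 w (op a • x) := fun a w x =>
    congrArg (fun p : EndPair X => p.1 x) (ψl a w)
  have l2 : ∀ (a : R) w x, ψ2 (a • w) x = a • ψ2 w x := fun a w x =>
    congrArg (fun p : EndPair X => p.2 x) (ψl a w)
  have r1 : ∀ (a : R) w x, ψ1 (op a • w) x = op a • ψ1 w x := fun a w x =>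
    congrArg (fun p : EndPair X => p.1 x) (ψr a w)
  have r2 : ∀ (a : R) w x, ψ2 (op a • w) x = ψ2 w (a • x) := fun a w x =>
    congrArg (fun p : EndPair X => p.2 x) (ψr a w)
  obtain ⟨H, H1, H2, H3, H4⟩ := exists_pairing (V := X) (U := X) hX
    (AddMonoidHom.mk' (fun x => AddMonoidHom.mk' (fun w => ψ1 w x) fun w w' => a1 w w' x)
      (fun x x' => by ext w; exact map_add (ψ1 w) x x'))
    (fun x a w => (l1 a w x).symm) (fun a x w => (ψ1 w).map_smul a x)
    (AddMonoidHom.id X) (fun _ _ => rfl) j.hom.toAddMonoidHom (hom_left_smul j)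
    (fun x => AddMonoidHom.mk' (fun p => ψ1 (r p) x) (fun p p' => by rw [map_add, a1]))
    (fun x a p => by
      change ψ1 (r (op a • p)) x = op a • ψ1 (r p) x
      rw [map_smul, r1])
    (fun x w => congrArg (fun y => ψ1 y x) (hr w))
  obtain ⟨K, K1, K2, K3, K4⟩ := exists_pairing' (V := X) (U := X) hX
    (AddMonoidHom.mk' (fun x => AddMonoidHom.mk' (fun w => ψ2 w x) fun w w' => a2 w w' x)
      (fun x x' => by ext w; exact map_add (ψ2 w) x x'))
    (fun x a w => (r2 a w x).symm) (fun a x w => (ψ2 w).map_smul (op a) x)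
    (AddMonoidHom.id X) (fun _ _ => rfl) j.hom.toAddMonoidHom (fun a w => hom_right_smul j (op a) w)
    (fun x => AddMonoidHom.mk' (fun p => ψ2 (l p) x) (fun p p' => by rw [map_add, a2]))
    (fun x a p => by
      change ψ2 (l (a • p)) x = a • ψ2 (l p) x
      rw [map_smul, l2])
    (fun x w => congrArg (fun y => ψ2 y x) (hl w))
  let Φ : P →+ EndPair X := AddMonoidHom.mk'
    (fun p => (({ toFun := fun x => H x p
                  map_add' := fun x x' => by rw [map_add, AddMonoidHom.add_apply]
                  map_smul' := fun a x => H3 a x p } : X →ₗ[R] X),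
               ({ toFun := fun x => K x p
                  map_add' := fun x x' => by rw [map_add, AddMonoidHom.add_apply]
                  map_smul' := fun a x => K3 a.unop x p } : X →ₗ[Rᵐᵒᵖ] X)))
    (fun p p' => Prod.ext (LinearMap.ext fun x => map_add (H x) p p')
      (LinearMap.ext fun x => map_add (K x) p p'))
  refine ⟨bimodHom (Z := endBimod X) Φ (fun a p => ?_) (fun a p => ?_), ?_⟩
  · refine Eq.trans ?_ (left_smul_toBimod (V := EndPair X) a (Φ p)).symm
    exact Prod.ext (LinearMap.ext fun x => (H2 x a p).symm) (LinearMap.ext fun x => K4 a x p)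
  · refine Eq.trans ?_ (right_smul_toBimod (V := EndPair X) (op a) (Φ p)).symm
    exact Prod.ext (LinearMap.ext fun x => H4 a x p) (LinearMap.ext fun x => (K2 x a p).symm)
  · ext w
    exact Prod.ext (LinearMap.ext fun x => H1 x w) (LinearMap.ext fun x => K1 x w)

/-- A surjection onto a projective module splits, and so does the inclusion of its kernel. -/
theorem exists_retraction {C Y₁ Y₂ Y₃ : Type u} [Ring C] [AddCommGroup Y₁] [AddCommGroup Y₂]
    [AddCommGroup Y₃] [Module C Y₁] [Module C Y₂] [Module C Y₃] (f : Y₁ →ₗ[C] Y₂)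
    (g : Y₂ →ₗ[C] Y₃) (hf : Function.Injective f) (hg : Function.Surjective g)
    (hfg : Function.Exact f g) (h : Module.Projective C Y₃) :
    ∃ l : Y₂ →ₗ[C] Y₁, ∀ y, l (f y) = y := by
  obtain ⟨s, hs⟩ := Module.projective_lifting_property g LinearMap.id hg
  have := (hfg.split_tfae hf hg).out 0 1
  obtain ⟨l, hl⟩ := this.1 ⟨s, hs⟩
  exact ⟨l, DFunLike.congr_fun hl⟩

/-- For a projective bimodule `X` there are no extensions of a bimodule `Y` by `endBimod X` if `Y`
is projective as a left module and as a right module. This is shown by dimension shifting: the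
syzygies of `Y` are then direct summands as one-sided modules, so that `exists_extension_endBimod`
applies. -/
theorem ext_endBimod_eq_zero (hX : Module.Projective (Env k R) X) (n : ℕ) (Y : BimodCat k R)
    (hl : Module.Projective R Y) (hr : Module.Projective Rᵐᵒᵖ Y)
    (x : Ext Y (endBimod X) (n + 1)) : x = 0 := by
  induction n generalizing Y with
  | zero =>
    obtain ⟨Ω, P, i, p, w, hS, hP⟩ := exists_projective_presentation Y
    obtain ⟨x, rfl⟩ := exists_extClass_comp hS hP x
    obtain ⟨φ, rfl⟩ := (Ext.mk₀_bijective _ _).2 x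
    obtain ⟨l, hl⟩ := exists_retraction (leftLin i) (leftLin p) (injective_f hS) (surjective_g hS)
      (exact_f_g hS) hl
    obtain ⟨r, hr⟩ := exists_retraction (rightLin i) (rightLin p) (injective_f hS)
      (surjective_g hS) (exact_f_g hS) hr
    obtain ⟨Φ, rfl⟩ := exists_extension_endBimod hX i l hl r hr φ
    rw [← Ext.mk₀_comp_mk₀, hS.extClass_comp_assoc]
  | succ n ih =>
    obtain ⟨Ω, P, i, p, w, hS, hP⟩ := exists_projective_presentation Y
    obtain ⟨x, rfl⟩ := exists_extClass_comp hS hP x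
    have hP' : Module.Projective (Env k R) P := (IsProjective.iff_projective P).2 hP
    obtain ⟨l, hl⟩ := exists_retraction (leftLin i) (leftLin p) (injective_f hS) (surjective_g hS)
      (exact_f_g hS) hl
    obtain ⟨r, hr⟩ := exists_retraction (rightLin i) (rightLin p) (injective_f hS)
      (surjective_g hS) (exact_f_g hS) hr
    have := projective_left hP'
    have := projective_right hP'
    rw [ih Ω (Module.Projective.of_split (leftLin i) l (LinearMap.ext hl))
      (Module.Projective.of_split (rightLin i) r (LinearMap.ext hr)) x, Ext.comp_zero]

end Endomorphisms

/-! ### Injective modules under restriction of scalars -/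

section RightProjective

variable {k : Type u} [Field k] {C D C' D' : Type u} [Ring C] [Ring D] [Ring C'] [Ring D']
  [Algebra k C] [Algebra k D] [Algebra k C'] [Algebra k D']

/-- The algebra `D` is projective as a right module over `C`: it has a dual basis, consisting of
elements `e i` and of coordinates `f d i`. -/
def RightProjective (φ : C →ₐ[k] D) : Prop :=
  ∃ (ι : Type u) (e : ι → D) (f : D →ₗ[k] (ι →₀ C)),
    (∀ d x i, f (d * φ x) i = f d i * x) ∧ ∀ d, (f d).sum (fun i c => e i * φ c) = d

/-- The map `∑ cᵢ ↦ ∑ eᵢ φ(cᵢ)`. -/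
def combination (φ : C →ₐ[k] D) {ι : Type u} (e : ι → D) : (ι →₀ C) →ₗ[k] D :=
  Finsupp.lsum k fun i => (LinearMap.mulLeft k (e i)).comp φ.toLinearMap

theorem combination_eq_sum (φ : C →ₐ[k] D) {ι : Type u} (e : ι → D) (t : ι →₀ C) :
    combination φ e t = t.sum (fun i c => e i * φ c) := rfl

theorem combination_single (φ : C →ₐ[k] D) {ι : Type u} (e : ι → D) (i : ι) (c : C) :
    combination φ e (Finsupp.single i c) = e i * φ c := by
  rw [combination_eq_sum, Finsupp.sum_single_index]
  rw [map_zero, mul_zero]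

/-- The products of two dual bases form a dual basis of the tensor product. -/
theorem RightProjective.tensor {φ : C →ₐ[k] D} {ψ : C' →ₐ[k] D'} (hφ : RightProjective φ)
    (hψ : RightProjective ψ) : RightProjective (Algebra.TensorProduct.map φ ψ) := by
  obtain ⟨ι, e, f, hf, he⟩ := hφ
  obtain ⟨κ, e', f', hf', he'⟩ := hψ
  refine ⟨ι × κ, fun i => e i.1 ⊗ₜ e' i.2,
    (finsuppTensorFinsupp k k C C' ι κ).toLinearMap.comp (TensorProduct.map f f'),
    fun d x i => ?_, fun d => ?_⟩
  · induction d using TensorProduct.induction_on with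
    | zero => simp
    | add d d' hd hd' => rw [add_mul, map_add, map_add, Finsupp.add_apply, Finsupp.add_apply, hd,
        hd', add_mul]
    | tmul d d' =>
      induction x using TensorProduct.induction_on with
      | zero => simp
      | add x x' hx hx' => rw [map_add, mul_add, mul_add, map_add, Finsupp.add_apply, hx, hx']
      | tmul x x' =>
        rw [Algebra.TensorProduct.map_tmul, Algebra.TensorProduct.tmul_mul_tmul]
        simp only [LinearMap.comp_apply, LinearEquiv.coe_coe, TensorProduct.map_tmul]
        rw [← Prod.mk.eta (p := i), finsuppTensorFinsupp_apply, finsuppTensorFinsupp_apply, hf, hf',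
          Algebra.TensorProduct.tmul_mul_tmul]
  · rw [← combination_eq_sum]
    have key : ∀ (t : ι →₀ C) (t' : κ →₀ C'),
        combination (Algebra.TensorProduct.map φ ψ) (fun i : ι × κ => e i.1 ⊗ₜ[k] e' i.2)
          (finsuppTensorFinsupp k k C C' ι κ (t ⊗ₜ t')) =
          combination φ e t ⊗ₜ combination ψ e' t' := fun t t' => by
      induction t using Finsupp.induction_linear with
      | zero => simp
      | add a b ha hb => rw [TensorProduct.add_tmul, map_add, map_add, ha, hb, map_add,
          TensorProduct.add_tmul]
      | single i c =>
        induction t' using Finsupp.induction_linear with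
        | zero => simp
        | add a b ha hb => rw [TensorProduct.tmul_add, map_add, map_add, ha, hb, map_add,
            TensorProduct.tmul_add]
        | single j c' =>
          rw [finsuppTensorFinsupp_single, combination_single, combination_single,
            combination_single, Algebra.TensorProduct.map_tmul,
            Algebra.TensorProduct.tmul_mul_tmul]
    induction d using TensorProduct.induction_on with
    | zero => rw [map_zero, map_zero]
    | add d d' hd hd' => rw [map_add, map_add, hd, hd']
    | tmul d d' =>
      refine (key (f d) (f' d')).trans ?_
      rw [combination_eq_sum, combination_eq_sum, he, he']

/-- Restriction of scalars preserves injective modules along a homomorphism `C → D` for which `D` is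
projective as a right module. -/
theorem RightProjective.injective {φ : C →ₐ[k] D} (hφ : RightProjective φ) (J : ModuleCat.{u} D)
    [Injective J] : Injective ((ModuleCat.restrictScalars φ.toRingHom).obj J) := by
  obtain ⟨ι, e, f, hf, he⟩ := hφ
  have hJ : Module.Injective D J := Module.injective_module_of_injective_object D J
  let J' := (ModuleCat.restrictScalars φ.toRingHom).obj J
  have : Module.Injective C J' := Module.Baer.injective (fun I g => ?_)
  · exact (Module.injective_iff_injective_object C J').1 this
  let g' : I →+ J := g.toAddMonoidHom
  have hg' : ∀ (c : C) (i : I), g' (c • i) = φ c • g' i := fun c i => g.map_smul c i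
  let G : (I →₀ D) →ₗ[D] D := Finsupp.linearCombination D fun i : I => φ i
  let H : (I →₀ D) →ₗ[D] J := Finsupp.linearCombination D g'
  -- `H t = ∑ⱼ eⱼ g(uⱼ)`, where `u` consists of the coordinates of `G t`, which lie in `I`
  let U : (I →₀ D) →+ (ι →₀ I) := Finsupp.liftAddHom fun i =>
    (Finsupp.mapRange.addMonoidHom ((smulAddHom C I).flip i)).comp f.toAddMonoidHom
  let K : (ι →₀ I) →+ J := Finsupp.liftAddHom fun j =>
    (DistribSMul.toAddMonoidHom J (e j)).comp g'
  have hU : ∀ t j, ((U t j : I) : C) = f (G t) j := fun t j => by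
    induction t using Finsupp.induction_linear with
    | zero => simp
    | add a b ha hb =>
      rw [map_add, map_add, map_add, Finsupp.add_apply, Finsupp.add_apply, ← ha, ← hb]; rfl
    | single i d =>
      rw [Finsupp.linearCombination_single, smul_eq_mul, hf, Finsupp.liftAddHom_apply_single]
      rfl
  have hK : ∀ t, K (U t) = H t := fun t => by
    induction t using Finsupp.induction_linear with
    | zero => simp
    | add a b ha hb => rw [map_add, map_add, map_add, ha, hb]
    | single i d =>
      rw [Finsupp.linearCombination_single, Finsupp.liftAddHom_apply_single]
      have key : ∀ u : ι →₀ C, K (Finsupp.mapRange.addMonoidHom ((smulAddHom C I).flip i) u) =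
          combination φ e u • g' i := fun u => by
        induction u using Finsupp.induction_linear with
        | zero => simp
        | add a b ha hb => rw [map_add, map_add, map_add, ha, hb, add_smul]
        | single j c =>
          rw [combination_single, Finsupp.mapRange.addMonoidHom_apply, Finsupp.mapRange_single,
            Finsupp.liftAddHom_apply_single, mul_smul, ← hg']
          rfl
      refine (key (f d)).trans ?_
      rw [combination_eq_sum, he]
  have hker : ∀ t, G t = 0 → H t = 0 := fun t ht => by
    have : U t = 0 := Finsupp.ext fun j => Subtype.ext ((hU t j).trans (by rw [ht, map_zero]; rfl))
    rw [← hK, this, map_zero]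
  have hle : LinearMap.ker G ≤ LinearMap.ker H := fun t ht => hker t ht
  obtain ⟨h, hh⟩ := hJ.out ((LinearMap.ker G).liftQ G le_rfl)
    (LinearMap.ker_eq_bot.1 (Submodule.ker_liftQ_eq_bot _ _ _ le_rfl))
    ((LinearMap.ker G).liftQ H hle)
  have hGH : ∀ t, h (G t) = H t := fun t => hh (Submodule.Quotient.mk t)
  refine ⟨({ toFun := fun c => h (φ c)
             map_add' := fun c c' => by rw [map_add]; exact map_add h _ _
             map_smul' := fun c c' => by
              rw [smul_eq_mul, map_mul, ← smul_eq_mul, map_smul]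
              rfl } : C →ₗ[C] J'), fun i hi => ?_⟩
  have := hGH (Finsupp.single ⟨i, hi⟩ 1)
  have hi' : h (φ i) = g' ⟨i, hi⟩ := by
    simpa [G, H, Finsupp.linearCombination_single] using this
  exact hi'

end RightProjective

section SquareZero

variable {k : Type u} [Field k] {R : Type u} [Ring R] [Algebra k R]
  {X : Type u} [AddCommGroup X] [Module k X] [Module R X] [Module Rᵐᵒᵖ X]
  [SMulCommClass R Rᵐᵒᵖ X] [IsScalarTower k R X] [IsScalarTower k Rᵐᵒᵖ X]

/-- A homomorphism `C → D` is right projective if the right module `D` is projective. Right modules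
over `C` are given as modules over a ring `E` that is isomorphic to `Cᵐᵒᵖ`. -/
theorem rightProjective_of_projective {C D E : Type u} [Ring C] [Ring D] [Ring E] [Algebra k C]
    [Algebra k D] (φ : C →ₐ[k] D) (u : E ≃+* Cᵐᵒᵖ) [Module E D]
    (hφ : ∀ (c : C) (d : D), u.symm (op c) • d = d * φ c) (h : Module.Projective E D) :
    RightProjective φ := by
  obtain ⟨s, hs⟩ := h
  let un : E →+ C := (MulOpposite.opAddEquiv.symm.toAddMonoidHom).comp u.toAddMonoidHom
  have un_mul : ∀ c x, un (u.symm (op c) * x) = un x * c := fun c x => by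
    change (u (u.symm (op c) * x)).unop = (u x).unop * c
    rw [map_mul, RingEquiv.apply_symm_apply, MulOpposite.unop_mul, MulOpposite.unop_op]
  have key : ∀ (d : D) (x : C) i, un (s (d * φ x) i) = un (s d i) * x := fun d x i => by
    rw [← hφ, map_smul, Finsupp.smul_apply, smul_eq_mul, un_mul]
  refine ⟨D, id,
    { toFun := fun d => Finsupp.mapRange un (map_zero un) (s d)
      map_add' := fun d d' => by rw [map_add, Finsupp.mapRange_add (map_add un)]
      map_smul' := fun c d => by
        ext i
        have := key d (algebraMap k C c) i
        rw [φ.commutes, ← Algebra.commutes, ← Algebra.smul_def, ← Algebra.commutes,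
          ← Algebra.smul_def] at this
        exact this }, fun d x i => key d x i, fun d => ?_⟩
  change (Finsupp.mapRange un (map_zero un) (s d)).sum (fun i c => id i * φ c) = d
  rw [Finsupp.sum_mapRange_index (fun i => by rw [map_zero, mul_zero])]
  refine Eq.trans ?_ (hs d)
  rw [Finsupp.linearCombination_apply]
  refine Finsupp.sum_congr fun i _ => (hφ (un (s d i)) i).symm.trans ?_
  change u.symm (op (u (s d i)).unop) • i = s d i • i
  rw [MulOpposite.op_unop, RingEquiv.symm_apply_apply]

variable (k R X) in
theorem rightProjective_incl (h : Module.Projective Rᵐᵒᵖ X) : RightProjective (incl k R X) := by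
  let m : Module Rᵐᵒᵖ (SqZ R X) := inferInstanceAs (Module Rᵐᵒᵖ (R × X))
  let e : Rᵐᵒᵖ ≃ₗ[Rᵐᵒᵖ] R :=
    { MulOpposite.opAddEquiv.symm with map_smul' := fun a b => rfl }
  have : Module.Projective Rᵐᵒᵖ R := Module.Projective.of_equiv' e
  refine rightProjective_of_projective _ (RingEquiv.refl _) (fun c d => ?_)
    (inferInstanceAs (Module.Projective Rᵐᵒᵖ (R × X)))
  ext
  · change d.fst * c = (d * TrivSqZeroExt.inl c).fst
    simp
  · change op c • d.snd = (d * TrivSqZeroExt.inl c).snd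
    simp

variable (k R X) in
theorem rightProjective_op_incl (h : Module.Projective R X) :
    RightProjective (AlgHom.op (incl k R X)) := by
  have : Module.Projective R (SqZ R X) := inferInstanceAs (Module.Projective R (R × X))
  refine rightProjective_of_projective _ (RingEquiv.opOp R) (fun c d => ?_)
    (Module.Projective.of_equiv' (MulOpposite.opLinearEquiv R : SqZ R X ≃ₗ[R] (SqZ R X)ᵐᵒᵖ))
  change op (c.unop • d.unop) = op (TrivSqZeroExt.inl c.unop * d.unop)
  congr 1
  ext
  · simp
  · simp

variable (k R X) in
theorem rightProjective_envMap (h : Module.Projective (Env k R) (ofBimod k R X)) :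
    RightProjective (envMap (incl k R X)) := by
  have hl := projective_left h
  have hr := projective_right h
  let el : ofBimod k R X ≃ₗ[R] X :=
    { AddEquiv.refl X with map_smul' := fun a x => left_smul_toBimod (k := k) (V := X) a x }
  let er : ofBimod k R X ≃ₗ[Rᵐᵒᵖ] X :=
    { AddEquiv.refl X with map_smul' := fun a x => right_smul_toBimod (k := k) (V := X) a x }
  exact (rightProjective_incl k R X (Module.Projective.of_equiv' er)).tensor
    (rightProjective_op_incl k R X (Module.Projective.of_equiv' el))

end SquareZero

/-! ### Extensions of induced bimodules -/

section Induced

variable {k : Type u} [Field k] {R : Type u} [Ring R] [Algebra k R]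
  {X : Type u} [AddCommGroup X] [Module k X] [Module R X] [Module Rᵐᵒᵖ X]
  [SMulCommClass R Rᵐᵒᵖ X] [IsScalarTower k R X] [IsScalarTower k Rᵐᵒᵖ X]

variable (k R X) in
/-- The unit `X^{⊗n} → S ⊗_R X^{⊗n} ⊗_R S`. -/
def barUnit (n : ℕ) : Pow k R X n ⟶ res (bar k R X n) :=
  bimodHom (Z := res (bar k R X n))
    (AddMonoidHom.mk' (fun w => (barElt w 0 0 0 : bar k R X n))
      (fun w w' => by
        have := barElt_add w w' 0 0 0 0 0 0
        rwa [add_zero, add_zero] at this))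
    (fun a w => by
      refine Eq.trans ?_ (left_smul_res (bar k R X n) a (barElt w 0 0 0)).symm
      rw [inl_smul_barElt, smul_zero, smul_zero]
      rfl)
    (fun a w => by
      refine Eq.trans ?_ (right_smul_res (bar k R X n) a (barElt w 0 0 0)).symm
      rw [op_inl_smul_barElt, smul_zero, smul_zero]
      rfl)

theorem bar_hom_ext' {n : ℕ} {W : BimodCat k (SqZ R X)} {f g : bar k R X n ⟶ W}
    (h : barUnit k R X n ≫ (restrictBimod (incl k R X)).map f =
      barUnit k R X n ≫ (restrictBimod (incl k R X)).map g) : f = g :=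
  bar_hom_ext fun w => congrArg (fun q : Pow k R X n ⟶ res W => (show W from q w)) h

theorem exists_bar_lift' {n : ℕ} {W : BimodCat k (SqZ R X)} (f : Pow k R X n ⟶ res W) :
    ∃ g : bar k R X n ⟶ W, barUnit k R X n ≫ (restrictBimod (incl k R X)).map g = f := by
  obtain ⟨g, hg⟩ := exists_bar_lift f
  refine ⟨g, ?_⟩
  ext w
  exact hg w

/-- A homomorphism from `Bₙ` amounts to one from `X^{⊗n}` over `R`, and `X^{⊗n}` is projective for
`n > 0`. -/
theorem bar_projective (hX : Module.Projective (Env k R) (ofBimod k R X)) (n : ℕ) :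
    Projective (bar k R X (n + 1)) := by
  have hP : Projective (Pow k R X (n + 1)) :=
    (IsProjective.iff_projective _).1 (tensorPower_projective hX n)
  refine ⟨fun {U V} f e he => ?_⟩
  have : Epi ((restrictBimod (incl k R X)).map e) := inferInstance
  obtain ⟨g, hg⟩ := exists_bar_lift' (Projective.factorThru
    (barUnit k R X (n + 1) ≫ (restrictBimod (incl k R X)).map f)
    ((restrictBimod (incl k R X)).map e))
  refine ⟨g, bar_hom_ext' ?_⟩
  rw [Functor.map_comp, reassoc_of% hg, Projective.factorThru_comp]

/-- Restriction of extensions of an induced bimodule by `W`, along the unit, is injective. -/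
theorem ext_bar_eq_zero (hX : Module.Projective (Env k R) (ofBimod k R X)) (m : ℕ) {n : ℕ}
    (W : BimodCat k (SqZ R X)) (x : Ext (bar k R X m) W n)
    (hx : (Ext.mk₀ (barUnit k R X m)).comp (x.mapExactFunctor (restrictBimod (incl k R X)))
      (zero_add n) = 0) : x = 0 := by
  induction n generalizing W with
  | zero =>
    obtain ⟨f, rfl⟩ := (Ext.mk₀_bijective _ _).2 x
    rw [Ext.mapExactFunctor_mk₀, Ext.mk₀_comp_mk₀] at hx
    have h0 := (Ext.mk₀_bijective _ _).1 (hx.trans (Ext.mk₀_zero _ _).symm)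
    have : f = 0 := bar_hom_ext' (by rw [h0, Functor.map_zero, Limits.comp_zero])
    rw [this, Ext.mk₀_zero]
  | succ n ih =>
    -- dimension shifting in the second variable; the bimodule `J` remains injective over `R`
    obtain ⟨J, W', i, p, w, hS, hJ⟩ := exists_injective_presentation W
    obtain ⟨y, rfl⟩ := exists_comp_extClass hS hJ x
    have e1 : (y.comp hS.extClass rfl).mapExactFunctor (restrictBimod (incl k R X)) =
        (y.mapExactFunctor (restrictBimod (incl k R X))).comp
          (hS.map_of_exact (restrictBimod (incl k R X))).extClass rfl :=
      (Ext.mapExactFunctor_comp _ _ _ _).trans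
        (congrArg (fun t => Ext.comp _ t rfl) (Ext.mapExactFunctor_extClass _ _))
    have e2 := (Ext.comp_assoc _ _ _ (zero_add n) rfl (by omega)).trans
      ((congrArg (fun t => Ext.comp _ t (zero_add (n + 1))) e1.symm).trans hx)
    obtain ⟨z, hz⟩ : ∃ z : Ext (Pow k R X m) (res J) n,
        z.comp (Ext.mk₀ ((restrictBimod (incl k R X)).map p)) (add_zero n) =
          (Ext.mk₀ (barUnit k R X m)).comp (y.mapExactFunctor (restrictBimod (incl k R X)))
            (zero_add n) := Ext.covariant_sequence_exact₃ _ _ _ rfl e2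
    cases n with
    | zero =>
      obtain ⟨ζ, rfl⟩ := (Ext.mk₀_bijective _ _).2 z
      obtain ⟨g, rfl⟩ := exists_bar_lift' (W := J) ζ
      obtain ⟨f, rfl⟩ := (Ext.mk₀_bijective _ _).2 y
      rw [Ext.mapExactFunctor_mk₀, Ext.mk₀_comp_mk₀, Ext.mk₀_comp_mk₀] at hz
      have hf : f = g ≫ p := bar_hom_ext' (by
        rw [← (Ext.mk₀_bijective _ _).1 hz, Category.assoc, Functor.map_comp])
      rw [hf, ← Ext.mk₀_comp_mk₀, Ext.comp_assoc _ _ _ (add_zero 0) (zero_add 1) (by omega),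
        hS.comp_extClass, Ext.comp_zero]
    | succ n =>
      have : Injective (res J) := (rightProjective_envMap k R X hX).injective J
      have hz0 : z = 0 := Ext.eq_zero_of_injective (I := res J) z
      rw [hz0, Ext.zero_comp] at hz
      rw [ih _ y hz.symm, Ext.zero_comp]

end Induced

/-! ### Bimodules on which a central element acts differently -/

section Center

variable {E : Type u} [Ring E]

/-- Multiplication by a central element. -/
def centralHom (z : E) (hz : ∀ w, z * w = w * z) (Y : ModuleCat.{u} E) : Y ⟶ Y :=
  ModuleCat.ofHom
    { toFun := fun y => z • y
      map_add' := smul_add z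
      map_smul' := fun w y => by rw [RingHom.id_apply, smul_smul, smul_smul, hz] }

theorem centralHom_comp (z : E) (hz : ∀ w, z * w = w * z) {Y Z : ModuleCat.{u} E} (f : Y ⟶ Z) :
    centralHom z hz Y ≫ f = f ≫ centralHom z hz Z := by
  ext y
  exact f.hom.map_smul z y

/-- A central element acts in the same way on an extension through its source and through its
target. -/
theorem ext_centralHom_comp (z : E) (hz : ∀ w, z * w = w * z) (n : ℕ) (Y Z : ModuleCat.{u} E)
    (x : Ext Y Z n) : (Ext.mk₀ (centralHom z hz Y)).comp x (zero_add n) =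
      x.comp (Ext.mk₀ (centralHom z hz Z)) (add_zero n) := by
  induction n generalizing Y with
  | zero =>
    obtain ⟨f, rfl⟩ := (Ext.mk₀_bijective _ _).2 x
    rw [Ext.mk₀_comp_mk₀, Ext.mk₀_comp_mk₀, centralHom_comp]
  | succ n ih =>
    obtain ⟨Ω, P, i, p, w, hS, hP⟩ := exists_projective_presentation Y
    obtain ⟨x, rfl⟩ := exists_extClass_comp hS hP x
    let φ : ShortComplex.mk i p w ⟶ ShortComplex.mk i p w :=
      { τ₁ := centralHom z hz Ω
        τ₂ := centralHom z hz P
        τ₃ := centralHom z hz Y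
        comm₁₂ := centralHom_comp z hz i
        comm₂₃ := centralHom_comp z hz p }
    have := ShortComplex.ShortExact.extClass_naturality hS hS φ
    rw [← Ext.comp_assoc _ _ _ (zero_add 1) (add_comm 1 n) (by omega), ← this,
      Ext.comp_assoc _ _ _ (add_zero 1) (zero_add n) (by omega), ih,
      Ext.comp_assoc _ _ _ (add_comm 1 n) (add_zero n) (by omega)]

/-- There are no extensions between two modules if a central element annihilates one of them and
squares to the identity on the other one. -/
theorem ext_eq_zero_of_central (z : E) (hz : ∀ w, z * w = w * z) {n : ℕ} {Y Z : ModuleCat.{u} E}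
    (hY : ∀ y : Y, z • y = 0) (hZ : ∀ y : Z, z • z • y = y) (x : Ext Y Z n) : x = 0 := by
  have h1 : centralHom z hz Y = 0 := by ext y; exact hY y
  have h2 : centralHom z hz Z ≫ centralHom z hz Z = 𝟙 Z := by ext y; exact hZ y
  have h := ext_centralHom_comp z hz n Y Z x
  rw [h1, Ext.mk₀_zero, Ext.zero_comp] at h
  rw [← Ext.comp_mk₀_id x, ← h2, ← Ext.mk₀_comp_mk₀, ← Ext.comp_assoc_of_third_deg_zero, ← h,
    Ext.zero_comp]

end Center

/-! ### Restriction to the diagonal -/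

section Diagonal

variable (k : Type u) [Field k] (R : Type u) [Ring R] [Algebra k R]
  (X : Type u) [AddCommGroup X] [Module k X] [Module R X] [Module Rᵐᵒᵖ X]
  [SMulCommClass R Rᵐᵒᵖ X] [IsScalarTower k R X] [IsScalarTower k Rᵐᵒᵖ X]

/-- The restriction map `HHⁿ(R ⊕ X) → HHⁿ(R)`. -/
abbrev retract (n : ℕ) : HHCohomology k (SqZ R X) n → HHCohomology k R n :=
  retractMap (incl k R X) (proj k R X) (fun _ => rfl) n

/-- The inclusion of `X` in `R ⊕ X`, as a homomorphism of `R`-bimodules. -/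
def inrHom : ofBimod k R X ⟶ res (regular k (SqZ R X)) :=
  bimodHom (Z := res (regular k (SqZ R X)))
    (AddMonoidHom.mk' (fun x : ofBimod k R X =>
      (toReg (TrivSqZeroExt.inr (unBimod x)) : regular k (SqZ R X)))
      (fun x y => TrivSqZeroExt.inr_add R (unBimod x) (unBimod y)))
    (fun a x => by
      have h : (toReg (TrivSqZeroExt.inr (a • unBimod x)) : regular k (SqZ R X)) =
          (TrivSqZeroExt.inl a : SqZ R X) • toReg (TrivSqZeroExt.inr (unBimod x)) := by
        rw [left_smul_toReg, TrivSqZeroExt.inl_mul_inr]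
      exact (congrArg (fun y : X => (toReg (TrivSqZeroExt.inr y : SqZ R X) : regular k (SqZ R X)))
        (left_smul_toBimod (k := k) (V := X) a (unBimod x))).trans
          (h.trans (left_smul_res (regular k (SqZ R X)) a _).symm))
    (fun a x => by
      have h : (toReg (TrivSqZeroExt.inr (op a • unBimod x)) : regular k (SqZ R X)) =
          op (TrivSqZeroExt.inl a : SqZ R X) • toReg (TrivSqZeroExt.inr (unBimod x)) := by
        rw [right_smul_toReg, TrivSqZeroExt.inr_mul_inl]
      exact (congrArg (fun y : X => (toReg (TrivSqZeroExt.inr y : SqZ R X) : regular k (SqZ R X)))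
        (right_smul_toBimod (k := k) (V := X) (op a) (unBimod x))).trans
          (h.trans (right_smul_res (regular k (SqZ R X)) a _).symm))

/-- The projection of `R ⊕ X` onto `R`, as a homomorphism of `R`-bimodules. -/
abbrev fstHom : res (regular k (SqZ R X)) ⟶ regular k R :=
  retractionHom (incl k R X) (proj k R X) (fun _ => rfl)

theorem inrHom_fstHom : inrHom k R X ≫ fstHom k R X = 0 := by
  ext x
  rfl

theorem restricted_shortExact : (ShortComplex.mk _ _ (inrHom_fstHom k R X)).ShortExact := by
  refine shortExact_of_exact _ (fun x y h => ?_) (fun r => ?_) (fun s hs => ?_)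
  · exact TrivSqZeroExt.inr_injective (R := R) (M := X) h
  · exact ⟨(toReg (TrivSqZeroExt.inl (unReg r)) : regular k (SqZ R X)), rfl⟩
  · exact ⟨toBimod (TrivSqZeroExt.snd (show SqZ R X from s)),
      TrivSqZeroExt.ext (R := R) (M := X) (show (0 : R) = _ from Eq.symm hs) rfl⟩

variable {k R X}

/-- If multiplication by a central idempotent `e` from the left and from the right are complementary
projections of `X`, then there are no extensions of `R` by `X`. -/
theorem ext_regular_eq_zero {e : R} (he : e * e = e) (hc : ∀ r, e * r = r * e)
    (hX : ∀ x : X, e • x + op e • x = x) {n : ℕ} (x : Ext (regular k R) (ofBimod k R X) n) :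
    x = 0 := by
  have hd : ∀ (Y : BimodCat k R) (y : Y),
      (e ⊗ₜ[k] (1 : Rᵐᵒᵖ) - (1 : R) ⊗ₜ[k] op e : Env k R) • y = e • y - op e • y :=
    fun Y y => by rw [sub_smul, ← left_smul_def, ← right_smul_def]
  refine ext_eq_zero_of_central (e ⊗ₜ[k] (1 : Rᵐᵒᵖ) - (1 : R) ⊗ₜ[k] op e : Env k R) (fun w => ?_)
    (fun r => ?_) (fun x => ?_) x
  · induction w using env_induction with
    | h0 => exact (mul_zero _).trans (zero_mul _).symm
    | hadd a b ha hb => rw [mul_add, add_mul, ha, hb]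
    | ht a b =>
      simp only [sub_mul, mul_sub, Algebra.TensorProduct.tmul_mul_tmul, one_mul, mul_one, hc,
        ← MulOpposite.op_mul]
  · refine (hd _ r).trans ?_
    refine (congrArg₂ (· - ·) (left_smul_toReg e (unReg r))
      (right_smul_toReg e (unReg r))).trans ?_
    rw [hc, sub_self]
  · have key : ∀ x : X, e • (e • x - op e • x) - op e • (e • x - op e • x) = x := fun x => by
      have h1 : e • op e • x = 0 := by
        have := congrArg (e • ·) (hX x)
        simpa [smul_smul, he] using this
      have h2 : op e • op e • x = op e • x := by rw [smul_smul, ← MulOpposite.op_mul, he]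
      have h3 : op e • e • x = 0 := (smul_comm e (op e) x).symm.trans h1
      rw [smul_sub, smul_sub, h1, h3, smul_smul, he, h2, sub_zero, zero_sub, sub_neg_eq_add, hX]
    have hX' : ∀ x : X, e • (toBimod x : ofBimod k R X) - op e • (toBimod x : ofBimod k R X) =
        toBimod (e • x - op e • x) := fun x => by
      rw [left_smul_toBimod, right_smul_toBimod]; rfl
    refine (hd _ _).trans ?_
    rw [hd]
    refine Eq.trans ?_ (key x)
    refine (congrArg (fun y : ofBimod k R X => e • y - op e • y) (hX' x)).trans ?_
    exact hX' _

/-- There are no extensions of `R` by the kernel `X` of the projection `R ⊕ X → R`, so that the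
projection is injective on extensions of `R`. -/
theorem eq_zero_of_comp_fstHom {e : R} (he : e * e = e) (hc : ∀ r, e * r = r * e)
    (hX : ∀ x : X, e • x + op e • x = x) {n : ℕ} (y : Ext (regular k R)
      (res (regular k (SqZ R X))) n)
    (h : y.comp (Ext.mk₀ (fstHom k R X)) (add_zero n) = 0) : y = 0 := by
  obtain ⟨z, rfl⟩ := Ext.covariant_sequence_exact₂ _ (restricted_shortExact k R X) y h
  have hz : z = 0 := ext_regular_eq_zero he hc hX z
  rw [hz, Ext.zero_comp]

/-- The identification of a bimodule over `R` with its restriction along `R → R ⊕ X → R`. -/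
def counitHom (Y : BimodCat k R) :
    res ((restrictBimod (proj k R X)).obj Y) ⟶ Y :=
  bimodHom (Y := res ((restrictBimod (proj k R X)).obj Y)) (Z := Y) (AddMonoidHom.id Y)
    (fun a y => (left_smul_res ((restrictBimod (proj k R X)).obj Y) a y).trans
      (left_smul_restrict (proj k R X) Y (TrivSqZeroExt.inl a) y))
    (fun a y => (right_smul_res ((restrictBimod (proj k R X)).obj Y) a y).trans
      (right_smul_restrict (proj k R X) Y (TrivSqZeroExt.inl a) y))

theorem counitHom_naturality {Y Z : BimodCat k R} (f : Y ⟶ Z) :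
    (restrictBimod (incl k R X)).map ((restrictBimod (proj k R X)).map f) ≫ counitHom Z =
      counitHom Y ≫ f := rfl

/-- Restriction from `R` to `R ⊕ X` and back to `R` does not change extensions. -/
theorem ext_counitHom (n : ℕ) (Y Z : BimodCat k R) (x : Ext Y Z n) :
    ((x.mapExactFunctor (restrictBimod (proj k R X))).mapExactFunctor
      (restrictBimod (incl k R X))).comp (Ext.mk₀ (counitHom Z)) (add_zero n) =
      (Ext.mk₀ (counitHom (X := X) Y)).comp x (zero_add n) := by
  induction n generalizing Y with
  | zero =>
    obtain ⟨f, rfl⟩ := (Ext.mk₀_bijective _ _).2 x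
    rw [Ext.mapExactFunctor_mk₀, Ext.mapExactFunctor_mk₀, Ext.mk₀_comp_mk₀, Ext.mk₀_comp_mk₀,
      counitHom_naturality]
  | succ n ih =>
    -- both functors are exact, so a presentation of `Y` reduces the degree
    obtain ⟨Ω, P, i, p, w, hS, hP⟩ := exists_projective_presentation Y
    obtain ⟨x, rfl⟩ := exists_extClass_comp hS hP x
    let hS' := (hS.map_of_exact (restrictBimod (proj k R X))).map_of_exact
      (restrictBimod (incl k R X))
    let φ : ((ShortComplex.mk i p w).map (restrictBimod (proj k R X))).map
        (restrictBimod (incl k R X)) ⟶ ShortComplex.mk i p w :=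
      { τ₁ := counitHom Ω
        τ₂ := counitHom P
        τ₃ := counitHom Y
        comm₁₂ := (counitHom_naturality i).symm
        comm₂₃ := (counitHom_naturality p).symm }
    have h1 : ((hS.extClass.comp x (add_comm 1 n)).mapExactFunctor
        (restrictBimod (proj k R X))).mapExactFunctor (restrictBimod (incl k R X)) =
        hS'.extClass.comp ((x.mapExactFunctor (restrictBimod (proj k R X))).mapExactFunctor
          (restrictBimod (incl k R X))) (add_comm 1 n) := by
      rw [Ext.mapExactFunctor_comp, Ext.mapExactFunctor_comp, Ext.mapExactFunctor_extClass]
      exact congrArg (fun t => Ext.comp t _ (add_comm 1 n)) (Ext.mapExactFunctor_extClass _ _)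
    rw [h1]
    refine (Ext.comp_assoc _ _ _ (add_comm 1 n) (add_zero n) (by omega)).trans ?_
    refine (congrArg (fun t => hS'.extClass.comp t (add_comm 1 n)) (ih Ω x)).trans ?_
    refine (Ext.comp_assoc _ _ _ (add_zero 1) (zero_add n) (by omega)).symm.trans ?_
    refine (congrArg (fun t => Ext.comp t x (add_comm 1 n))
      (ShortComplex.ShortExact.extClass_naturality hS' hS φ)).trans ?_
    exact Ext.comp_assoc _ _ _ (zero_add 1) (add_comm 1 n) (by omega)

end Diagonal

/-! ### Surjectivity of the restriction to the diagonal -/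

section Surjectivity

variable (k : Type u) [Field k] (R : Type u) [Ring R] [Algebra k R]
  (X : Type u) [AddCommGroup X] [Module k X] [Module R X] [Module Rᵐᵒᵖ X]
  [SMulCommClass R Rᵐᵒᵖ X] [IsScalarTower k R X] [IsScalarTower k Rᵐᵒᵖ X]

set_option linter.unusedSectionVars false in
variable {R X} in
theorem mul_inr (s : SqZ R X) (x : X) :
    s * TrivSqZeroExt.inr x = TrivSqZeroExt.inr (s.fst • x) := by
  ext <;> simp

set_option linter.unusedSectionVars false in
variable {R X} in
theorem inr_mul (s : SqZ R X) (x : X) :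
    TrivSqZeroExt.inr x * s = TrivSqZeroExt.inr (op s.fst • x) := by
  ext <;> simp

variable {R X} in
theorem smul_restrict_toBimod (s : SqZ R X) (x : X) :
    s • (show (restrictBimod (proj k R X)).obj (ofBimod k R X) from
        (toBimod x : ofBimod k R X)) =
      (show (restrictBimod (proj k R X)).obj (ofBimod k R X) from
        (toBimod (s.fst • x) : ofBimod k R X)) :=
  (left_smul_restrict (proj k R X) (ofBimod k R X) s (toBimod x)).trans
    (left_smul_toBimod (V := X) s.fst x)

variable {R X} in
theorem op_smul_restrict_toBimod (s : SqZ R X) (x : X) :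
    op s • (show (restrictBimod (proj k R X)).obj (ofBimod k R X) from
        (toBimod x : ofBimod k R X)) =
      (show (restrictBimod (proj k R X)).obj (ofBimod k R X) from
        (toBimod (op s.fst • x) : ofBimod k R X)) :=
  (right_smul_restrict (proj k R X) (ofBimod k R X) s (toBimod x)).trans
    (right_smul_toBimod (V := X) (op s.fst) x)

/-- The inclusion of `X` in `R ⊕ X`, where `X` acts trivially on `X`. -/
def inrHom' : (restrictBimod (proj k R X)).obj (ofBimod k R X) ⟶ regular k (SqZ R X) :=
  bimodHom (Y := (restrictBimod (proj k R X)).obj (ofBimod k R X))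
    (show X →+ SqZ R X from AddMonoidHom.mk' TrivSqZeroExt.inr (TrivSqZeroExt.inr_add R))
    (fun s => show ∀ _ : X, _ from fun x =>
      (congrArg (fun y : X => (toReg (TrivSqZeroExt.inr y : SqZ R X) : regular k (SqZ R X)))
        (smul_restrict_toBimod k s x)).trans
        ((congrArg toReg (mul_inr s x).symm).trans (left_smul_toReg s _).symm))
    (fun s => show ∀ _ : X, _ from fun x =>
      (congrArg (fun y : X => (toReg (TrivSqZeroExt.inr y : SqZ R X) : regular k (SqZ R X)))
        (op_smul_restrict_toBimod k s x)).trans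
        ((congrArg toReg (inr_mul s x).symm).trans (right_smul_toReg s _).symm))

/-- The projection of `R ⊕ X` onto `R`, as a homomorphism of bimodules over `R ⊕ X`. -/
def fstHom' : regular k (SqZ R X) ⟶ (restrictBimod (proj k R X)).obj (regular k R) :=
  bimodHom (Z := (restrictBimod (proj k R X)).obj (regular k R))
    (AddMonoidHom.mk' (fun s => (toReg (unReg s).fst : regular k R)) (fun _ _ => rfl))
    (fun s t => ((congrArg (fun y : regular k (SqZ R X) => (toReg (unReg y).fst : regular k R))
      (left_smul_toReg s (unReg t))).trans (left_smul_toReg s.fst (unReg t).fst).symm).trans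
        (left_smul_restrict (proj k R X) (regular k R) s (toReg (unReg t).fst)).symm)
    (fun s t => ((congrArg (fun y : regular k (SqZ R X) => (toReg (unReg y).fst : regular k R))
      (right_smul_toReg s (unReg t))).trans (right_smul_toReg s.fst (unReg t).fst).symm).trans
        (right_smul_restrict (proj k R X) (regular k R) s (toReg (unReg t).fst)).symm)

theorem inrHom'_fstHom' : inrHom' k R X ≫ fstHom' k R X = 0 := by
  ext x
  rfl

theorem regular_shortExact : (ShortComplex.mk _ _ (inrHom'_fstHom' k R X)).ShortExact := by
  refine shortExact_of_exact _ (fun x y h => ?_) (fun r => ?_) (fun s hs => ?_)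
  · exact TrivSqZeroExt.inr_injective (R := R) (M := X) h
  · exact ⟨(toReg (TrivSqZeroExt.inl (unReg (k := k) r)) : regular k (SqZ R X)), rfl⟩
  · exact ⟨(toBimod (TrivSqZeroExt.snd (show SqZ R X from s)) : ofBimod k R X),
      TrivSqZeroExt.ext (R := R) (M := X) (show (0 : R) = _ from Eq.symm hs) rfl⟩

/-- The pairs of endomorphisms `(x ↦ x r, x ↦ r x)`. -/
def mulPair : R →+ EndPair (ofBimod k R X) :=
  AddMonoidHom.mk' (fun r => (EndPair.mulRight r, EndPair.mulLeft r))
    (fun r s => Prod.ext (LinearMap.ext fun x => add_smul (op r) (op s) x)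
      (LinearMap.ext fun x => add_smul r s x))

variable {R} in
theorem smul_mulPair (a r : R) : a • mulPair k R X r = mulPair k R X (a * r) :=
  Prod.ext (LinearMap.ext fun x => (mul_smul (op r) (op a) x).symm)
    (LinearMap.ext fun x => (mul_smul a r x).symm)

variable {R} in
theorem op_smul_mulPair (a r : R) : op a • mulPair k R X r = mulPair k R X (r * a) :=
  Prod.ext (LinearMap.ext fun x => (mul_smul (op a) (op r) x).symm)
    (LinearMap.ext fun x => (mul_smul r a x).symm)

/-- The homomorphism `r ↦ (x ↦ x r, x ↦ r x)`. -/
def multiplicationHom : regular k R ⟶ endBimod (ofBimod k R X) :=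
  bimodHom (Z := endBimod (ofBimod k R X))
    (show R →+ EndPair (ofBimod k R X) from mulPair k R X)
    (fun a => show ∀ _ : R, _ from fun r =>
      (congrArg (fun t : regular k R => (toBimod (mulPair k R X (unReg t)) :
        endBimod (ofBimod k R X))) (left_smul_toReg a r)).trans
        ((congrArg toBimod (smul_mulPair k X a r).symm).trans
          (left_smul_toBimod (V := EndPair (ofBimod k R X)) a _).symm))
    (fun a => show ∀ _ : R, _ from fun r =>
      (congrArg (fun t : regular k R => (toBimod (mulPair k R X (unReg t)) :
        endBimod (ofBimod k R X))) (right_smul_toReg a r)).trans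
        ((congrArg toBimod (op_smul_mulPair k X a r).symm).trans
          (right_smul_toBimod (V := EndPair (ofBimod k R X)) (op a) _).symm))

/-- The actions of `X` on `X ⊕ End X` by `x (y, (f, g)) = (f(x), 0)` and
`(y, (f, g)) x = (g(x), 0)`. -/
def evaluationAction : SqAction R X (X × EndPair (ofBimod k R X)) where
  l := AddMonoidHom.mk' (fun x => AddMonoidHom.mk'
    (fun v => (unBimod (v.2.1 (toBimod x)), 0)) (fun v w => Prod.ext rfl (add_zero 0).symm))
    (fun x y => by
      ext v
      · exact map_add v.2.1 _ _
      · exact (add_zero 0).symm)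
  r := AddMonoidHom.mk' (fun x => AddMonoidHom.mk'
    (fun v => (unBimod (v.2.2 (toBimod x)), 0)) (fun v w => Prod.ext rfl (add_zero 0).symm))
    (fun x y => by
      ext v
      · exact map_add v.2.2 _ _
      · exact (add_zero 0).symm)
  l_smul a x v := Prod.ext
    (((congrArg v.2.1 (left_smul_toBimod (k := k) a x).symm).trans (map_smul v.2.1 a _)).trans
      (left_smul_toBimod (k := k) (V := X) a _)) (smul_zero a).symm
  l_op a x v := Prod.ext (congrArg v.2.1 (right_smul_toBimod (k := k) (op a) x).symm) rfl
  l_right a x v := Prod.ext (right_smul_toBimod (k := k) (V := X) (op a) _) (smul_zero (op a)).symm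
  r_op a x v := Prod.ext
    (((congrArg v.2.2 (right_smul_toBimod (k := k) (op a) x).symm).trans
      (map_smul v.2.2 (op a) _)).trans
      (right_smul_toBimod (k := k) (V := X) (op a) _)) (smul_zero (op a)).symm
  r_smul a x v := Prod.ext (congrArg v.2.2 (left_smul_toBimod (k := k) a x).symm) rfl
  r_left a x v := Prod.ext (left_smul_toBimod (k := k) (V := X) a _) (smul_zero a).symm
  l_l x y v := rfl
  r_r x y v := rfl
  l_r x y v := rfl

/-- The extension of `End X` by `X` in which `X` acts by evaluation. -/
abbrev evaluationBimod : BimodCat k (SqZ R X) := (evaluationAction k R X).obj k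

variable {k R X} in
/-- Elements of `evaluationBimod`. -/
def evalElt (x : X) (p : EndPair (ofBimod k R X)) : evaluationBimod k R X :=
  (evaluationAction k R X).elt k (x, p)

variable {k R X} in
theorem smul_evalElt (s : SqZ R X) (x : X) (p : EndPair (ofBimod k R X)) :
    s • evalElt x p = evalElt (s.fst • x + unBimod (p.1 (toBimod s.snd))) (s.fst • p) := by
  conv_lhs => rw [← TrivSqZeroExt.inl_fst_add_inr_snd_eq s, add_smul]
  refine (congrArg₂ (· + ·) ((evaluationAction k R X).inl_smul_elt s.fst (x, p))
    ((evaluationAction k R X).inr_smul_elt s.snd (x, p))).trans ?_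
  exact congrArg (fun q => evalElt _ q) (add_zero (s.fst • p))

variable {k R X} in
theorem op_smul_evalElt (s : SqZ R X) (x : X) (p : EndPair (ofBimod k R X)) :
    op s • evalElt x p =
      evalElt (op s.fst • x + unBimod (p.2 (toBimod s.snd))) (op s.fst • p) := by
  conv_lhs => rw [← TrivSqZeroExt.inl_fst_add_inr_snd_eq s, MulOpposite.op_add, add_smul]
  refine (congrArg₂ (· + ·) ((evaluationAction k R X).op_inl_smul_elt s.fst (x, p))
    ((evaluationAction k R X).op_inr_smul_elt s.snd (x, p))).trans ?_
  exact congrArg (fun q => evalElt _ q) (add_zero (op s.fst • p))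

/-- The inclusion of `X` in `X ⊕ End X`. -/
def evaluationIncl : (restrictBimod (proj k R X)).obj (ofBimod k R X) ⟶ evaluationBimod k R X :=
  bimodHom (Y := (restrictBimod (proj k R X)).obj (ofBimod k R X))
    (show X →+ X × EndPair (ofBimod k R X) from AddMonoidHom.inl _ _)
    (fun s => show ∀ _ : X, _ from fun x =>
      (congrArg (fun y : X => (evalElt y 0 : evaluationBimod k R X))
        (smul_restrict_toBimod k s x)).trans ((congrArg₂ evalElt (add_zero (s.fst • x)).symm
          (smul_zero s.fst).symm).trans (smul_evalElt s x 0).symm))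
    (fun s => show ∀ _ : X, _ from fun x =>
      (congrArg (fun y : X => (evalElt y 0 : evaluationBimod k R X))
        (op_smul_restrict_toBimod k s x)).trans ((congrArg₂ evalElt (add_zero (op s.fst • x)).symm
          (smul_zero (op s.fst)).symm).trans (op_smul_evalElt s x 0).symm))

/-- The projection of `X ⊕ End X` onto `End X`. -/
def evaluationProj : evaluationBimod k R X ⟶
    (restrictBimod (proj k R X)).obj (endBimod (ofBimod k R X)) :=
  bimodHom (Z := (restrictBimod (proj k R X)).obj (endBimod (ofBimod k R X)))
    (show X × EndPair (ofBimod k R X) →+ EndPair (ofBimod k R X) from AddMonoidHom.snd _ _)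
    (fun s => show ∀ _ : X × EndPair (ofBimod k R X), _ from fun v =>
      (congrArg (fun w : X × EndPair (ofBimod k R X) => (toBimod w.2 :
        endBimod (ofBimod k R X))) (smul_evalElt s v.1 v.2)).trans
      ((left_smul_restrict (proj k R X) (endBimod (ofBimod k R X)) s (toBimod v.2)).trans
        (left_smul_toBimod (V := EndPair (ofBimod k R X)) s.fst v.2)).symm)
    (fun s => show ∀ _ : X × EndPair (ofBimod k R X), _ from fun v =>
      (congrArg (fun w : X × EndPair (ofBimod k R X) => (toBimod w.2 :
        endBimod (ofBimod k R X))) (op_smul_evalElt s v.1 v.2)).trans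
      ((right_smul_restrict (proj k R X) (endBimod (ofBimod k R X)) s (toBimod v.2)).trans
        (right_smul_toBimod (V := EndPair (ofBimod k R X)) (op s.fst) v.2)).symm)

theorem evaluationIncl_proj : evaluationIncl k R X ≫ evaluationProj k R X = 0 := by
  ext x
  rfl

theorem evaluation_shortExact :
    (ShortComplex.mk _ _ (evaluationIncl_proj k R X)).ShortExact := by
  refine shortExact_of_exact _ (fun x y h => ?_) (fun p => ?_) (fun v hv => ?_)
  · exact congrArg (fun w : X × EndPair (ofBimod k R X) => w.1) h
  · exact ⟨evalElt 0 (show EndPair (ofBimod k R X) from p), rfl⟩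
  · refine ⟨(show X × EndPair (ofBimod k R X) from v).1, ?_⟩
    exact Prod.ext (α := X) (β := EndPair (ofBimod k R X)) rfl (Eq.symm hv)

/-- The homomorphism `(r, x) ↦ (x, (y ↦ y r, y ↦ r y))`. -/
def evaluationHom : regular k (SqZ R X) ⟶ evaluationBimod k R X :=
  bimodHom (Y := regular k (SqZ R X))
    (show SqZ R X →+ X × EndPair (ofBimod k R X) from
      AddMonoidHom.mk' (fun s => (s.snd, mulPair k R X s.fst))
        (fun s t => Prod.ext rfl (map_add (mulPair k R X) s.fst t.fst)))
    (fun s => show ∀ _ : SqZ R X, _ from fun t => by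
      refine Eq.trans ?_ (smul_evalElt s t.snd (mulPair k R X t.fst)).symm
      refine (congrArg (fun t : SqZ R X => (evalElt t.snd (mulPair k R X t.fst) :
        evaluationBimod k R X)) (left_smul_toReg (k := k) s t)).trans ?_
      refine congrArg₂ evalElt ?_ (smul_mulPair k X s.fst t.fst).symm
      refine (TrivSqZeroExt.snd_mul s t).trans ?_
      exact congrArg (s.fst • t.snd + ·)
        (right_smul_toBimod (k := k) (V := X) (op t.fst) s.snd).symm)
    (fun s => show ∀ _ : SqZ R X, _ from fun t => by
      refine Eq.trans ?_ (op_smul_evalElt s t.snd (mulPair k R X t.fst)).symm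
      refine (congrArg (fun t : SqZ R X => (evalElt t.snd (mulPair k R X t.fst) :
        evaluationBimod k R X)) (right_smul_toReg (k := k) s t)).trans ?_
      refine congrArg₂ evalElt ?_ (op_smul_mulPair k X s.fst t.fst).symm
      refine (TrivSqZeroExt.snd_mul t s).trans ((add_comm _ _).trans ?_)
      exact congrArg (op s.fst • t.snd + ·)
        (left_smul_toBimod (k := k) (V := X) t.fst s.snd).symm)

/-- The extension of `R` by `X` given by `R ⊕ X` is induced by the extension of `End X` by `X`. -/
def evaluationMap : ShortComplex.mk _ _ (inrHom'_fstHom' k R X) ⟶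
    ShortComplex.mk _ _ (evaluationIncl_proj k R X) where
  τ₁ := 𝟙 _
  τ₂ := evaluationHom k R X
  τ₃ := (restrictBimod (proj k R X)).map (multiplicationHom k R X)
  comm₁₂ := by
    ext x
    exact Prod.ext (α := X) (β := EndPair (ofBimod k R X)) rfl (map_zero (mulPair k R X)).symm
  comm₂₃ := by
    ext s
    rfl

variable {k R X}

/-- The obstruction to lifting a class along `R ⊕ X → R` is a product that factors through an
extension of `R` by `endBimod X`, and these vanish. -/
theorem retract_surjective (hX : Module.Projective (Env k R) (ofBimod k R X)) {n : ℕ}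
    (ξ : HHCohomology k R (n + 1)) : ∃ x, retract k R X (n + 1) x = ξ := by
  have h0 : ξ.comp (Ext.mk₀ (multiplicationHom k R X)) (add_zero (n + 1)) = 0 :=
    ext_endBimod_eq_zero hX n _ regular_projective_left regular_projective_right _
  -- the product with the class of `0 → X → R ⊕ X → R → 0` vanishes
  have h1 : (ξ.mapExactFunctor (restrictBimod (proj k R X))).comp
      (regular_shortExact k R X).extClass rfl = 0 := by
    have h2 := ShortComplex.ShortExact.extClass_naturality (regular_shortExact k R X)
      (evaluation_shortExact k R X) (evaluationMap k R X)
    have h3 := (Ext.comp_mk₀_id (regular_shortExact k R X).extClass).symm.trans h2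
    rw [h3]
    refine (Ext.comp_assoc _ _ _ (add_zero (n + 1)) (zero_add 1) (by omega)).symm.trans ?_
    have h4 : (ξ.mapExactFunctor (restrictBimod (proj k R X))).comp
        (Ext.mk₀ ((restrictBimod (proj k R X)).map (multiplicationHom k R X)))
        (add_zero (n + 1)) = 0 := by
      rw [← Ext.mapExactFunctor_mk₀, ← Ext.mapExactFunctor_comp, h0, Ext.mapExactFunctor_zero]
    exact (congrArg (fun t => Ext.comp t _ rfl) h4).trans (Ext.zero_comp _ _ _ _ _)
  obtain ⟨y, hy⟩ := Ext.covariant_sequence_exact₃ _ (regular_shortExact k R X) _ rfl h1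
  -- the lift `y`, composed with the projection of `R ⊕ X` onto `R`, restricts to `ξ`
  refine ⟨(Ext.mk₀ (fstHom' k R X)).comp y (zero_add (n + 1)), ?_⟩
  let f := (restrictBimod (incl k R X)).map (fstHom' k R X)
  let z := y.mapExactFunctor (restrictBimod (incl k R X))
  have hf : fstHom k R X = f ≫ counitHom (regular k R) := rfl
  have hz : z.comp (Ext.mk₀ f) (add_zero (n + 1)) = (ξ.mapExactFunctor
      (restrictBimod (proj k R X))).mapExactFunctor (restrictBimod (incl k R X)) :=
    ((congrArg (fun t => z.comp t (add_zero (n + 1))) (Ext.mapExactFunctor_mk₀ _ _).symm).trans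
      (Ext.mapExactFunctor_comp _ _ _ _).symm).trans (congrArg _ hy)
  have hi : (inclusionHom (incl k R X) ≫ f) ≫ counitHom (regular k R) = 𝟙 _ := rfl
  have h5 : ((Ext.mk₀ (fstHom' k R X)).comp y (zero_add (n + 1))).mapExactFunctor
      (restrictBimod (incl k R X)) = (Ext.mk₀ f).comp z (zero_add (n + 1)) :=
    (Ext.mapExactFunctor_comp _ _ _ _).trans
      (congrArg (fun t => Ext.comp t z (zero_add (n + 1))) (Ext.mapExactFunctor_mk₀ _ _))
  change ((Ext.mk₀ (inclusionHom (incl k R X))).comp _ (zero_add (n + 1))).comp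
    (Ext.mk₀ (fstHom k R X)) (add_zero (n + 1)) = ξ
  rw [h5, hf, ← Ext.mk₀_comp_mk₀, Ext.comp_assoc_of_third_deg_zero,
    Ext.comp_assoc_of_third_deg_zero, ← Ext.comp_assoc_of_third_deg_zero z, hz, ext_counitHom,
    Ext.mk₀_comp_mk₀_assoc, Ext.mk₀_comp_mk₀_assoc, hi, Ext.mk₀_id_comp]

end Surjectivity

/-! ### Hochschild classes that come from the syzygies -/

section LongExactSequence

variable (k : Type u) [Field k] (R : Type u) [Ring R] [Algebra k R]
  (X : Type u) [AddCommGroup X] [Module k X] [Module R X] [Module Rᵐᵒᵖ X]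
  [SMulCommClass R Rᵐᵒᵖ X] [IsScalarTower k R X] [IsScalarTower k Rᵐᵒᵖ X]

/-- The unit of the tensor algebra of `X`. -/
def one : Pow k R X 0 := scalar (ofBimod k R X) 1

variable {k R X} in
theorem lmul_scalar (x : X) (r : R) : lmul k R X 0 x (scalar (ofBimod k R X) r) =
    lmul k R X 0 (op r • x) (one k R X) := by
  rw [lmul_op, one, left_smul_scalar, mul_one]

variable {k R X} in
theorem rmul_scalar (x : X) (r : R) : rmul k R X 0 x (scalar (ofBimod k R X) r) =
    lmul k R X 0 (r • x) (one k R X) := by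
  rw [rmul_def, append_scalar, left_smul_toBimod]
  rfl

/-- The isomorphism of `R ⊕ X` with its zeroth syzygy. -/
def regularToSyzygy : regular k (SqZ R X) ⟶ syzygy k R X 0 :=
  sqHom (Z := regular k (SqZ R X))
    (show SqZ R X →+ syzygy k R X 0 from AddMonoidHom.mk'
      (fun s => syz (scalar (ofBimod k R X) s.fst) (lmul k R X 0 s.snd (one k R X)))
      (fun s t => by
        rw [← syz_add, ← map_add, ← AddMonoidHom.add_apply, ← map_add]
        rfl))
    (fun a => show ∀ _ : SqZ R X, _ from fun s => by
      refine Eq.trans ?_ (inl_smul_syz (scalar (ofBimod k R X) s.fst) _ a).symm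
      rw [left_smul_scalar, ← lmul_smul]
      refine (congrArg (fun s : SqZ R X => syz (scalar (ofBimod k R X) s.fst)
        (lmul k R X 0 s.snd (one k R X))) (left_smul_toReg (k := k) _ s)).trans ?_
      change syz (scalar (ofBimod k R X) (TrivSqZeroExt.inl a * s : SqZ R X).fst)
        (lmul k R X 0 (TrivSqZeroExt.inl a * s : SqZ R X).snd (one k R X)) = _
      simp)
    (fun x => show ∀ _ : SqZ R X, _ from fun s => by
      refine Eq.trans ?_ (inr_smul_syz (scalar (ofBimod k R X) s.fst) _ x).symm
      rw [lmul_scalar]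
      refine (congrArg (fun s : SqZ R X => syz (scalar (ofBimod k R X) s.fst)
        (lmul k R X 0 s.snd (one k R X))) (left_smul_toReg (k := k) _ s)).trans ?_
      change syz (scalar (ofBimod k R X) (TrivSqZeroExt.inr x * s : SqZ R X).fst)
        (lmul k R X 0 (TrivSqZeroExt.inr x * s : SqZ R X).snd (one k R X)) = _
      simp)
    (fun a => show ∀ _ : SqZ R X, _ from fun s => by
      refine Eq.trans ?_ (op_inl_smul_syz (scalar (ofBimod k R X) s.fst) _ a).symm
      rw [right_smul_scalar, ← lmul_right, one, right_smul_scalar, one_mul, lmul_scalar]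
      refine (congrArg (fun s : SqZ R X => syz (scalar (ofBimod k R X) s.fst)
        (lmul k R X 0 s.snd (one k R X))) (right_smul_toReg (k := k) _ s)).trans ?_
      change syz (scalar (ofBimod k R X) (s * TrivSqZeroExt.inl a : SqZ R X).fst)
        (lmul k R X 0 (s * TrivSqZeroExt.inl a : SqZ R X).snd (one k R X)) = _
      simp)
    (fun x => show ∀ _ : SqZ R X, _ from fun s => by
      refine Eq.trans ?_ (op_inr_smul_syz (scalar (ofBimod k R X) s.fst) _ x).symm
      rw [rmul_scalar]
      refine (congrArg (fun s : SqZ R X => syz (scalar (ofBimod k R X) s.fst)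
        (lmul k R X 0 s.snd (one k R X))) (right_smul_toReg (k := k) _ s)).trans ?_
      change syz (scalar (ofBimod k R X) (s * TrivSqZeroExt.inr x : SqZ R X).fst)
        (lmul k R X 0 (s * TrivSqZeroExt.inr x : SqZ R X).snd (one k R X)) = _
      simp [sign])

theorem regularToSyzygy_apply (s : SqZ R X) : regularToSyzygy k R X (toReg s) =
    syz (scalar (ofBimod k R X) s.fst) (lmul k R X 0 s.snd (one k R X)) := rfl

variable {k R X} in
theorem lmul_one_surjective (v : Pow k R X 1) : ∃ x, lmul k R X 0 x (one k R X) = v := by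
  refine cons_induction (X := ofBimod k R X) (n := 0)
    (p := fun v => ∃ x, lmul k R X 0 x (one k R X) = v) ?_ ?_ ?_ v
  · exact ⟨0, by rw [map_zero]; rfl⟩
  · rintro _ _ ⟨x, rfl⟩ ⟨y, rfl⟩
    exact ⟨x + y, by rw [map_add]; rfl⟩
  · intro x w
    obtain ⟨r, rfl⟩ := exists_scalar (X := ofBimod k R X) w
    exact ⟨op r • unBimod x, (lmul_scalar _ r).symm⟩

variable {k R X} in
theorem lmul_one_injective (x : X) (hx : lmul k R X 0 x (one k R X) = 0) : x = 0 := by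
  obtain ⟨g, hg⟩ := exists_lmul_lift (k := k) (R := R) (X := X) 0
    (AddMonoidHom.mk' (fun x => (AddMonoidHom.mk' (fun r : R => op r • x)
      (fun r s => by rw [MulOpposite.op_add, add_smul]) : R →+ X))
      (fun x y => by ext r; exact smul_add (op r) x y))
    (fun x a w => by
      obtain ⟨r, rfl⟩ := exists_scalar (X := ofBimod k R X) w
      rw [left_smul_scalar]
      exact (mul_smul (op r) (op a) x).symm)
  have h1 : g (lmul k R X 0 x (one k R X)) = (1 : Rᵐᵒᵖ) • x := hg x (one k R X)
  rw [hx, map_zero, one_smul] at h1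
  exact h1.symm

instance regularToSyzygy_isIso : IsIso (regularToSyzygy k R X) := by
  refine (ConcreteCategory.isIso_iff_bijective _).2 ⟨?_, fun q => ?_⟩
  · refine (injective_iff_map_eq_zero (regularToSyzygy k R X).hom).2 (fun s hs => ?_)
    obtain ⟨h1, h2⟩ := syz_injective (show syz (scalar (ofBimod k R X) (unReg s).fst)
      (lmul k R X 0 (unReg s).snd (one k R X)) = syz 0 0 from hs)
    exact TrivSqZeroExt.ext (R := R) (M := X) h1 (lmul_one_injective _ h2)
  · obtain ⟨w, v, rfl⟩ := exists_syz q
    obtain ⟨r, rfl⟩ := exists_scalar (X := ofBimod k R X) w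
    obtain ⟨x, rfl⟩ := lmul_one_surjective v
    exact ⟨(toReg (TrivSqZeroExt.inl r + TrivSqZeroExt.inr x : SqZ R X) : regular k (SqZ R X)), by
      rw [regularToSyzygy_apply]; simp⟩

theorem inclusionHom_regularToSyzygy :
    inclusionHom (incl k R X) ≫ (restrictBimod (incl k R X)).map (regularToSyzygy k R X) =
      barUnit k R X 0 ≫ (restrictBimod (incl k R X)).map (barProj k R X 0) := by
  ext r
  change syz (scalar (ofBimod k R X) (unReg r)) (lmul k R X 0 0 (one k R X)) =
    syz (scalar (ofBimod k R X) (unReg r)) (0 + sign 0 • 0)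
  rw [map_zero, smul_zero, add_zero]
  rfl

/-- The composition with the unit of `B₀` and with the projection of `R ⊕ X` onto `R`. -/
def barRetract (n : ℕ) :
    Ext (bar k R X 0) (regular k (SqZ R X)) n →+ HHCohomology k R n :=
  ((Ext.mk₀ (fstHom k R X)).postcomp (regular k R) (add_zero n)).comp
    (((Ext.mk₀ (barUnit k R X 0)).precomp (res (regular k (SqZ R X))) (zero_add n)).comp
      ((restrictBimod (incl k R X)).mapExtAddHom (bar k R X 0) (regular k (SqZ R X)) n))

/-- The restriction map of a class from the zeroth syzygy depends only on its pullback to `B₀`. -/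
theorem retract_comp_eq_barRetract {n : ℕ} (x : Ext (syzygy k R X 0) (regular k (SqZ R X)) n) :
    retract k R X n ((Ext.mk₀ (regularToSyzygy k R X)).comp x (zero_add n)) =
      barRetract k R X n ((Ext.mk₀ (barProj k R X 0)).comp x (zero_add n)) := by
  let y := x.mapExactFunctor (restrictBimod (incl k R X))
  have h1 : ∀ {Y : BimodCat k (SqZ R X)} (f : Y ⟶ syzygy k R X 0),
      ((Ext.mk₀ f).comp x (zero_add n)).mapExactFunctor (restrictBimod (incl k R X)) =
        (Ext.mk₀ ((restrictBimod (incl k R X)).map f)).comp y (zero_add n) := fun f =>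
    (Ext.mapExactFunctor_comp _ _ _ _).trans
      (congrArg (fun t => Ext.comp t y (zero_add n)) (Ext.mapExactFunctor_mk₀ _ _))
  refine congrArg (fun t => Ext.comp t (Ext.mk₀ (fstHom k R X)) (add_zero n)) ?_
  refine (congrArg (fun t => Ext.comp (Ext.mk₀ (inclusionHom (incl k R X))) t (zero_add n))
    (h1 (regularToSyzygy k R X))).trans ?_
  refine Eq.trans ?_ (congrArg (fun t => Ext.comp (Ext.mk₀ (barUnit k R X 0)) t (zero_add n))
    (h1 (barProj k R X 0))).symm
  refine (Ext.mk₀_comp_mk₀_assoc _ _ _).trans ?_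
  rw [inclusionHom_regularToSyzygy]
  exact (Ext.mk₀_comp_mk₀_assoc _ _ _).symm

variable {k R X} in
/-- The extensions of `B₀` by `R ⊕ X` over `R ⊕ X` embed in the extensions of `R` by itself over
`R`. -/
theorem barRetract_injective (hX : Module.Projective (Env k R) (ofBimod k R X)) {e : R}
    (he : e * e = e) (hc : ∀ r, e * r = r * e) (heX : ∀ x : X, e • x + op e • x = x) (n : ℕ) :
    Function.Injective (barRetract k R X n) := by
  refine (injective_iff_map_eq_zero _).2 fun x hx => ?_
  exact ext_bar_eq_zero hX 0 _ x (eq_zero_of_comp_fstHom he hc heX _ hx)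

/-- The class of the extension of a syzygy by the next one. -/
def syzygyExt (n : ℕ) : Ext (syzygy k R X n) (syzygy k R X (n + 1)) 1 :=
  (barSequence_shortExact k R X n).extClass

section

variable {k R X} {n j : ℕ} {W : BimodCat k (SqZ R X)}

theorem syzygyExt_comp_incl (z : Ext (bar k R X n) W j) : (syzygyExt k R X n).comp
    ((Ext.mk₀ (syzygyIncl k R X n)).comp z (zero_add j)) (add_comm 1 j) = 0 :=
  (barSequence_shortExact k R X n).extClass_comp_assoc z

theorem barProj_comp_syzygyExt (y : Ext (syzygy k R X (n + 1)) W j) :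
    (Ext.mk₀ (barProj k R X n)).comp ((syzygyExt k R X n).comp y (add_comm 1 j))
      (zero_add (j + 1)) = 0 :=
  (barSequence_shortExact k R X n).comp_extClass_assoc y _

theorem syzygyIncl_comp_barProj (y : Ext (syzygy k R X n) W j) :
    (Ext.mk₀ (syzygyIncl k R X n)).comp ((Ext.mk₀ (barProj k R X n)).comp y (zero_add j))
      (zero_add j) = 0 := by
  have h : syzygyIncl k R X n ≫ barProj k R X n = 0 := (barSequence k R X n).zero
  rw [Ext.mk₀_comp_mk₀_assoc, h, Ext.mk₀_zero, Ext.zero_comp]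

theorem exists_syzygyIncl_comp (y : Ext (syzygy k R X (n + 1)) W j)
    (h : (syzygyExt k R X n).comp y (add_comm 1 j) = 0) :
    ∃ z : Ext (bar k R X n) W j, (Ext.mk₀ (syzygyIncl k R X n)).comp z (zero_add j) = y :=
  Ext.contravariant_sequence_exact₁ (barSequence_shortExact k R X n) _ y _ h

theorem exists_syzygyExt_comp (x : Ext (syzygy k R X n) W (j + 1))
    (h : (Ext.mk₀ (barProj k R X n)).comp x (zero_add (j + 1)) = 0) :
    ∃ y, (syzygyExt k R X n).comp y (add_comm 1 j) = x :=
  Ext.contravariant_sequence_exact₃ (barSequence_shortExact k R X n) _ x h (add_comm 1 j)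

end

/-- The `n`-fold extension of `R ⊕ X` by its `n`-th syzygy that is given by the bar resolution. -/
def syzygyClass : (n : ℕ) → Ext (regular k (SqZ R X)) (syzygy k R X n) n
  | 0 => Ext.mk₀ (regularToSyzygy k R X)
  | n + 1 => (syzygyClass n).comp (syzygyExt k R X n) rfl

theorem syzygyClass_comp {n j N : ℕ} {W : BimodCat k (SqZ R X)}
    (y : Ext (syzygy k R X (n + 1)) W j) (hN : n + 1 + j = N) (hN' : n + (j + 1) = N) :
    (syzygyClass k R X (n + 1)).comp y hN =
      (syzygyClass k R X n).comp ((syzygyExt k R X n).comp y (add_comm 1 j))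
        hN' :=
  Ext.comp_assoc _ _ _ rfl (add_comm 1 j) (by omega)

variable {k R X}

theorem eq_of_iso_comp {j : ℕ} {W : BimodCat k (SqZ R X)} (y : Ext (syzygy k R X 0) W j) :
    (Ext.mk₀ (inv (regularToSyzygy k R X))).comp
      ((Ext.mk₀ (regularToSyzygy k R X)).comp y (zero_add j)) (zero_add j) = y := by
  rw [Ext.mk₀_comp_mk₀_assoc, IsIso.inv_hom_id, Ext.mk₀_id_comp]

theorem eq_of_iso_comp' {j : ℕ} {W : BimodCat k (SqZ R X)} (y : Ext (regular k (SqZ R X)) W j) :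
    (Ext.mk₀ (regularToSyzygy k R X)).comp
      ((Ext.mk₀ (inv (regularToSyzygy k R X))).comp y (zero_add j)) (zero_add j) = y := by
  rw [Ext.mk₀_comp_mk₀_assoc, IsIso.hom_inv_id, Ext.mk₀_id_comp]

/-- Composition with the class of the syzygy is injective in positive degrees. In the first step,
this uses the surjectivity of the restriction to the diagonal. -/
theorem eq_zero_of_syzygyClass_comp (hX : Module.Projective (Env k R) (ofBimod k R X)) {e : R}
    (he : e * e = e) (hc : ∀ r, e * r = r * e) (heX : ∀ x : X, e • x + op e • x = x) (n : ℕ)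
    {j N : ℕ} (y : Ext (syzygy k R X (n + 1)) (regular k (SqZ R X)) (j + 1))
    (hN : n + 1 + (j + 1) = N) (hy : (syzygyClass k R X (n + 1)).comp y hN = 0) : y = 0 := by
  rw [syzygyClass_comp _ _ _ y hN (by omega)] at hy
  induction n generalizing j with
  | zero =>
    obtain rfl : j + 1 + 1 = N := by omega
    have h1 := (eq_of_iso_comp _).symm.trans
      ((congrArg (fun t => Ext.comp (Ext.mk₀ (inv (regularToSyzygy k R X))) t
        (zero_add (j + 1 + 1))) hy).trans (Ext.comp_zero _ _ _ _ _))
    obtain ⟨z, rfl⟩ := exists_syzygyIncl_comp y h1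
    -- a class on `B₀` is determined by its restriction to `R`, hence comes from a class of `R ⊕ X`
    obtain ⟨x, hx⟩ := retract_surjective hX (barRetract k R X (j + 1) z)
    have h2 : (Ext.mk₀ (barProj k R X 0)).comp
        ((Ext.mk₀ (inv (regularToSyzygy k R X))).comp x (zero_add (j + 1)))
          (zero_add (j + 1)) = z := by
      refine barRetract_injective hX he hc heX (j + 1) ?_
      rw [← retract_comp_eq_barRetract, eq_of_iso_comp', hx]
    rw [← h2, syzygyIncl_comp_barProj]
  | succ n ih =>
    have h1 := ih _ (by omega) ((syzygyClass_comp _ _ _ _ (by omega) _).symm.trans hy)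
    obtain ⟨z, rfl⟩ := exists_syzygyIncl_comp y h1
    have := bar_projective hX n
    have hz : z = 0 := Ext.eq_zero_of_projective (P := bar k R X (n + 1)) z
    rw [hz, Ext.comp_zero]

/-- A composite with the class of a syzygy vanishes exactly if it factors through the bar
resolution. -/
theorem syzygyClass_comp_mk₀_eq_zero_iff (hX : Module.Projective (Env k R) (ofBimod k R X)) {e : R}
    (he : e * e = e) (hc : ∀ r, e * r = r * e) (heX : ∀ x : X, e • x + op e • x = x) (n : ℕ)
    (f : syzygy k R X (n + 1) ⟶ regular k (SqZ R X)) :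
    (syzygyClass k R X (n + 1)).comp (Ext.mk₀ f) (add_zero (n + 1)) = 0 ↔
      ∃ g : bar k R X n ⟶ regular k (SqZ R X), syzygyIncl k R X n ≫ g = f := by
  rw [syzygyClass_comp _ _ _ _ _ rfl]
  constructor
  · intro h
    have h1 : (syzygyExt k R X n).comp (Ext.mk₀ f) (add_comm 1 0) = 0 := by
      cases n with
      | zero =>
        exact (eq_of_iso_comp _).symm.trans
          ((congrArg (fun t => Ext.comp (Ext.mk₀ (inv (regularToSyzygy k R X))) t
            (zero_add 1)) h).trans (Ext.comp_zero _ _ _ _ _))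
      | succ n => exact eq_zero_of_syzygyClass_comp hX he hc heX n (j := 0) _ _ h
    obtain ⟨z, hz⟩ := exists_syzygyIncl_comp _ h1
    obtain ⟨g, rfl⟩ := (Ext.mk₀_bijective _ _).2 z
    refine ⟨g, (Ext.mk₀_bijective _ _).1 ?_⟩
    exact (Ext.mk₀_comp_mk₀ _ _).symm.trans hz
  · rintro ⟨g, rfl⟩
    rw [← Ext.mk₀_comp_mk₀, syzygyExt_comp_incl, Ext.comp_zero]

/-- The classes that come from a syzygy vanish on `B₀`, hence on the diagonal. -/
theorem retract_syzygyClass_comp (n : ℕ) {j N : ℕ}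
    (y : Ext (syzygy k R X (n + 1)) (regular k (SqZ R X)) j) (hN : n + 1 + j = N) :
    retract k R X N ((syzygyClass k R X (n + 1)).comp y hN) = 0 := by
  rw [syzygyClass_comp _ _ _ y hN (by omega)]
  induction n generalizing j with
  | zero =>
    obtain rfl : j + 1 = N := by omega
    refine (retract_comp_eq_barRetract _ _ _ _).trans ?_
    rw [barProj_comp_syzygyExt, map_zero]
  | succ n ih =>
    have := ih ((syzygyExt k R X (n + 1)).comp y (add_comm 1 j)) (by omega)
    rwa [← syzygyClass_comp _ _ _ _ (by omega) _] at this

/-- The classes that restrict to zero on the diagonal come from the syzygies. -/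
theorem exists_syzygyClass_comp (hX : Module.Projective (Env k R) (ofBimod k R X)) {e : R}
    (he : e * e = e) (hc : ∀ r, e * r = r * e) (heX : ∀ x : X, e • x + op e • x = x) (n : ℕ)
    {j N : ℕ} (hN : n + 1 + j = N) (x : HHCohomology k (SqZ R X) N)
    (hx : retract k R X N x = 0) :
    ∃ y : Ext (syzygy k R X (n + 1)) (regular k (SqZ R X)) j,
      (syzygyClass k R X (n + 1)).comp y hN = x := by
  induction n generalizing j with
  | zero =>
    obtain rfl : j + 1 = N := by omega
    have h1 : (Ext.mk₀ (barProj k R X 0)).comp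
        ((Ext.mk₀ (inv (regularToSyzygy k R X))).comp x (zero_add (j + 1)))
          (zero_add (j + 1)) = 0 := by
      refine barRetract_injective hX he hc heX (j + 1) ?_
      rw [← retract_comp_eq_barRetract, eq_of_iso_comp', hx, map_zero]
    obtain ⟨y, hy⟩ := exists_syzygyExt_comp _ h1
    refine ⟨y, (syzygyClass_comp _ _ _ y hN (by omega)).trans ?_⟩
    rw [hy]
    exact eq_of_iso_comp' x
  | succ n ih =>
    obtain ⟨y, hy⟩ := ih (j := j + 1) (by omega)
    obtain ⟨z, rfl⟩ := exists_extClass_comp (barSequence_shortExact k R X (n + 1))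
      (bar_projective hX n) y
    exact ⟨z, (syzygyClass_comp _ _ _ z hN (by omega)).trans hy⟩

end LongExactSequence

/-! ### Commutators with the identity of `X` -/

section HomRegular

variable {k : Type u} [Field k] {R : Type u} [Ring R] [Algebra k R] {Y : BimodCat k R}

theorem unReg_left (f : Y ⟶ regular k R) (r : R) (y : Y) : unReg (f (r • y)) = r * unReg (f y) := by
  rw [hom_left_smul]
  exact left_smul_toReg r (unReg (f y))

theorem unReg_right (f : Y ⟶ regular k R) (r : R) (y : Y) :
    unReg (f (op r • y)) = unReg (f y) * r := by
  rw [hom_right_smul]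
  exact right_smul_toReg r (unReg (f y))

end HomRegular

section Commutator

variable (k : Type u) [Field k] (R : Type u) [Ring R] [Algebra k R]
  (X : Type u) [AddCommGroup X] [Module k X] [Module R X] [Module Rᵐᵒᵖ X]
  [SMulCommClass R Rᵐᵒᵖ X] [IsScalarTower k R X] [IsScalarTower k Rᵐᵒᵖ X]

variable {k R X} in
/-- The map `x ⊗ w ↦ x φ(w)` is well defined. -/
theorem exists_leftProduct {n : ℕ} (φ : Pow k R X n ⟶ regular k R) :
    ∃ f : Pow k R X (n + 1) ⟶ ofBimod k R X,
      ∀ x w, unBimod (f (lmul k R X n x w)) = op (unReg (φ w)) • x := by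
  obtain ⟨g, hg⟩ := exists_lmul_lift (k := k) (R := R) (X := X) n
    (AddMonoidHom.mk' (fun x => (AddMonoidHom.mk' (fun w => op (unReg (φ w)) • x)
      (fun w w' => by
        rw [map_add, ← add_smul]
        rfl) : Pow k R X n →+ X))
      (fun x y => by ext w; exact smul_add _ x y))
    (fun x a w => by
      change op (unReg (φ w)) • op a • x = op (unReg (φ (a • w))) • x
      rw [unReg_left, MulOpposite.op_mul, mul_smul])
  have hg' : ∀ x w, g (lmul k R X n x w) = op (unReg (φ w)) • x := hg
  refine ⟨bimodHom (Z := ofBimod k R X) g (fun a => ?_) (fun a => ?_), hg'⟩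
  · refine DFunLike.congr_fun (lmul_addHom_ext (f := g.comp (DistribSMul.toAddMonoidHom _ a))
      (g := (DistribSMul.toAddMonoidHom (ofBimod k R X) a).comp g) (fun x w => ?_))
    change g (a • _) = a • (toBimod (g _) : ofBimod k R X)
    rw [left_smul_toBimod, ← lmul_smul, hg', hg', ← smul_comm a]
    rfl
  · refine DFunLike.congr_fun (lmul_addHom_ext (f := g.comp (DistribSMul.toAddMonoidHom _ (op a)))
      (g := (DistribSMul.toAddMonoidHom (ofBimod k R X) (op a)).comp g) (fun x w => ?_))
    change g (op a • _) = op a • (toBimod (g _) : ofBimod k R X)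
    rw [right_smul_toBimod, ← lmul_right, hg', hg', unReg_right, MulOpposite.op_mul, mul_smul]
    rfl

variable {k R X} in
/-- The map `w ⊗ x ↦ φ(w) x` is well defined. -/
theorem exists_rightProduct {n : ℕ} (φ : Pow k R X n ⟶ regular k R) :
    ∃ f : Pow k R X (n + 1) ⟶ ofBimod k R X,
      ∀ x w, unBimod (f (rmul k R X n x w)) = unReg (φ w) • x := by
  obtain ⟨g, hg⟩ := exists_rmul_lift (k := k) (R := R) (X := X) (ofBimod k R X) n
    (AddMonoidHom.mk' (fun w => (AddMonoidHom.mk' (fun x => unReg (φ w) • x)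
      (fun x y => smul_add _ x y) : X →+ X))
      (fun w w' => by
        ext x
        exact (congrArg (fun t : regular k R => unReg t • x) (map_add φ.hom w w')).trans
          (add_smul (unReg (φ w)) (unReg (φ w')) x)))
    (fun w a x => by
      change unReg (φ (op a • w)) • x = unReg (φ w) • a • x
      rw [unReg_right, mul_smul])
    (fun w a x => by
      change unReg (φ w) • op a • x = op a • (toBimod (unReg (φ w) • x) : ofBimod k R X)
      rw [right_smul_toBimod, smul_comm]
      rfl)
  have hg' : ∀ x w, g (rmul k R X n x w) = (unReg (φ w) • x : X) := hg
  refine ⟨bimodHom (Z := ofBimod k R X) g (fun a => ?_) (fun a => ?_), hg'⟩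
  · refine DFunLike.congr_fun (rmul_addHom_ext (f := g.comp (DistribSMul.toAddMonoidHom _ a))
      (g := (DistribSMul.toAddMonoidHom (ofBimod k R X) a).comp g) (fun x w => ?_))
    change g (a • _) = a • g _
    rw [← rmul_left, hg', hg', unReg_left, mul_smul]
    exact (left_smul_toBimod (k := k) (V := X) a _).symm
  · refine DFunLike.congr_fun (rmul_addHom_ext (f := g.comp (DistribSMul.toAddMonoidHom _ (op a)))
      (g := (DistribSMul.toAddMonoidHom (ofBimod k R X) (op a)).comp g) (fun x w => ?_))
    change g (op a • _) = op a • g _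
    rw [← rmul_op, hg', hg', smul_comm]
    exact (right_smul_toBimod (k := k) (V := X) (op a) _).symm

variable {k R X}

theorem smul_unBimod (c : k) (x : ofBimod k R X) : unBimod (c • x) = c • unBimod x := by
  have h : c • x = (algebraMap k R c) • x := (algebraMap_smul R c x).symm
  rw [h]
  exact (left_smul_toBimod (k := k) (V := X) _ (unBimod x)).trans
    (algebraMap_smul R c (unBimod x))

theorem smul_unReg (c : k) (x : regular k R) : unReg (c • x) = c • unReg x := by
  have h : c • x = (algebraMap k R c) • x := (algebraMap_smul R c x).symm
  rw [h]
  exact (left_smul_toReg (k := k) _ (unReg x)).trans (Algebra.smul_def c (unReg x)).symm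

theorem lmul_hom_ext {n : ℕ} {Z : BimodCat k R} {f g : Pow k R X (n + 1) ⟶ Z}
    (h : ∀ x w, f (lmul k R X n x w) = g (lmul k R X n x w)) : f = g := by
  ext t
  exact DFunLike.congr_fun (lmul_addHom_ext (f := f.hom.toAddMonoidHom)
    (g := g.hom.toAddMonoidHom) h) t

theorem rmul_hom_ext {n : ℕ} {Z : BimodCat k R} {f g : Pow k R X (n + 1) ⟶ Z}
    (h : ∀ x w, f (rmul k R X n x w) = g (rmul k R X n x w)) : f = g := by
  ext t
  exact DFunLike.congr_fun (rmul_addHom_ext (f := f.hom.toAddMonoidHom)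
    (g := g.hom.toAddMonoidHom) h) t

variable (k R X)

/-- For `φ : X^{⊗n} → R`, the map `x ⊗ w ↦ x φ(w)`. -/
def leftProduct (n : ℕ) :
    (Pow k R X n ⟶ regular k R) →ₗ[k] (Pow k R X (n + 1) ⟶ ofBimod k R X) where
  toFun φ := (exists_leftProduct φ).choose
  map_add' φ ψ := lmul_hom_ext fun x w => by
    refine ((exists_leftProduct (φ + ψ)).choose_spec x w).trans ?_
    refine Eq.trans ?_ (congrArg₂ (fun a b : X => a + b)
      ((exists_leftProduct φ).choose_spec x w) ((exists_leftProduct ψ).choose_spec x w)).symm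
    exact add_smul (op (unReg (φ w))) (op (unReg (ψ w))) x
  map_smul' c φ := lmul_hom_ext fun x w => by
    refine ((exists_leftProduct (c • φ)).choose_spec x w).trans ?_
    refine Eq.trans ?_ ((smul_unBimod c ((exists_leftProduct φ).choose (lmul k R X n x w))).trans
      (congrArg (c • ·) ((exists_leftProduct φ).choose_spec x w))).symm
    refine (congrArg (fun r : R => op r • x) (smul_unReg c (φ w))).trans ?_
    exact smul_assoc c (op (unReg (φ w))) x

/-- For `φ : X^{⊗n} → R`, the map `w ⊗ x ↦ φ(w) x`. -/
def rightProduct (n : ℕ) :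
    (Pow k R X n ⟶ regular k R) →ₗ[k] (Pow k R X (n + 1) ⟶ ofBimod k R X) where
  toFun φ := (exists_rightProduct φ).choose
  map_add' φ ψ := rmul_hom_ext fun x w => by
    refine ((exists_rightProduct (φ + ψ)).choose_spec x w).trans ?_
    refine Eq.trans ?_ (congrArg₂ (fun a b : X => a + b)
      ((exists_rightProduct φ).choose_spec x w) ((exists_rightProduct ψ).choose_spec x w)).symm
    exact add_smul (unReg (φ w)) (unReg (ψ w)) x
  map_smul' c φ := rmul_hom_ext fun x w => by
    refine ((exists_rightProduct (c • φ)).choose_spec x w).trans ?_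
    refine Eq.trans ?_ ((smul_unBimod c ((exists_rightProduct φ).choose (rmul k R X n x w))).trans
      (congrArg (c • ·) ((exists_rightProduct φ).choose_spec x w))).symm
    refine (congrArg (fun r : R => r • x) (smul_unReg c (φ w))).trans ?_
    exact smul_assoc c (unReg (φ w)) x

/-- The commutator of homomorphisms `X^{⊗n} → R` with the identity of `X`. -/
def commutator (n : ℕ) :
    (Pow k R X n ⟶ regular k R) →ₗ[k] (Pow k R X (n + 1) ⟶ ofBimod k R X) :=
  leftProduct k R X n - rightProduct k R X n

variable {k R X}

variable {n : ℕ} (φ : Pow k R X n ⟶ regular k R)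

theorem leftProduct_lmul (x : X) (w : Pow k R X n) :
    unBimod (leftProduct k R X n φ (lmul k R X n x w)) = op (unReg (φ w)) • x :=
  (exists_leftProduct φ).choose_spec x w

theorem rightProduct_rmul (x : X) (w : Pow k R X n) :
    unBimod (rightProduct k R X n φ (rmul k R X n x w)) = unReg (φ w) • x :=
  (exists_rightProduct φ).choose_spec x w

theorem commutator_apply (v : Pow k R X (n + 1)) : unBimod (commutator k R X n φ v) =
    unBimod (leftProduct k R X n φ v) - unBimod (rightProduct k R X n φ v) := rfl

/-- A pure tensor is obtained by appending its last factor. -/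
theorem pureTensor_succ (Y : BimodCat k R) (n : ℕ) (x : Fin (n + 1) → Y) :
    pureTensor Y (n + 1) x = append Y n (x (Fin.last n)) (pureTensor Y n (Fin.init x)) := by
  induction n with
  | zero =>
    refine Eq.trans ?_ (append_scalar (x 0) 1).symm
    rw [one_smul]
    rfl
  | succ n ih =>
    refine (congrArg (cons Y (n + 1) (x 0)) (ih (Fin.tail x))).trans ?_
    exact (append_cons (x (Fin.last (n + 1))) (x 0) (pureTensor Y n (Fin.tail (Fin.init x)))).symm

theorem commutator_pureTensor (x : Fin (n + 1) → X) :
    unBimod (commutator k R X n φ (pureTensor (ofBimod k R X) (n + 1) fun i => toBimod (x i))) =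
      op (unReg (φ (pureTensor (ofBimod k R X) n fun i => toBimod (x i.succ)))) • x 0
      - unReg (φ (pureTensor (ofBimod k R X) n fun i => toBimod (x i.castSucc))) •
        x (Fin.last n) := by
  rw [commutator_apply]
  refine congrArg₂ (· - ·) (leftProduct_lmul φ (x 0) _) ?_
  rw [pureTensor_succ]
  exact rightProduct_rmul φ (x (Fin.last n)) _

end Commutator

/-! ### Parity and homomorphisms from the syzygies -/

theorem unReg_zero {k : Type u} [Field k] {R : Type u} [Ring R] [Algebra k R] :
    unReg (0 : regular k R) = 0 := rfl

section Parity

variable {k : Type u} [Field k] {R : Type u} [Ring R] [Algebra k R]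
  {X : Type u} [AddCommGroup X] [Module k X] [Module R X] [Module Rᵐᵒᵖ X]
  [SMulCommClass R Rᵐᵒᵖ X] [IsScalarTower k R X] [IsScalarTower k Rᵐᵒᵖ X]

/-- An even power, multiplied by `X`, becomes an odd one. -/
theorem smul_add_op_smul_of_even {n : ℕ} {e : R} (heX : ∀ x : X, e • x + op e • x = x)
    (h : ∀ w : Pow k R X n, e • w = op e • w) (v : Pow k R X (n + 1)) :
    e • v + op e • v = v :=
  DFunLike.congr_fun (lmul_addHom_ext (f := DistribSMul.toAddMonoidHom (Pow k R X (n + 1)) e +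
      DistribSMul.toAddMonoidHom (Pow k R X (n + 1)) (op e))
    (g := AddMonoidHom.id (Pow k R X (n + 1))) (fun x w => by
      change e • lmul k R X n x w + op e • lmul k R X n x w = lmul k R X n x w
      rw [← lmul_smul, ← lmul_right, ← h, ← lmul_op, ← AddMonoidHom.add_apply, ← map_add, heX])) v

/-- An odd power, multiplied by `X`, becomes an even one. -/
theorem smul_eq_op_smul_of_odd {n : ℕ} {e : R} (heX : ∀ x : X, e • x + op e • x = x)
    (h : ∀ w : Pow k R X n, e • w + op e • w = w) (v : Pow k R X (n + 1)) :
    e • v = op e • v :=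
  DFunLike.congr_fun (lmul_addHom_ext (f := DistribSMul.toAddMonoidHom (Pow k R X (n + 1)) e)
    (g := DistribSMul.toAddMonoidHom (Pow k R X (n + 1)) (op e)) (fun x w => by
      change e • lmul k R X n x w = op e • lmul k R X n x w
      rw [← lmul_smul, ← lmul_right, eq_sub_of_add_eq' (h w), map_sub, ← lmul_op,
        ← AddMonoidHom.sub_apply, ← map_sub, eq_sub_of_add_eq (heX x)])) v

/-- Left and right multiplication by `e` coincide on the even tensor powers of `X` and are
complementary projections of the odd ones. -/
theorem pow_parity {e : R} (hc : ∀ r, e * r = r * e) (heX : ∀ x : X, e • x + op e • x = x)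
    (m : ℕ) : (∀ w : Pow k R X (2 * m), e • w = op e • w) ∧
      ∀ w : Pow k R X (2 * m + 1), e • w + op e • w = w := by
  have h0 : ∀ w : Pow k R X (2 * m), e • w = op e • w := by
    induction m with
    | zero =>
      intro w
      obtain ⟨r, rfl⟩ := exists_scalar (X := ofBimod k R X) w
      exact (left_smul_scalar e r).trans ((congrArg _ (hc r)).trans (right_smul_scalar e r).symm)
    | succ m ih => exact smul_eq_op_smul_of_odd heX (smul_add_op_smul_of_even heX ih)
  exact ⟨h0, smul_add_op_smul_of_even heX h0⟩

theorem sign_two_mul (m : ℕ) : sign (2 * m) = 1 := by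
  induction m with
  | zero => rfl
  | succ m ih => exact (neg_neg (sign (2 * m))).trans ih

section

variable {Z : BimodCat k (SqZ R X)} (g : Z ⟶ regular k (SqZ R X)) {z : Z} {e : R}

/-- Elements on which left and right multiplication by `e` coincide are mapped to `R`. -/
theorem snd_eq_zero_of_even (he : e * e = e) (heX : ∀ x : X, e • x + op e • x = x)
    (hz : (TrivSqZeroExt.inl e : SqZ R X) • z = op (TrivSqZeroExt.inl e : SqZ R X) • z) :
    (unReg (g z)).snd = 0 := by
  have h := congrArg (fun z => (unReg (g z)).snd) hz
  simp only [unReg_left, unReg_right, TrivSqZeroExt.snd_mul, TrivSqZeroExt.fst_inl,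
    TrivSqZeroExt.snd_inl, smul_zero, add_zero, zero_add] at h
  have h1 := heX (unReg (g z)).snd
  have h2 : e • op e • (unReg (g z)).snd = 0 := by
    have := congrArg (e • ·) h1
    simpa [smul_smul, he] using this
  rw [← h, smul_smul, he] at h2
  rwa [← h, h2, add_zero, eq_comm] at h1

/-- Elements on which left and right multiplication by `e` are complementary are mapped to `X`. -/
theorem fst_eq_zero_of_odd (he : e * e = e) (hc : ∀ r, e * r = r * e)
    (hz : (TrivSqZeroExt.inl e : SqZ R X) • z + op (TrivSqZeroExt.inl e : SqZ R X) • z = z) :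
    (unReg (g z)).fst = 0 := by
  have h := congrArg (fun z => (unReg (g z)).fst) hz
  have h0 : (unReg (g ((TrivSqZeroExt.inl e : SqZ R X) • z +
      op (TrivSqZeroExt.inl e : SqZ R X) • z))).fst =
        (unReg (g ((TrivSqZeroExt.inl e : SqZ R X) • z))).fst +
          (unReg (g (op (TrivSqZeroExt.inl e : SqZ R X) • z))).fst := by
    rw [map_add]
    rfl
  have h1 := h0.symm.trans h
  simp only [unReg_left, unReg_right, TrivSqZeroExt.fst_mul, TrivSqZeroExt.fst_inl, ← hc] at h1
  have h2 : e * (unReg (g z)).fst = 0 := by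
    have := congrArg (e * ·) h1
    simpa [mul_add, ← mul_assoc, he] using this
  rwa [h2, add_zero, eq_comm] at h1

end

section

variable {n : ℕ} {f g : syzygy k R X n ⟶ regular k (SqZ R X)} {e : R}

theorem hom_syz_lmul (f : syzygy k R X n ⟶ regular k (SqZ R X)) (x : X) (w : Pow k R X n) :
    unReg (f (syz 0 (lmul k R X n x w))) = TrivSqZeroExt.inr x * unReg (f (syz w 0)) := by
  rw [← unReg_left, inr_smul_syz]

theorem hom_syz_rmul (hn : sign n = 1) (f : syzygy k R X n ⟶ regular k (SqZ R X)) (x : X)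
    (w : Pow k R X n) :
    unReg (f (syz 0 (rmul k R X n x w))) = unReg (f (syz w 0)) * TrivSqZeroExt.inr x := by
  rw [← unReg_right, op_inr_smul_syz, hn, one_smul]

theorem syz_eq_add (w : Pow k R X n) (v : Pow k R X (n + 1)) :
    syz w v = syz w 0 + syz 0 v := by
  rw [← syz_add, add_zero, zero_add]

/-- The syzygy `Qₙ` is generated by the copy of `X^{⊗n}` in it. -/
theorem syzygy_hom_ext (h : ∀ w, f (syz w 0) = g (syz w 0)) : f = g := by
  have h1 : ∀ v, f (syz 0 v) = g (syz 0 v) := by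
    refine DFunLike.congr_fun (lmul_addHom_ext
      (f := AddMonoidHom.mk' (fun v => f (syz 0 v)) (fun a b => ?_))
      (g := AddMonoidHom.mk' (fun v => g (syz 0 v)) (fun a b => ?_)) (fun x w => ?_))
    · rw [← map_add, ← syz_add, add_zero]
    · rw [← map_add, ← syz_add, add_zero]
    · refine (hom_syz_lmul f x w).trans (Eq.trans ?_ (hom_syz_lmul g x w).symm)
      rw [h]
  ext q
  obtain ⟨w, v, rfl⟩ := exists_syz q
  change f _ = g _
  rw [syz_eq_add, map_add, map_add, h, h1]

theorem hom_syz_snd (he : e * e = e) (heX : ∀ x : X, e • x + op e • x = x)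
    (h : ∀ w : Pow k R X n, e • w = op e • w) (w : Pow k R X n) : (unReg (f (syz w 0))).snd = 0 :=
  snd_eq_zero_of_even f he heX (by
    rw [inl_smul_syz, op_inl_smul_syz, h, smul_zero, smul_zero])

theorem hom_syz_fst (he : e * e = e) (hc : ∀ r, e * r = r * e)
    (h : ∀ w : Pow k R X n, e • w + op e • w = w) (w : Pow k R X n) :
    (unReg (f (syz w 0))).fst = 0 :=
  fst_eq_zero_of_odd f he hc (by
    rw [inl_smul_syz, op_inl_smul_syz, ← syz_add, h, smul_zero, smul_zero, add_zero])

end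

variable (k R X) in
/-- The homomorphism `Qₙ → R ⊕ X` that is `φ : X^{⊗n} → X` on `X^{⊗n}` and zero on
`X^{⊗(n+1)}`. -/
def cornerHom (n : ℕ) :
    (Pow k R X n ⟶ ofBimod k R X) →ₗ[k] (syzygy k R X n ⟶ regular k (SqZ R X)) where
  toFun φ := (syzygyAction k R X n).desc
    (show _ →+ regular k (SqZ R X) from
      AddMonoidHom.mk' (fun v => (toReg (TrivSqZeroExt.inr (unBimod (φ v.1))) :
        regular k (SqZ R X))) (fun v v' => by
          rw [Prod.fst_add, map_add]
          exact TrivSqZeroExt.inr_add R (unBimod (φ v.1)) (unBimod (φ v'.1))))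
    (fun a v => by
      refine Eq.trans ?_ (left_smul_toReg (k := k) (TrivSqZeroExt.inl a : SqZ R X)
        (TrivSqZeroExt.inr (unBimod (φ v.1)))).symm
      rw [TrivSqZeroExt.inl_mul_inr, AddMonoidHom.mk'_apply, Prod.smul_fst, hom_left_smul]
      exact congrArg (fun y : X => (toReg (TrivSqZeroExt.inr y : SqZ R X) : regular k (SqZ R X)))
        (left_smul_toBimod (k := k) (V := X) a (unBimod (φ v.1))))
    (fun x v => by
      refine Eq.trans ?_ (left_smul_toReg (k := k) (TrivSqZeroExt.inr x : SqZ R X)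
        (TrivSqZeroExt.inr (unBimod (φ v.1)))).symm
      rw [TrivSqZeroExt.inr_mul_inr]
      change (toReg (TrivSqZeroExt.inr (unBimod (φ 0))) : regular k (SqZ R X)) = _
      rw [map_zero]
      rfl)
    (fun a v => by
      refine Eq.trans ?_ (right_smul_toReg (k := k) (TrivSqZeroExt.inl a : SqZ R X)
        (TrivSqZeroExt.inr (unBimod (φ v.1)))).symm
      rw [TrivSqZeroExt.inr_mul_inl, AddMonoidHom.mk'_apply, Prod.smul_fst, hom_right_smul]
      exact congrArg (fun y : X => (toReg (TrivSqZeroExt.inr y : SqZ R X) : regular k (SqZ R X)))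
        (right_smul_toBimod (k := k) (V := X) (op a) (unBimod (φ v.1))))
    (fun x v => by
      refine Eq.trans ?_ (right_smul_toReg (k := k) (TrivSqZeroExt.inr x : SqZ R X)
        (TrivSqZeroExt.inr (unBimod (φ v.1)))).symm
      rw [TrivSqZeroExt.inr_mul_inr]
      change (toReg (TrivSqZeroExt.inr (unBimod (φ 0))) : regular k (SqZ R X)) = _
      rw [map_zero]
      rfl)
  map_add' φ ψ := syzygy_hom_ext fun w =>
    TrivSqZeroExt.inr_add R (unBimod (φ w)) (unBimod (ψ w))
  map_smul' c φ := syzygy_hom_ext fun w => by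
    refine Eq.trans ?_ (smul_unReg (k := k) (R := SqZ R X) c
      (toReg (TrivSqZeroExt.inr (unBimod (φ w))))).symm
    refine (congrArg (fun x : X => (TrivSqZeroExt.inr x : SqZ R X))
      (smul_unBimod c (φ w))).trans ?_
    exact TrivSqZeroExt.inr_smul R c (unBimod (φ w))

theorem cornerHom_syz {n : ℕ} (φ : Pow k R X n ⟶ ofBimod k R X) (w : Pow k R X n)
    (v : Pow k R X (n + 1)) : unReg (cornerHom k R X n φ (syz w v)) =
      TrivSqZeroExt.inr (unBimod (φ w)) := rfl

/-- For odd `n`, all homomorphisms `Qₙ → R ⊕ X` come from homomorphisms `X^{⊗n} → X`: their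
values on `X^{⊗n}` lie in `X`, so that they vanish on `X^{⊗(n+1)}`. -/
theorem exists_cornerHom {n : ℕ} {e : R} (he : e * e = e) (hc : ∀ r, e * r = r * e)
    (h : ∀ w : Pow k R X n, e • w + op e • w = w)
    (f : syzygy k R X n ⟶ regular k (SqZ R X)) : ∃ φ, cornerHom k R X n φ = f := by
  have hval : ∀ w : Pow k R X n,
      unReg (f (syz w 0)) = TrivSqZeroExt.inr (unReg (f (syz w 0))).snd := fun w =>
    TrivSqZeroExt.ext (hom_syz_fst he hc h w) rfl
  let φ : Pow k R X n ⟶ ofBimod k R X := bimodHom (Z := ofBimod k R X)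
    (AddMonoidHom.mk' (fun w => (toBimod (unReg (f (syz w 0))).snd : ofBimod k R X))
      (fun w w' => by
        have h1 : syz (w + w') 0 = syz w 0 + syz w' 0 := by rw [← syz_add, add_zero]
        rw [h1, map_add]
        rfl))
    (fun a w => by
      rw [AddMonoidHom.mk'_apply, left_smul_toBimod]
      have h1 := inl_smul_syz w 0 a
      rw [smul_zero] at h1
      rw [← h1, unReg_left]
      simp)
    (fun a w => by
      rw [AddMonoidHom.mk'_apply, right_smul_toBimod]
      have h1 := op_inl_smul_syz w 0 a
      rw [smul_zero] at h1
      rw [← h1, unReg_right]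
      simp)
  exact ⟨φ, syzygy_hom_ext fun w => (hval w).symm⟩

variable (k R X) in
/-- For `f : Qₙ → R ⊕ X`, the component `X^{⊗n} → R`. -/
def diagonalHom (n : ℕ) :
    (syzygy k R X n ⟶ regular k (SqZ R X)) →ₗ[k] (Pow k R X n ⟶ regular k R) where
  toFun f := bimodHom (Z := regular k R)
    (AddMonoidHom.mk' (fun w => (toReg (unReg (f (syz w 0))).fst : regular k R))
      (fun w w' => by
        have h1 : syz (w + w') 0 = syz w 0 + syz w' 0 := by rw [← syz_add, add_zero]
        rw [h1, map_add]
        rfl))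
    (fun a w => by
      rw [AddMonoidHom.mk'_apply, left_smul_toReg]
      have h1 := inl_smul_syz w 0 a
      rw [smul_zero] at h1
      rw [← h1, unReg_left]
      simp)
    (fun a w => by
      rw [AddMonoidHom.mk'_apply, right_smul_toReg]
      have h1 := op_inl_smul_syz w 0 a
      rw [smul_zero] at h1
      rw [← h1, unReg_right]
      simp)
  map_add' _ _ := rfl
  map_smul' c f := by
    ext w
    refine Eq.trans ?_ (smul_unReg (k := k) (R := R) c (toReg (unReg (f (syz w 0))).fst)).symm
    exact congrArg TrivSqZeroExt.fst (smul_unReg (k := k) (R := SqZ R X) c (f (syz w 0)))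

theorem diagonalHom_injective {n : ℕ} {e : R} (he : e * e = e)
    (heX : ∀ x : X, e • x + op e • x = x) (h : ∀ w : Pow k R X n, e • w = op e • w) :
    Function.Injective (diagonalHom k R X n) := fun _ _ hfg =>
  syzygy_hom_ext fun w => TrivSqZeroExt.ext (R := R) (M := X)
    (congrArg (fun q : Pow k R X n ⟶ regular k R => unReg (q w)) hfg)
    ((hom_syz_snd he heX h w).trans (hom_syz_snd he heX h w).symm)

/-- For even `n`, the homomorphisms `Qₙ → R ⊕ X` are the maps `X^{⊗n} → R` that commute with the
identity of `X`. -/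
theorem diagonalHom_exact {n : ℕ} {e : R} (hn : sign n = 1) (he : e * e = e)
    (heX : ∀ x : X, e • x + op e • x = x) (h : ∀ w : Pow k R X n, e • w = op e • w) :
    Function.Exact (diagonalHom k R X n) (commutator k R X n) := by
  intro φ
  constructor
  · intro hφ
    have hlr : leftProduct k R X n φ = rightProduct k R X n φ := sub_eq_zero.1 hφ
    have hl := leftProduct_lmul φ
    have hr := rightProduct_rmul φ
    rw [← hlr] at hr
    generalize leftProduct k R X n φ = F at hl hr
    have hadd : ∀ (r r' : R) (x x' : X), (TrivSqZeroExt.inl (r + r') + TrivSqZeroExt.inr (x + x') :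
        SqZ R X) = TrivSqZeroExt.inl r + TrivSqZeroExt.inr x +
          (TrivSqZeroExt.inl r' + TrivSqZeroExt.inr x') := fun r r' x x' => by
      rw [TrivSqZeroExt.inl_add, TrivSqZeroExt.inr_add]
      abel
    let f : syzygy k R X n ⟶ regular k (SqZ R X) := (syzygyAction k R X n).desc
      (show _ →+ regular k (SqZ R X) from
        AddMonoidHom.mk' (fun v => (toReg (TrivSqZeroExt.inl (unReg (φ v.1)) +
          TrivSqZeroExt.inr (unBimod (F v.2))) : regular k (SqZ R X))) (fun v v' => by
            rw [Prod.fst_add, Prod.snd_add, map_add, map_add]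
            exact hadd (unReg (φ v.1)) (unReg (φ v'.1)) (unBimod (F v.2)) (unBimod (F v'.2))))
      (fun a v => by
        refine Eq.trans ?_ (left_smul_toReg (k := k) (TrivSqZeroExt.inl a : SqZ R X)
          (TrivSqZeroExt.inl (unReg (φ v.1)) + TrivSqZeroExt.inr (unBimod (F v.2)))).symm
        rw [AddMonoidHom.mk'_apply, Prod.smul_fst, Prod.smul_snd, unReg_left, hom_left_smul]
        have h1 : unBimod (a • F v.2) = a • unBimod (F v.2) :=
          left_smul_toBimod (k := k) (V := X) a (unBimod (F v.2))
        rw [h1]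
        exact congrArg toReg (TrivSqZeroExt.ext (R := R) (M := X) (by simp) (by simp)))
      (fun x v => by
        refine Eq.trans ?_ (left_smul_toReg (k := k) (TrivSqZeroExt.inr x : SqZ R X)
          (TrivSqZeroExt.inl (unReg (φ v.1)) + TrivSqZeroExt.inr (unBimod (F v.2)))).symm
        change toReg (TrivSqZeroExt.inl (unReg (φ 0)) +
          TrivSqZeroExt.inr (unBimod (F (lmul k R X n x v.1)))) = _
        rw [hl, map_zero]
        exact congrArg toReg (TrivSqZeroExt.ext (R := R) (M := X) (by simp [unReg_zero]) (by simp)))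
      (fun a v => by
        refine Eq.trans ?_ (right_smul_toReg (k := k) (TrivSqZeroExt.inl a : SqZ R X)
          (TrivSqZeroExt.inl (unReg (φ v.1)) + TrivSqZeroExt.inr (unBimod (F v.2)))).symm
        rw [AddMonoidHom.mk'_apply, Prod.smul_fst, Prod.smul_snd, unReg_right, hom_right_smul]
        have h1 : unBimod (op a • F v.2) = op a • unBimod (F v.2) :=
          right_smul_toBimod (k := k) (V := X) (op a) (unBimod (F v.2))
        rw [h1]
        exact congrArg toReg (TrivSqZeroExt.ext (R := R) (M := X) (by simp) (by simp)))
      (fun x v => by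
        refine Eq.trans ?_ (right_smul_toReg (k := k) (TrivSqZeroExt.inr x : SqZ R X)
          (TrivSqZeroExt.inl (unReg (φ v.1)) + TrivSqZeroExt.inr (unBimod (F v.2)))).symm
        change toReg (TrivSqZeroExt.inl (unReg (φ 0)) +
          TrivSqZeroExt.inr (unBimod (F (sign n • rmul k R X n x v.1)))) = _
        rw [hn, one_smul, hr, map_zero]
        exact congrArg toReg (TrivSqZeroExt.ext (R := R) (M := X) (by simp [unReg_zero]) (by simp)))
    refine ⟨f, ?_⟩
    ext w
    change (TrivSqZeroExt.inl (unReg (φ w)) + TrivSqZeroExt.inr (unBimod (F 0)) : SqZ R X).fst = _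
    rw [TrivSqZeroExt.fst_add, TrivSqZeroExt.fst_inl, TrivSqZeroExt.fst_inr, add_zero]
    rfl
  · rintro ⟨f, rfl⟩
    have hval : ∀ w : Pow k R X n, unReg (f (syz w 0)) =
        TrivSqZeroExt.inl (unReg (diagonalHom k R X n f w)) := fun w =>
      TrivSqZeroExt.ext rfl (hom_syz_snd he heX h w)
    let f2 : Pow k R X (n + 1) →+ X := AddMonoidHom.mk' (fun v => (unReg (f (syz 0 v))).snd)
      (fun v v' => by
        have h1 : syz 0 (v + v') = syz 0 v + syz 0 v' := by rw [← syz_add, add_zero]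
        rw [h1, map_add]
        rfl)
    have hl : ∀ v, f2 v = unBimod (leftProduct k R X n (diagonalHom k R X n f) v) :=
      DFunLike.congr_fun (lmul_addHom_ext (f := f2)
        (g := (leftProduct k R X n (diagonalHom k R X n f)).hom.toAddMonoidHom) (fun x w => by
          refine Eq.trans ?_ (leftProduct_lmul _ x w).symm
          refine (congrArg TrivSqZeroExt.snd (hom_syz_lmul f x w)).trans ?_
          rw [hval]
          simp))
    have hr : ∀ v, f2 v = unBimod (rightProduct k R X n (diagonalHom k R X n f) v) :=
      DFunLike.congr_fun (rmul_addHom_ext (f := f2)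
        (g := (rightProduct k R X n (diagonalHom k R X n f)).hom.toAddMonoidHom) (fun x w => by
          refine Eq.trans ?_ (rightProduct_rmul _ x w).symm
          refine (congrArg TrivSqZeroExt.snd (hom_syz_rmul hn f x w)).trans ?_
          rw [hval]
          simp))
    ext v
    refine (commutator_apply _ v).trans ?_
    rw [← hl, ← hr, sub_self]
    rfl

end Parity

/-! ### The five-term exact sequences -/

/-- A short exact sequence `0 → F → H → C → 0` of vector spaces and an exact sequence
`0 → F → G → D` splice to an exact sequence `0 → H → C × G → D`. -/
theorem exists_exact_splice {k F G H C D : Type*} [Field k] [AddCommGroup F] [AddCommGroup G]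
    [AddCommGroup H] [AddCommGroup C] [AddCommGroup D] [Module k F] [Module k G] [Module k H]
    [Module k C] [Module k D] (κ : F →ₗ[k] H) (ρ : H →ₗ[k] C) (g : F →ₗ[k] G) (d : G →ₗ[k] D)
    (hκ : Function.Injective κ) (hκρ : Function.Exact κ ρ) (hρ : Function.Surjective ρ)
    (hg : Function.Injective g) (hgd : Function.Exact g d) :
    ∃ ι : H →ₗ[k] C × G, Function.Injective ι ∧
      Function.Exact ι (d.comp (LinearMap.snd k C G)) ∧ ∀ x, (ι x).1 = ρ x := by
  obtain ⟨s, hs⟩ := κ.exists_leftInverse_of_injective (LinearMap.ker_eq_bot.2 hκ)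
  have hs' : ∀ f, s (κ f) = f := LinearMap.congr_fun hs
  refine ⟨ρ.prod (g.comp s), (injective_iff_map_eq_zero _).2 fun x hx => ?_, ?_, fun _ => rfl⟩
  · obtain ⟨f, rfl⟩ := (hκρ x).1 (congrArg Prod.fst hx)
    have h : g (s (κ f)) = 0 := congrArg Prod.snd hx
    rw [hs'] at h
    rw [(injective_iff_map_eq_zero g).1 hg f h, map_zero]
  · rintro ⟨c, φ⟩
    constructor
    · intro h
      obtain ⟨f, rfl⟩ := (hgd φ).1 h
      obtain ⟨x, rfl⟩ := hρ c
      refine ⟨x + κ (f - s x), Prod.ext ?_ ?_⟩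
      · change ρ (x + κ (f - s x)) = ρ x
        rw [map_add, hκρ.apply_apply_eq_zero, add_zero]
      · change g (s (x + κ (f - s x))) = g f
        rw [map_add, hs', add_sub_cancel]
    · rintro ⟨x, hx⟩
      change d φ = 0
      rw [← show g (s x) = φ from congrArg Prod.snd hx]
      exact hgd.apply_apply_eq_zero (s x)

section FiveTerm

variable (k : Type u) [Field k] (R : Type u) [Ring R] [Algebra k R]
  (X : Type u) [AddCommGroup X] [Module k X] [Module R X] [Module Rᵐᵒᵖ X]
  [SMulCommClass R Rᵐᵒᵖ X] [IsScalarTower k R X] [IsScalarTower k Rᵐᵒᵖ X]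

/-- The restriction map `HHⁿ(R ⊕ X) → HHⁿ(R)`, as a linear map. -/
def retractLinear (n : ℕ) : HHCohomology k (SqZ R X) n →ₗ[k] HHCohomology k R n where
  toFun := retract k R X n
  map_add' x y := by
    change ((Ext.mk₀ _).comp ((x + y).mapExactFunctor _) _).comp _ _ = _
    rw [Ext.mapExactFunctor_add, Ext.comp_add, Ext.add_comp]
    rfl
  map_smul' c x := by
    change ((Ext.mk₀ _).comp ((c • x).mapExactFunctor _) _).comp _ _ = _
    rw [Functor.mapExactFunctor_smul, Ext.comp_smul, Ext.smul_comp]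
    rfl

/-- The homomorphisms from the syzygy `Qₙ` to `R ⊕ X` give classes in `HHⁿ(R ⊕ X)`. -/
def syzygyMap (n : ℕ) :
    (syzygy k R X n ⟶ regular k (SqZ R X)) →ₗ[k] HHCohomology k (SqZ R X) n where
  toFun f := (syzygyClass k R X n).comp (Ext.mk₀ f) (add_zero n)
  map_add' f g := by rw [Ext.mk₀_add, Ext.comp_add]
  map_smul' c f := by
    rw [Ext.mk₀_smul, Ext.comp_smul]
    rfl

/-- The connecting map `Hom(X^{⊗n}, X) → HHⁿ(R ⊕ X)`. -/
def connecting (n : ℕ) :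
    (Pow k R X n ⟶ ofBimod k R X) →ₗ[k] HHCohomology k (SqZ R X) n :=
  (syzygyMap k R X n).comp (cornerHom k R X n)

variable {k R X}

section

variable {n : ℕ} (g : bar k R X n ⟶ regular k (SqZ R X))

theorem hom_barElt_lmul (x : X) (w : Pow k R X n) :
    unReg (g (barElt 0 (lmul k R X n x w) 0 0)) =
      TrivSqZeroExt.inr x * unReg (g (barElt w 0 0 0)) := by
  have h := inr_smul_barElt w 0 0 0 x
  rw [map_zero] at h
  rw [← unReg_left, h]

theorem hom_barElt_rmul (x : X) (w : Pow k R X n) :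
    unReg (g (barElt 0 0 (rmul k R X n x w) 0)) =
      unReg (g (barElt w 0 0 0)) * TrivSqZeroExt.inr x := by
  have h := op_inr_smul_barElt w 0 0 0 x
  rw [map_zero] at h
  rw [← unReg_right, h]

/-- The value `g(0, v, 0, 0)`. -/
def barLeft : Pow k R X (n + 1) →+ SqZ R X :=
  AddMonoidHom.mk' (fun v => unReg (g (barElt 0 v 0 0))) (fun v v' => by
    have h := barElt_add (0 : Pow k R X n) 0 v v' 0 0 0 0
    simp only [add_zero] at h
    rw [h, map_add]
    rfl)

/-- The value `g(0, 0, v, 0)`. -/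
def barRight : Pow k R X (n + 1) →+ SqZ R X :=
  AddMonoidHom.mk' (fun v => unReg (g (barElt 0 0 v 0))) (fun v v' => by
    have h := barElt_add (0 : Pow k R X n) 0 0 0 v v' 0 0
    simp only [add_zero] at h
    rw [h, map_add]
    rfl)

theorem syzygyIncl_comp_apply (v : Pow k R X (n + 1)) :
    unReg ((syzygyIncl k R X n ≫ g) (syz v 0)) = -(sign n • barLeft g v) + barRight g v := by
  have h : barElt (0 : Pow k R X n) (-sign n • v) v 0 =
      barElt 0 (-sign n • v) 0 0 + barElt 0 0 v 0 := by
    rw [← barElt_add]; simp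
  have h1 : unReg ((syzygyIncl k R X n ≫ g) (syz v 0)) =
      unReg (g (barElt (0 : Pow k R X n) (-sign n • v) v 0)) := rfl
  rw [h1, h, map_add]
  refine (congrArg (· + barRight g v) (map_zsmul (barLeft g) (-sign n) v)).trans ?_
  rw [neg_smul]

/-- For odd `n`, a homomorphism from `Bₙ` has values in `X` on `X^{⊗n}` and thus vanishes on the
other summands, because `X` has square zero. -/
theorem syzygyIncl_comp_eq_zero {e : R} (he : e * e = e) (hc : ∀ r, e * r = r * e)
    (h : ∀ w : Pow k R X n, e • w + op e • w = w) : syzygyIncl k R X n ≫ g = 0 := by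
  have hval : ∀ w : Pow k R X n, unReg (g (barElt w 0 0 0)) =
      TrivSqZeroExt.inr (unReg (g (barElt w 0 0 0))).snd := fun w =>
    TrivSqZeroExt.ext (fst_eq_zero_of_odd g he hc (by
      rw [inl_smul_barElt, op_inl_smul_barElt, ← barElt_add, h]; simp)) rfl
  have h1 : barLeft g = 0 := lmul_addHom_ext fun x w => by
    refine (hom_barElt_lmul g x w).trans ?_
    rw [hval, TrivSqZeroExt.inr_mul_inr]
    rfl
  have h2 : barRight g = 0 := rmul_addHom_ext fun x w => by
    refine (hom_barElt_rmul g x w).trans ?_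
    rw [hval, TrivSqZeroExt.inr_mul_inr]
    rfl
  refine syzygy_hom_ext fun v => (syzygyIncl_comp_apply g v).trans ?_
  rw [h1, h2, AddMonoidHom.zero_apply, smul_zero, neg_zero, add_zero]
  rfl

/-- For even `n`, the homomorphism from `Bₙ` that is `ψ` on `X^{⊗n}` restricts to the syzygy as a
commutator of `ψ`. -/
theorem syzygyIncl_comp_eq_cornerHom (hn : sign n = 1) (ψ : Pow k R X n ⟶ regular k R)
    (hψ : ∀ w, unReg (g (barElt w 0 0 0)) = TrivSqZeroExt.inl (unReg (ψ w))) :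
    syzygyIncl k R X n ≫ g = cornerHom k R X (n + 1) (-commutator k R X n ψ) := by
  have h1 : ∀ v, barLeft g v = TrivSqZeroExt.inr (unBimod (leftProduct k R X n ψ v)) :=
    DFunLike.congr_fun (lmul_addHom_ext (f := barLeft g)
      (g := (TrivSqZeroExt.inrHom R X).toAddMonoidHom.comp
        (leftProduct k R X n ψ).hom.toAddMonoidHom) fun x w => by
      refine (hom_barElt_lmul g x w).trans ?_
      rw [hψ, TrivSqZeroExt.inr_mul_inl, ← leftProduct_lmul]
      rfl)
  have h2 : ∀ v, barRight g v = TrivSqZeroExt.inr (unBimod (rightProduct k R X n ψ v)) :=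
    DFunLike.congr_fun (rmul_addHom_ext (f := barRight g)
      (g := (TrivSqZeroExt.inrHom R X).toAddMonoidHom.comp
        (rightProduct k R X n ψ).hom.toAddMonoidHom) fun x w => by
      refine (hom_barElt_rmul g x w).trans ?_
      rw [hψ, TrivSqZeroExt.inl_mul_inr, ← rightProduct_rmul]
      rfl)
  refine syzygy_hom_ext fun v => (syzygyIncl_comp_apply g v).trans ?_
  refine Eq.trans ?_ (cornerHom_syz (-commutator k R X n ψ) v 0).symm
  have h3 : unBimod ((-commutator k R X n ψ) v) = -(unBimod (leftProduct k R X n ψ v) -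
    unBimod (rightProduct k R X n ψ v)) := rfl
  rw [h1, h2, h3, hn, one_smul, neg_sub, TrivSqZeroExt.inr_sub, neg_add_eq_sub]

end

theorem retractLinear_surjective (hX : Module.Projective (Env k R) (ofBimod k R X)) (n : ℕ) :
    Function.Surjective (retractLinear k R X (n + 1)) :=
  retract_surjective hX

/-- The classes that vanish on the diagonal are those that come from the syzygy of the same
degree. -/
theorem syzygyMap_exact (hX : Module.Projective (Env k R) (ofBimod k R X)) {e : R}
    (he : e * e = e) (hc : ∀ r, e * r = r * e) (heX : ∀ x : X, e • x + op e • x = x)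
    (n : ℕ) :
    Function.Exact (syzygyMap k R X (n + 1)) (retractLinear k R X (n + 1)) := by
  intro x
  constructor
  · intro hx
    obtain ⟨y, hy⟩ := exists_syzygyClass_comp hX he hc heX n (add_zero (n + 1)) x hx
    obtain ⟨f, rfl⟩ := (Ext.mk₀_bijective _ _).2 y
    exact ⟨f, hy⟩
  · rintro ⟨f, rfl⟩
    exact retract_syzygyClass_comp n (Ext.mk₀ f) (add_zero (n + 1))

theorem syzygyMap_injective (hX : Module.Projective (Env k R) (ofBimod k R X)) {e : R}
    (he : e * e = e) (hc : ∀ r, e * r = r * e) (heX : ∀ x : X, e • x + op e • x = x)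
    (m : ℕ) : Function.Injective (syzygyMap k R X (2 * m + 1 + 1)) :=
  (injective_iff_map_eq_zero _).2 fun f hf => by
    obtain ⟨g, rfl⟩ := (syzygyClass_comp_mk₀_eq_zero_iff hX he hc heX _ f).1 hf
    exact syzygyIncl_comp_eq_zero g he hc (pow_parity hc heX m).2

theorem connecting_exact (hX : Module.Projective (Env k R) (ofBimod k R X)) {e : R}
    (he : e * e = e) (hc : ∀ r, e * r = r * e) (heX : ∀ x : X, e • x + op e • x = x)
    (m : ℕ) :
    Function.Exact (connecting k R X (2 * m + 1)) (retractLinear k R X (2 * m + 1)) := by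
  intro x
  rw [syzygyMap_exact hX he hc heX (2 * m) x]
  constructor
  · rintro ⟨f, rfl⟩
    obtain ⟨φ, rfl⟩ := exists_cornerHom he hc (pow_parity hc heX m).2 f
    exact ⟨φ, rfl⟩
  · rintro ⟨φ, rfl⟩
    exact ⟨cornerHom k R X _ φ, rfl⟩

theorem commutator_exact (hX : Module.Projective (Env k R) (ofBimod k R X)) {e : R}
    (he : e * e = e) (hc : ∀ r, e * r = r * e) (heX : ∀ x : X, e • x + op e • x = x)
    (m : ℕ) :
    Function.Exact (commutator k R X (2 * m)) (connecting k R X (2 * m + 1)) := by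
  have hpar := (pow_parity (k := k) hc heX m).1
  intro φ
  refine Iff.trans (syzygyClass_comp_mk₀_eq_zero_iff hX he hc heX (2 * m)
    (cornerHom k R X (2 * m + 1) φ)) ?_
  constructor
  · rintro ⟨g, hg⟩
    let ψ : Pow k R X (2 * m) ⟶ regular k R :=
      barUnit k R X (2 * m) ≫ (restrictBimod (incl k R X)).map g ≫ fstHom k R X
    have h := syzygyIncl_comp_eq_cornerHom g (sign_two_mul m) ψ (fun w =>
      TrivSqZeroExt.ext rfl (snd_eq_zero_of_even g he heX (by
        rw [inl_smul_barElt, op_inl_smul_barElt, hpar]; simp)))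
    refine ⟨-ψ, ?_⟩
    rw [map_neg]
    ext v
    have h1 := congrArg (fun f : syzygy k R X (2 * m + 1) ⟶ regular k (SqZ R X) =>
      (unReg (f (syz v 0))).snd) (h.symm.trans hg)
    exact h1
  · rintro ⟨ψ, rfl⟩
    obtain ⟨g, hg⟩ := exists_bar_lift (W := regular k (SqZ R X))
      ((-ψ) ≫ inclusionHom (incl k R X))
    refine ⟨g, ?_⟩
    have h := syzygyIncl_comp_eq_cornerHom g (sign_two_mul m) (-ψ) hg
    rw [h, map_neg (commutator k R X (2 * m)), neg_neg]

/-- The beginning of the exact sequence, in the positive even degree `2(m + 1)`. -/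
theorem exists_exact_even (hX : Module.Projective (Env k R) (ofBimod k R X)) {e : R}
    (he : e * e = e) (hc : ∀ r, e * r = r * e) (heX : ∀ x : X, e • x + op e • x = x)
    (m : ℕ) : ∃ ι : HHCohomology k (SqZ R X) (2 * (m + 1)) →ₗ[k]
      HHCohomology k R (2 * (m + 1)) × (Pow k R X (2 * (m + 1)) ⟶ regular k R),
    Function.Injective ι ∧
      Function.Exact ι ((commutator k R X (2 * (m + 1))).comp (LinearMap.snd k _ _)) ∧
      ∀ x, (ι x).1 = retractLinear k R X (2 * (m + 1)) x :=
  exists_exact_splice (syzygyMap k R X (2 * (m + 1))) (retractLinear k R X (2 * (m + 1)))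
    (diagonalHom k R X (2 * (m + 1))) (commutator k R X (2 * (m + 1)))
    (syzygyMap_injective hX he hc heX m) (syzygyMap_exact hX he hc heX (2 * m + 1))
    (retractLinear_surjective hX (2 * m + 1))
    (diagonalHom_injective he heX (pow_parity hc heX (m + 1)).1)
    (diagonalHom_exact (sign_two_mul (m + 1)) he heX (pow_parity hc heX (m + 1)).1)

end FiveTerm

/-! ### The exact sequence in degrees zero and one -/

section DegreeZero

variable (k : Type u) [Field k] (R : Type u) [Ring R] [Algebra k R]
  (X : Type u) [AddCommGroup X] [Module k X] [Module R X] [Module Rᵐᵒᵖ X]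
  [SMulCommClass R Rᵐᵒᵖ X] [IsScalarTower k R X] [IsScalarTower k Rᵐᵒᵖ X]

/-- The isomorphism of `X` with its first tensor power. -/
def toPowOne : ofBimod k R X ⟶ Pow k R X 1 :=
  bimodHom (Y := ofBimod k R X)
    (AddMonoidHom.mk' (fun x => lmul k R X 0 (unBimod x) (one k R X)) (fun x y =>
      DFunLike.congr_fun (map_add (lmul k R X 0) (unBimod x) (unBimod y)) (one k R X)))
    (fun a x => by
      refine Eq.trans ?_ (lmul_smul a (unBimod x) (one k R X))
      exact congrArg (fun y : X => lmul k R X 0 y (one k R X))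
        (left_smul_toBimod (k := k) (V := X) a (unBimod x)))
    (fun a x => by
      have h : op a • one k R X = a • one k R X := by
        rw [one, right_smul_scalar, left_smul_scalar, one_mul, mul_one]
      refine Eq.trans ?_ (lmul_right a (unBimod x) (one k R X))
      rw [h, ← lmul_op]
      exact congrArg (fun y : X => lmul k R X 0 y (one k R X))
        (right_smul_toBimod (k := k) (V := X) (op a) (unBimod x)))

instance toPowOne_isIso : IsIso (toPowOne k R X) := by
  refine (ConcreteCategory.isIso_iff_bijective _).2 ⟨?_, fun v => ?_⟩
  · exact (injective_iff_map_eq_zero (toPowOne k R X).hom).2 fun x hx =>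
      lmul_one_injective (unBimod x) hx
  · obtain ⟨x, hx⟩ := lmul_one_surjective v
    exact ⟨(toBimod x : ofBimod k R X), hx⟩

/-- The commutators of the elements of `HH⁰(R)` with the identity of `X`. -/
def commutatorZero : HHCohomology k R 0 →ₗ[k] (ofBimod k R X ⟶ ofBimod k R X) :=
  (Linear.leftComp k (ofBimod k R X) (toPowOne k R X)).comp ((commutator k R X 0).comp
    (Ext.linearEquiv₀ (R := k) (X := regular k R) (Y := regular k R)).toLinearMap)

/-- The connecting map `End(X) → HH¹(R ⊕ X)`. -/
def connectingOne : (ofBimod k R X ⟶ ofBimod k R X) →ₗ[k] HHCohomology k (SqZ R X) 1 :=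
  (connecting k R X 1).comp (Linear.leftComp k (ofBimod k R X) (inv (toPowOne k R X)))

variable {k R X}

theorem commutatorZero_mk₀ (f : regular k R ⟶ regular k R) :
    commutatorZero k R X (Ext.mk₀ f) = toPowOne k R X ≫ commutator k R X 0 f := by
  have h : Ext.linearEquiv₀ (R := k) (Ext.mk₀ f) = f :=
    (Ext.linearEquiv₀ (R := k) (X := regular k R) (Y := regular k R)).symm_apply_eq.1 rfl |>.symm
  exact congrArg (fun g => toPowOne k R X ≫ commutator k R X 0 g) h

theorem commutatorZero_apply (f : regular k R ⟶ regular k R) (x : X) :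
    unBimod (commutatorZero k R X (Ext.mk₀ f) (toBimod x)) =
      op (unReg (f (toReg 1))) • x - unReg (f (toReg 1)) • x := by
  rw [commutatorZero_mk₀]
  have h : lmul k R X 0 x (one k R X) = rmul k R X 0 x (one k R X) := by
    refine Eq.trans ?_ (rmul_scalar x (1 : R)).symm
    rw [one_smul]
  let φ : Pow k R X 0 ⟶ regular k R := f
  refine (commutator_apply φ (lmul k R X 0 x (one k R X))).trans ?_
  refine congrArg₂ (· - ·) (leftProduct_lmul φ x (one k R X)) ?_
  rw [h]
  exact rightProduct_rmul φ x (one k R X)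

theorem syzygyMap_zero_surjective : Function.Surjective (syzygyMap k R X 0) := fun x => by
  obtain ⟨f, rfl⟩ := (Ext.mk₀_bijective _ _).2 x
  refine ⟨inv (regularToSyzygy k R X) ≫ f, ?_⟩
  refine (Ext.mk₀_comp_mk₀ _ _).trans ?_
  rw [IsIso.hom_inv_id_assoc]

/-- In degree zero, `R ⊕ X` is its own syzygy and the restriction map is `diagonalHom`. -/
theorem retractLinear_syzygyMap (f : syzygy k R X 0 ⟶ regular k (SqZ R X)) :
    retractLinear k R X 0 (syzygyMap k R X 0 f) =
      Ext.mk₀ (show regular k R ⟶ regular k R from diagonalHom k R X 0 f) := by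
  have h1 : syzygyMap k R X 0 f = Ext.mk₀ (regularToSyzygy k R X ≫ f) := Ext.mk₀_comp_mk₀ _ _
  rw [h1]
  change ((Ext.mk₀ (inclusionHom (incl k R X))).comp ((Ext.mk₀ _).mapExactFunctor _)
    (zero_add 0)).comp
    (Ext.mk₀ (fstHom k R X)) (add_zero 0) = _
  rw [Ext.mapExactFunctor_mk₀, Ext.mk₀_comp_mk₀, Ext.mk₀_comp_mk₀]
  refine congrArg Ext.mk₀ ?_
  ext r
  have h2 : regularToSyzygy k R X (toReg (TrivSqZeroExt.inl (unReg r))) =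
      syz (scalar (ofBimod k R X) (unReg r)) 0 := by
    rw [regularToSyzygy_apply, TrivSqZeroExt.snd_inl, map_zero]
    rfl
  exact congrArg (fun q : syzygy k R X 0 => (unReg (f q)).fst) h2

theorem retractLinear_zero_injective {e : R} (he : e * e = e) (hc : ∀ r, e * r = r * e)
    (heX : ∀ x : X, e • x + op e • x = x) : Function.Injective (retractLinear k R X 0) :=
  (injective_iff_map_eq_zero _).2 fun x hx => by
    obtain ⟨f, rfl⟩ := syzygyMap_zero_surjective x
    rw [retractLinear_syzygyMap] at hx
    have h1 : diagonalHom k R X 0 f = 0 :=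
      (Ext.mk₀_bijective _ _).1 (hx.trans (Ext.mk₀_zero _ _).symm)
    have h2 : f = 0 := (injective_iff_map_eq_zero (diagonalHom k R X 0)).1
      (diagonalHom_injective he heX (pow_parity hc heX 0).1) f h1
    rw [h2, map_zero]

theorem retractLinear_exact_zero {e : R} (he : e * e = e) (hc : ∀ r, e * r = r * e)
    (heX : ∀ x : X, e • x + op e • x = x) :
    Function.Exact (retractLinear k R X 0) (commutatorZero k R X) := by
  intro c
  obtain ⟨h, rfl⟩ := (Ext.mk₀_bijective _ _).2 c
  rw [commutatorZero_mk₀]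
  have hex := diagonalHom_exact (k := k) (sign_two_mul 0) he heX (pow_parity hc heX 0).1
  refine Iff.trans ⟨fun h0 => (cancel_epi (toPowOne k R X)).1
    (h0.trans Limits.comp_zero.symm), fun h0 => ?_⟩ ((hex h).trans ?_)
  · exact (congrArg (fun g => toPowOne k R X ≫ g) h0).trans Limits.comp_zero
  · constructor
    · rintro ⟨f, hf⟩
      exact ⟨syzygyMap k R X 0 f, (retractLinear_syzygyMap f).trans (congrArg Ext.mk₀ hf)⟩
    · rintro ⟨x, hx⟩
      obtain ⟨f, rfl⟩ := syzygyMap_zero_surjective x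
      rw [retractLinear_syzygyMap] at hx
      exact ⟨f, (Ext.mk₀_bijective _ _).1 hx⟩

theorem commutatorZero_exact (hX : Module.Projective (Env k R) (ofBimod k R X)) {e : R}
    (he : e * e = e) (hc : ∀ r, e * r = r * e) (heX : ∀ x : X, e • x + op e • x = x) :
    Function.Exact (commutatorZero k R X) (connectingOne k R X) := by
  intro h
  refine Iff.trans (commutator_exact hX he hc heX 0 (inv (toPowOne k R X) ≫ h)) ?_
  constructor
  · rintro ⟨ψ, hψ⟩
    refine ⟨Ext.mk₀ ψ, (commutatorZero_mk₀ ψ).trans ?_⟩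
    refine (congrArg (fun g => toPowOne k R X ≫ g) hψ).trans ?_
    rw [IsIso.hom_inv_id_assoc]
  · rintro ⟨c, rfl⟩
    obtain ⟨ψ, rfl⟩ := (Ext.mk₀_bijective _ _).2 c
    refine ⟨ψ, ?_⟩
    rw [commutatorZero_mk₀, IsIso.inv_hom_id_assoc]

theorem connectingOne_exact (hX : Module.Projective (Env k R) (ofBimod k R X)) {e : R}
    (he : e * e = e) (hc : ∀ r, e * r = r * e) (heX : ∀ x : X, e • x + op e • x = x) :
    Function.Exact (connectingOne k R X) (retractLinear k R X 1) := by
  intro x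
  refine (connecting_exact hX he hc heX 0 x).trans ⟨?_, ?_⟩
  · rintro ⟨φ, rfl⟩
    refine ⟨toPowOne k R X ≫ φ, ?_⟩
    exact congrArg (connecting k R X 1) (IsIso.inv_hom_id_assoc (toPowOne k R X) φ)
  · rintro ⟨φ, rfl⟩
    exact ⟨inv (toPowOne k R X) ≫ φ, rfl⟩

end DegreeZero

end HH

end

theorem mainTheorem6 (k : Type u) [Field k] (A B M N : Type u) [Ring A] [Ring B]
    [Algebra k A] [Algebra k B]
    [AddCommGroup M] [Module k M] [Module B M] [Module Aᵐᵒᵖ M] [SMulCommClass B Aᵐᵒᵖ M]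
    [IsScalarTower k B M] [IsScalarTower k Aᵐᵒᵖ M]
    [AddCommGroup N] [Module k N] [Module A N] [Module Bᵐᵒᵖ N] [SMulCommClass A Bᵐᵒᵖ N]
    [IsScalarTower k A N] [IsScalarTower k Bᵐᵒᵖ N]
    (hproj : Module.Projective (HH.Env k (A × B)) (HH.ofBimod k (A × B) (HH.Corners M N))) :
    letI AA : HH.BimodCat k (A × B) := HH.regular k (A × B)
    letI MM : HH.BimodCat k (A × B) := HH.ofBimod k (A × B) (HH.Corners M N)
    (∀ m : ℕ, 0 < m →
      ∃ (ι : HH.HHCohomology k (HH.NullSquare A B M N) (2 * m) →ₗ[k]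
              HH.HHCohomology k (A × B) (2 * m) × (HH.tensorPower MM (2 * m) ⟶ AA))
        (nabla : HH.HHCohomology k (A × B) (2 * m) × (HH.tensorPower MM (2 * m) ⟶ AA) →ₗ[k]
              (HH.tensorPower MM (2 * m + 1) ⟶ MM))
        (κ : (HH.tensorPower MM (2 * m + 1) ⟶ MM) →ₗ[k]
              HH.HHCohomology k (HH.NullSquare A B M N) (2 * m + 1))
        (ρ : HH.HHCohomology k (HH.NullSquare A B M N) (2 * m + 1) →ₗ[k]
              HH.HHCohomology k (A × B) (2 * m + 1)),
        Function.Injective ι ∧ Function.Exact ι nabla ∧ Function.Exact nabla κ ∧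
          Function.Exact κ ρ ∧ Function.Surjective ρ ∧
        (∀ c, (ι c).1 = HH.diagonalMap k A B M N (2 * m) c) ∧
        (∀ c (φ : HH.tensorPower MM (2 * m) ⟶ AA) (x : Fin (2 * m + 1) → HH.Corners M N),
          HH.unBimod (nabla (c, φ) (HH.pureTensor MM (2 * m + 1) fun i => HH.toBimod (x i))) =
            op (HH.unReg (φ (HH.pureTensor MM (2 * m) fun i => HH.toBimod (x i.succ)))) • x 0
            - HH.unReg (φ (HH.pureTensor MM (2 * m) fun i => HH.toBimod (x i.castSucc))) •
                x (Fin.last (2 * m))) ∧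
        (∀ c, ρ c = HH.diagonalMap k A B M N (2 * m + 1) c)) ∧
    (∃ (ι : HH.HHCohomology k (HH.NullSquare A B M N) 0 →ₗ[k] HH.HHCohomology k (A × B) 0)
      (nabla : HH.HHCohomology k (A × B) 0 →ₗ[k] (MM ⟶ MM))
      (κ : (MM ⟶ MM) →ₗ[k] HH.HHCohomology k (HH.NullSquare A B M N) 1)
      (ρ : HH.HHCohomology k (HH.NullSquare A B M N) 1 →ₗ[k] HH.HHCohomology k (A × B) 1),
      Function.Injective ι ∧ Function.Exact ι nabla ∧ Function.Exact nabla κ ∧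
        Function.Exact κ ρ ∧ Function.Surjective ρ ∧
      (∀ c, ι c = HH.diagonalMap k A B M N 0 c) ∧
      (∀ (f : AA ⟶ AA) (x : HH.Corners M N),
        HH.unBimod (nabla (CategoryTheory.Abelian.Ext.mk₀ f) (HH.toBimod x)) =
          op (HH.unReg (f (HH.toReg 1))) • x - HH.unReg (f (HH.toReg 1)) • x) ∧
      (∀ c, ρ c = HH.diagonalMap k A B M N 1 c)) := by
  have he : ((1, 0) : A × B) * (1, 0) = (1, 0) := by simp
  have hc : ∀ r : A × B, (1, 0) * r = r * (1, 0) := fun r => by ext <;> simp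
  -- the idempotent `(1, 0)` acts on `M` from the right and on `N` from the left
  have heX : ∀ x : HH.Corners M N, ((1, 0) : A × B) • x + op ((1, 0) : A × B) • x = x := fun x =>
    show (((0 : B) • x.1 + (1 : Aᵐᵒᵖ) • x.1, (1 : A) • x.2 + (0 : Bᵐᵒᵖ) • x.2) : M × N) = x by
      simp
      rfl
  refine ⟨fun m hm => ?_, HH.retractLinear k (A × B) (HH.Corners M N) 0,
    HH.commutatorZero k (A × B) (HH.Corners M N), HH.connectingOne k (A × B) (HH.Corners M N),
    HH.retractLinear k (A × B) (HH.Corners M N) 1,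
    HH.retractLinear_zero_injective he hc heX, HH.retractLinear_exact_zero he hc heX,
    HH.commutatorZero_exact hproj he hc heX, HH.connectingOne_exact hproj he hc heX,
    HH.retractLinear_surjective hproj 0, fun _ => rfl, HH.commutatorZero_apply, fun _ => rfl⟩
  obtain ⟨m, rfl⟩ : ∃ l, m = l + 1 := ⟨m - 1, by omega⟩
  obtain ⟨ι, hι, hex, hfst⟩ := HH.exists_exact_even hproj he hc heX m
  have hcomm := HH.commutator_exact hproj he hc heX (m + 1)
  refine ⟨ι, _, HH.connecting k (A × B) (HH.Corners M N) (2 * (m + 1) + 1),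
    HH.retractLinear k (A × B) (HH.Corners M N) (2 * (m + 1) + 1), hι, hex, fun ψ => ?_,
    HH.connecting_exact hproj he hc heX (m + 1), HH.retractLinear_surjective hproj (2 * (m + 1)),
    hfst, fun c φ x => HH.commutator_pureTensor φ x, fun _ => rfl⟩
  rw [hcomm ψ]
  exact ⟨fun ⟨φ, h⟩ => ⟨(0, φ), h⟩, fun ⟨c, h⟩ => ⟨c.2, h⟩⟩
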